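/- Let $G$ be a compact connected semisimple Lie group with Lie algebra $\mathfrak g$, and let $\mathrm{Kil}$ be the negative of the Killing form of $\mathfrak g$. Let $\mu_\diamond\in\mathfrak g'$, let $K$ be its stabilizer for the coadjoint action, with Lie algebra $\mathfrak k$, so that $G/K$ is the coadjoint orbit of $\mu_\diamond$, and let $\mathfrak m=\mathfrak k^\perp$ with respect to $\mathrm{Kil}$. Vector fields on $G/K$ are the elements of $$\mathcal T(G/K)=\{V\in C^\infty(G,\mathfrak m): V(xs)=\mathrm{Ad}_s^{-1}(V(x)),\ x\in G,\ s\in K\},$$ and $V$ acts on $C^\infty(G/K)$ (right $K$-invariant smooth functions on $G$) by $(\delta_Vf)(x)=\frac{d}{dt}\big|_{t=0}f(x\exp(tV(x)))$. **Kähler structure.** Let $\omega_\diamond(X,Y)=\mu_\diamond([X,Y])$ on $\mathfrak m$, let $\Gamma_\diamond$ be the operator on $\mathfrak m$ with $\omega_\diamond(X,Y)=\mathrm{Kil}(\Gamma_\diamond X,Y)$, let $\Gamma_\diamond=|\Gamma_\diamond|J_\diamond$ be its polar decomposition with respect to $\mathrm{Kil}$, and let $g_\diamond(X,Y)=\omega_\diamond(X,J_\diamond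 Y)$. Then $(g_\diamond,J_\diamond)$ is well defined and unique, $g_\diamond$ is an $\mathrm{Ad}(K)$-invariant inner product on $\mathfrak m$, and $J_\diamond$ is a $g_\diamond$-orthogonal complex structure ($J_\diamond^2=-1$) commuting with $\mathrm{Ad}(K)$. Applied pointwise to $\mathcal T(G/K)$, they are a Riemannian metric and an almost complex structure on $G/K$. **Levi-Civita connection.** Let $(\nabla^c_VW)(x)=\frac{d}{dt}\big|_{t=0}W(x\exp(tV(x)))$ be the canonical connection. There is exactly one connection $\nabla^\diamond=\nabla^c+L$ on $\mathcal T(G/K)$, with $L$ a tensor field, $(L_VW)(x)=L(x)(V(x),W(x))$, that is compatible with $g_\diamond$ and torsion free; and every $\nabla^\diamond_V$ (hence every $L_V$) commutes with $J_\diamond$. **Dirac operator.** Let $\mathfrak m_J$ be $\mathfrak m$ as a complex vector space by means of $J_\diamond$, with the inner product $\langle X,Y\rangle_J=g_\diamond(X,Y)+i\,g_\diamond(J_\diamond X,Y)$, linear in $Y$, and let $\mathcal S=\bigwedge^*\mathfrak m_J$ be the complex exterior algebra with the inner product $\langle X_1\wedge\dots\wedge X_p,Y_1\wedge\dots\wedge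 Y_q\rangle=\delta_{pq}\det[\langle X_k,Y_l\rangle_J]$. For $X\in\mathfrak m$ let $\kappa(X)=i(a(X)+a^\dagger(X))$, where $a^\dagger(X)\xi=X\wedge\xi$ and $a(X)(X_1\wedge\dots\wedge X_p)=\sum_j(-1)^{j-1}\langle X,X_j\rangle_J\,X_1\wedge\dots\wedge\widehat{X_j}\wedge\dots\wedge X_p$. Let $\widetilde{\mathrm{Ad}}$ be the action of $K$ on $\mathcal S$ by algebra automorphisms extending $\mathrm{Ad}$ on $\mathfrak m$. For a character (continuous homomorphism) $\chi:K\to\mathbb T$ put $$\mathcal S(G/K,\chi)=\{\psi\in C^\infty(G,\mathcal S):\psi(xs)=\overline{\chi(s)}\,\widetilde{\mathrm{Ad}}_s^{-1}(\psi(x)),\ x\in G,\ s\in K\}.$$ For $X\in\mathfrak m$ let $(\nabla^{\mathcal S}_X\psi)(x)=\frac{d}{dt}\big|_{t=0}\psi(x\exp(tX))+L^{\mathcal S}_X(x)\psi(x)$, where $L^{\mathcal S}_X(x)$ is the derivation of the exterior algebra $\mathcal S$ extending the complex linear operator $L(x)(X,\cdot)$ on $\mathfrak m_J$, and let $$D^\diamond\psi=\kappa(\mathrm{grad}\,\psi)=\sum_i\kappa(b_i)\,\nabla^{\mathcal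 S}_{b^i}\psi,$$ where $(b_i)$ is a basis of $\mathfrak m$ and $(b^i)$ is its dual basis for $g_\diamond$. **Conclusion.** For every character $\chi$ of $K$ the operator $D^\diamond$ maps $\mathcal S(G/K,\chi)$ into itself and is formally self-adjoint: for all $\psi,\varphi\in\mathcal S(G/K,\chi)$ and every Haar measure on $G$, $$\int_G\langle (D^\diamond\psi)(x),\varphi(x)\rangle\,dx=\int_G\langle\psi(x),(D^\diamond\varphi)(x)\rangle\,dx.$$ -/

import Mathlib

open scoped Manifold ContDiff ComplexConjugate

set_option linter.unusedSectionVars false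

noncomputable section

namespace CoadjointDirac

/-! ### Fock space -/

section Fock

variable {M : Type*} [AddCommGroup M] [Module ℂ M]

/-- The complex exterior algebra of a complex vector space (the unpolarized Fock space). -/
abbrev Fock (M : Type*) [AddCommGroup M] [Module ℂ M] : Type _ := ExteriorAlgebra ℂ M

/-- The annihilation operator `a(X)`:
`a(X)(X₁ ∧ ⋯ ∧ Xₚ) = ∑ⱼ (-1)^(j-1) ⟨X, Xⱼ⟩ X₁ ∧ ⋯ ∧ X̂ⱼ ∧ ⋯ ∧ Xₚ`, for a sesquilinear form `B = ⟨·,·⟩` that is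
linear in the second variable. -/
def annih (B : M →ₗ⋆[ℂ] M →ₗ[ℂ] ℂ) (X : M) : Fock M →ₗ[ℂ] Fock M :=
  CliffordAlgebra.contractLeft (B X)

/-- The creation operator `a†(X) : ξ ↦ X ∧ ξ`. -/
def creat (X : M) : Fock M →ₗ[ℂ] Fock M :=
  LinearMap.mulLeft ℂ (ExteriorAlgebra.ι ℂ X)

/-- Clifford multiplication `κ(X) = i (a(X) + a†(X))`. -/
def cliff (B : M →ₗ⋆[ℂ] M →ₗ[ℂ] ℂ) (X : M) : Fock M →ₗ[ℂ] Fock M :=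
  Complex.I • (annih B X + creat X)

/-- The opposite of a complex algebra `A`, with complex scalars acting through conjugation; a conjugate
linear, product reversing map into `A` is the same as an algebra homomorphism into `ConjOp A`. -/
def ConjOp (A : Type*) : Type _ := Aᵐᵒᵖ
instance {A : Type*} [Ring A] : Ring (ConjOp A) := inferInstanceAs (Ring Aᵐᵒᵖ)
instance {A : Type*} [Ring A] [Algebra ℂ A] : Algebra ℂ (ConjOp A) :=
  Algebra.compHom Aᵐᵒᵖ (starRingEnd ℂ)

/-- The conjugate linear map `X₁ ∧ ⋯ ∧ Xₚ ↦ a(Xₚ) ∘ ⋯ ∘ a(X₁)`. -/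
def annihWord (B : M →ₗ⋆[ℂ] M →ₗ[ℂ] ℂ) :
    Fock M →ₐ[ℂ] ConjOp (Module.End ℂ (Fock M)) :=
  ExteriorAlgebra.lift ℂ
    ⟨{ toFun := fun X ↦ MulOpposite.op (annih B X)
       map_add' := fun X Y ↦ by
        simp only [annih, map_add, MulOpposite.op_add]; rfl
       map_smul' := fun c X ↦ by
        simp only [annih, map_smulₛₗ, MulOpposite.op_smul]; rfl }, fun X ↦ by
        refine MulOpposite.unop_injective (LinearMap.ext fun ξ ↦ ?_)
        exact CliffordAlgebra.contractLeft_contractLeft (B X) ξ⟩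

/-- The sesquilinear form on the exterior algebra induced by a sesquilinear form `B` on the vector
space: `⟨X₁ ∧ ⋯ ∧ Xₚ, η⟩` is the component in degree `0` of `a(Xₚ) ⋯ a(X₁) η`. It is the form with
`⟨X₁ ∧ ⋯ ∧ Xₚ, Y₁ ∧ ⋯ ∧ Y_q⟩ = δ_{pq} det (B (X k) (Y l))`; see `fockInner_ιMulti` and
`fockInner_ιMulti_of_ne`, which determine it. -/
def fockInner (B : M →ₗ⋆[ℂ] M →ₗ[ℂ] ℂ) : Fock M →ₗ⋆[ℂ] Fock M →ₗ[ℂ] ℂ :=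
  LinearMap.mk₂'ₛₗ (starRingEnd ℂ) (RingHom.id ℂ)
    (fun ξ η ↦ ExteriorAlgebra.algebraMapInv (MulOpposite.unop (annihWord B ξ) η))
    (fun ξ ξ' η ↦ by
      rw [map_add]
      exact map_add (ExteriorAlgebra.algebraMapInv (R := ℂ) (M := M)) _ _)
    (fun c ξ η ↦ by
      rw [map_smul]
      exact map_smul (ExteriorAlgebra.algebraMapInv (R := ℂ) (M := M)) (starRingEnd ℂ c) _)
    (fun ξ η η' ↦ by rw [map_add, map_add])
    (fun c ξ η ↦ by rw [map_smul, map_smul]; rfl)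

theorem annih_ιMulti (B : M →ₗ⋆[ℂ] M →ₗ[ℂ] ℂ) (X : M) {p : ℕ} (Y : Fin (p + 1) → M) :
    annih B X (ExteriorAlgebra.ιMulti ℂ (p + 1) Y) =
      ∑ j : Fin (p + 1), ((-1) ^ (j : ℕ) * B X (Y j)) •
        ExteriorAlgebra.ιMulti ℂ p (fun k ↦ Y (j.succAbove k)) := by
  induction p with
  | zero =>
    simp [annih, ExteriorAlgebra.ιMulti_succ_apply, CliffordAlgebra.contractLeft_ι, Algebra.smul_def]
  | succ p ih =>
    have h : annih B X (ExteriorAlgebra.ι ℂ (Y 0) * ExteriorAlgebra.ιMulti ℂ (p + 1) (Matrix.vecTail Y)) =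
       B X (Y 0) • ExteriorAlgebra.ιMulti ℂ (p + 1) (Matrix.vecTail Y) -
         ExteriorAlgebra.ι ℂ (Y 0) * annih B X (ExteriorAlgebra.ιMulti ℂ (p + 1) (Matrix.vecTail Y)) :=
      CliffordAlgebra.contractLeft_ι_mul (B X) (Y 0) _
    rw [ExteriorAlgebra.ιMulti_succ_apply, h, ih, Fin.sum_univ_succ (n := p + 1), sub_eq_add_neg,
      Finset.mul_sum, ← Finset.sum_neg_distrib]
    congr 1
    · simp [Matrix.vecTail, Function.comp_def]
    · refine Finset.sum_congr rfl fun j _ ↦ ?_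
      rw [ExteriorAlgebra.ιMulti_succ_apply, mul_smul_comm, ← neg_smul]
      simp [Matrix.vecTail, Function.comp_def, pow_succ]

theorem fockInner_zero (B : M →ₗ⋆[ℂ] M →ₗ[ℂ] ℂ) (X : Fin 0 → M) (η : Fock M) :
    fockInner B (ExteriorAlgebra.ιMulti ℂ 0 X) η = ExteriorAlgebra.algebraMapInv η := by
  rw [ExteriorAlgebra.ιMulti_zero_apply]
  simp only [fockInner, LinearMap.mk₂'ₛₗ_apply, map_one]
  rfl

theorem fockInner_succ (B : M →ₗ⋆[ℂ] M →ₗ[ℂ] ℂ) {p : ℕ} (X : Fin (p + 1) → M) (η : Fock M) :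
    fockInner B (ExteriorAlgebra.ιMulti ℂ (p + 1) X) η =
      fockInner B (ExteriorAlgebra.ιMulti ℂ p (Matrix.vecTail X)) (annih B (X 0) η) := by
  rw [ExteriorAlgebra.ιMulti_succ_apply]
  simp only [fockInner, LinearMap.mk₂'ₛₗ_apply, map_mul]
  have : annihWord B (ExteriorAlgebra.ι ℂ (X 0)) = MulOpposite.op (annih B (X 0)) := by
    exact ExteriorAlgebra.lift_ι_apply ℂ _ _ _
  rw [this]
  rfl

theorem fockInner_ιMulti (B : M →ₗ⋆[ℂ] M →ₗ[ℂ] ℂ) {p : ℕ} (X Y : Fin p → M) :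
    fockInner B (ExteriorAlgebra.ιMulti ℂ p X) (ExteriorAlgebra.ιMulti ℂ p Y) =
      Matrix.det (Matrix.of fun k l ↦ B (X k) (Y l)) := by
  induction p with
  | zero => rw [fockInner_zero]; simp
  | succ p ih =>
    rw [fockInner_succ, annih_ιMulti, map_sum, Matrix.det_succ_row_zero]
    refine Finset.sum_congr rfl fun j _ ↦ ?_
    rw [map_smul, ih]
    rfl

theorem fockInner_ιMulti_of_ne (B : M →ₗ⋆[ℂ] M →ₗ[ℂ] ℂ) {p q : ℕ} (hpq : p ≠ q)
    (X : Fin p → M) (Y : Fin q → M) :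
    fockInner B (ExteriorAlgebra.ιMulti ℂ p X) (ExteriorAlgebra.ιMulti ℂ q Y) = 0 := by
  induction p generalizing q with
  | zero =>
    obtain ⟨q, rfl⟩ := Nat.exists_eq_succ_of_ne_zero hpq.symm
    rw [fockInner_zero, ExteriorAlgebra.ιMulti_succ_apply, map_mul]
    simp [ExteriorAlgebra.algebraMapInv]
  | succ p ih =>
    rw [fockInner_succ]
    cases q with
    | zero =>
      rw [ExteriorAlgebra.ιMulti_zero_apply]
      have : annih B (X 0) 1 = 0 := CliffordAlgebra.contractLeft_one _ _
      rw [this, map_zero]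
    | succ q =>
      rw [annih_ιMulti, map_sum]
      refine Finset.sum_eq_zero fun j _ ↦ ?_
      rw [map_smul, ih (by omega), smul_zero]

/-- The algebra homomorphism `ξ ↦ ξ + ε (T ξ)`, where `T` also denotes the extension of `T` to a
derivation. -/
def dualHom (T : M →ₗ[ℂ] M) : Fock M →ₐ[ℂ] DualNumber (Fock M) :=
  ExteriorAlgebra.lift ℂ
    ⟨{ toFun := fun X ↦ TrivSqZeroExt.inl (ExteriorAlgebra.ι ℂ X) +
          TrivSqZeroExt.inr (ExteriorAlgebra.ι ℂ (T X))
       map_add' := fun X Y ↦ by ext <;> simp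
       map_smul' := fun c X ↦ by ext <;> simp }, fun X ↦ by
        ext <;> simp [ExteriorAlgebra.ι_add_mul_swap]⟩

/-- The extension of a linear map `T` to a derivation of the exterior algebra; it is determined by
`extDer_ι` and `extDer_mul`. -/
def extDer (T : M →ₗ[ℂ] M) : Fock M →ₗ[ℂ] Fock M :=
  (TrivSqZeroExt.sndHom (Fock M) (Fock M)).restrictScalars ℂ ∘ₗ (dualHom T).toLinearMap

theorem fst_dualHom (T : M →ₗ[ℂ] M) (ξ : Fock M) : (dualHom T ξ).fst = ξ := by
  have : (TrivSqZeroExt.fstHom ℂ (Fock M) (Fock M)).comp (dualHom T) = AlgHom.id ℂ (Fock M) := by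
    ext X; simp [dualHom]
  exact congrArg (fun f ↦ f ξ) this

theorem extDer_ι (T : M →ₗ[ℂ] M) (X : M) :
    extDer T (ExteriorAlgebra.ι ℂ X) = ExteriorAlgebra.ι ℂ (T X) := by
  simp [extDer, dualHom]

theorem extDer_mul (T : M →ₗ[ℂ] M) (ξ η : Fock M) :
    extDer T (ξ * η) = extDer T ξ * η + ξ * extDer T η := by
  simp [extDer, fst_dualHom, add_comm]

/-- The Clifford relation. -/
theorem cliff_cliff (B : M →ₗ⋆[ℂ] M →ₗ[ℂ] ℂ) (X Y : M) (ξ : Fock M) :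
    cliff B X (cliff B Y ξ) + cliff B Y (cliff B X ξ) = -(B X Y + B Y X) • ξ := by
  have h1 : ∀ U V : M, annih B U (creat V ξ) = B U V • ξ - creat V (annih B U ξ) := fun U V ↦
    CliffordAlgebra.contractLeft_ι_mul (B U) V ξ
  have h2 : annih B X (annih B Y ξ) = -annih B Y (annih B X ξ) :=
    CliffordAlgebra.contractLeft_comm (B X) (B Y) ξ
  have h3 : creat X (creat Y ξ) = -creat Y (creat X ξ) := by
    rw [eq_neg_iff_add_eq_zero]
    change ExteriorAlgebra.ι ℂ X * (ExteriorAlgebra.ι ℂ Y * ξ) +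
      ExteriorAlgebra.ι ℂ Y * (ExteriorAlgebra.ι ℂ X * ξ) = 0
    rw [← mul_assoc, ← mul_assoc, ← add_mul, ExteriorAlgebra.ι_add_mul_swap, zero_mul]
  simp only [cliff, LinearMap.smul_apply, LinearMap.add_apply, map_smul, map_add, smul_smul,
    smul_add, Complex.I_mul_I, h1, h2, h3]
  module

instance [Module.Finite ℂ M] : Module.Finite ℂ (Fock M) :=
  Module.Finite.of_basis (Module.finBasis ℂ M).ExteriorAlgebra
end Fock

/-! ### The adjoint representation -/

section LieGroup

variable {n : ℕ} {G : Type*} [TopologicalSpace G] [ChartedSpace (EuclideanSpace ℝ (Fin n)) G]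
  [Group G]

theorem three_le : (3 : ℕ∞ω) ≤ ∞ := WithTop.coe_le_coe.2 (le_top : (3 : ℕ∞) ≤ ⊤)

instance instLieGroupMinSmoothness [LieGroup (𝓡 n) ∞ G] :
    LieGroup (𝓡 n) (minSmoothness ℝ 3) G :=
  LieGroup.of_le (n := ∞) (by
    rw [minSmoothness_of_isRCLikeNormedField]; exact three_le)

variable (n G) in
/-- The Lie algebra `𝔤` of `G`. -/
abbrev LieAlg : Type := GroupLieAlgebra (𝓡 n) G

instance : FiniteDimensional ℝ (LieAlg n G) :=
  inferInstanceAs (FiniteDimensional ℝ (EuclideanSpace ℝ (Fin n)))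

variable (n) in
/-- `Ad_s`, the differential at the identity of `x ↦ s x s⁻¹`. (Since `s 1 s⁻¹ = 1`, its values are in
the tangent space at the identity.) -/
def AdCLM (s : G) : LieAlg n G →L[ℝ] LieAlg n G :=
  mfderiv (𝓡 n) (𝓡 n) (fun x : G ↦ s * x * s⁻¹) 1

variable [LieGroup (𝓡 n) ∞ G]

variable (n) in
theorem conj_contMDiff (s : G) : ContMDiff (𝓡 n) (𝓡 n) ∞ (fun x : G ↦ s * x * s⁻¹) :=
    (contMDiff_mul_right (a := s⁻¹)).comp (contMDiff_mul_left (a := s))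

variable (n) in
theorem conj_mdiff (s x : G) : MDifferentiableAt (𝓡 n) (𝓡 n) (fun x : G ↦ s * x * s⁻¹) x := 
  (conj_contMDiff n s).contMDiffAt.mdifferentiableAt (by simp)


variable (n) in
theorem mfderiv_congr_base (f : G → G) {y z : G} (h : y = z) (v : EuclideanSpace ℝ (Fin n)) :
    (id (mfderiv (𝓡 n) (𝓡 n) f y v) : EuclideanSpace ℝ (Fin n)) = mfderiv (𝓡 n) (𝓡 n) f z v := by
  subst h; rfl

theorem AdFun_mul (s t : G) (X : LieAlg n G) : AdCLM n (s * t) X = AdCLM n s (AdCLM n t X) := by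
  have h : (fun x : G ↦ (s * t) * x * (s * t)⁻¹) = (fun x : G ↦ s * x * s⁻¹) ∘ (fun x ↦ t * x * t⁻¹) := by
    funext x; simp [mul_assoc]
  have := mfderiv_comp_apply (I := 𝓡 n) (I' := 𝓡 n) (I'' := 𝓡 n) 1
    (conj_mdiff n s (t * 1 * t⁻¹)) (conj_mdiff n t 1) X
  rw [← h] at this
  exact this.trans (mfderiv_congr_base n _ (by simp) _)

theorem AdFun_one (X : LieAlg n G) : AdCLM n (1 : G) X = X := by
  have h : (fun x : G ↦ 1 * x * 1⁻¹) = id := by funext x; simp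
  unfold AdCLM
  rw [h, mfderiv_id]
  rfl

theorem mfderiv_conj_mulInvariantVectorField (s h : G) (X : LieAlg n G) :
    mfderiv (𝓡 n) (𝓡 n) (fun x : G ↦ s * x * s⁻¹) h (mulInvariantVectorField X h) =
      mulInvariantVectorField (AdCLM n s X) (s * h * s⁻¹) := by
  have hL : ∀ a y : G, MDifferentiableAt (𝓡 n) (𝓡 n) (fun x : G ↦ a * x) y := fun a y ↦
    (contMDiff_mul_left (I := 𝓡 n) (n := ∞) (a := a)).contMDiffAt.mdifferentiableAt (by simp)
  have e : (fun x : G ↦ s * x * s⁻¹) ∘ (fun x ↦ h * x) =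
      (fun x ↦ (s * h * s⁻¹) * x) ∘ (fun x : G ↦ s * x * s⁻¹) := by
    funext x; simp [mul_assoc]
  have h1 := mfderiv_comp_apply (I := 𝓡 n) (I' := 𝓡 n) (I'' := 𝓡 n) 1
    (conj_mdiff n s (h * 1)) (hL h 1) X
  have h2 := mfderiv_comp_apply (I := 𝓡 n) (I' := 𝓡 n) (I'' := 𝓡 n) 1
    (hL (s * h * s⁻¹) (s * 1 * s⁻¹)) (conj_mdiff n s 1) X
  rw [e] at h1
  exact (mfderiv_congr_base n _ (mul_one h).symm _).trans
    ((h1.symm.trans h2).trans (mfderiv_congr_base n _ (by simp) _))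

theorem AdCLM_lie (s : G) (X Y : LieAlg n G) : AdCLM n s ⁅X, Y⁆ = ⁅AdCLM n s X, AdCLM n s Y⁆ := by
  set f : G → G := fun x ↦ s * x * s⁻¹ with hf
  have hinv : ∀ h : G, (mfderiv (𝓡 n) (𝓡 n) f h).IsInvertible := by
    intro h
    have e1 : (fun x : G ↦ s⁻¹ * x * s⁻¹⁻¹) ∘ f = id := by funext x; simp [hf, mul_assoc]
    have e2 : f ∘ (fun x : G ↦ s⁻¹ * x * s⁻¹⁻¹) = id := by funext x; simp [hf, mul_assoc]
    let Φ : Diffeomorph (𝓡 n) (𝓡 n) G G ∞ :=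
      { toFun := f
        invFun := fun x ↦ s⁻¹ * x * s⁻¹⁻¹
        left_inv := congrFun e1
        right_inv := congrFun e2
        contMDiff_toFun := conj_contMDiff n s
        contMDiff_invFun := conj_contMDiff n s⁻¹ }
    exact ⟨Φ.mfderivToContinuousLinearEquiv (by simp) h, rfl⟩
  have hp : ∀ X : LieAlg n G, VectorField.mpullback (𝓡 n) (𝓡 n) f
      (mulInvariantVectorField (AdCLM n s X)) = mulInvariantVectorField X := by
    intro X
    funext h
    rw [VectorField.mpullback_apply, ← mfderiv_conj_mulInvariantVectorField s h X]
    exact (hinv h).inverse_apply_eq.2 rfl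
  have h1 : (1 : G) = f 1 := by simp [hf]
  have key := VectorField.mpullback_mlieBracket (I := 𝓡 n) (I' := 𝓡 n) (f := f) (x₀ := 1) (n := ∞)
    (V := mulInvariantVectorField (AdCLM n s X)) (W := mulInvariantVectorField (AdCLM n s Y))
    (mdifferentiableAt_mulInvariantVectorField _) (mdifferentiableAt_mulInvariantVectorField _)
    (conj_contMDiff n s).contMDiffAt
    (by rw [minSmoothness_of_isRCLikeNormedField]; exact le_trans (by norm_num) three_le)
  rw [hp, hp, VectorField.mpullback_apply] at key
  have k2 := (hinv 1).inverse_apply_eq.1 key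
  have h3 : ∀ y : G, y = 1 → (id (VectorField.mlieBracket (𝓡 n) (mulInvariantVectorField (AdCLM n s X))
      (mulInvariantVectorField (AdCLM n s Y)) y) : EuclideanSpace ℝ (Fin n)) =
      ⁅AdCLM n s X, AdCLM n s Y⁆ := by rintro y rfl; rfl
  exact k2.symm.trans (h3 _ h1.symm)

variable (n G) in
/-- The adjoint representation. -/
def Ad : Representation ℝ G (LieAlg n G) where
  toFun s := AdCLM n s
  map_one' := LinearMap.ext AdFun_one
  map_mul' s t := LinearMap.ext (AdFun_mul s t)

variable (n G) in
/-- The coadjoint representation on the dual space `𝔤'`. -/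
def coAd : Representation ℝ G (Module.Dual ℝ (LieAlg n G)) := (Ad n G).dual

variable (n G) in
/-- The negative of the Killing form. -/
def Kil : LinearMap.BilinForm ℝ (LieAlg n G) := -killingForm ℝ (LieAlg n G)

variable (μ : Module.Dual ℝ (LieAlg n G))

/-- `K`, the stabilizer of `μ` for the coadjoint action. -/
def stab : Subgroup G where
  carrier := {s | coAd n G s μ = μ}
  one_mem' := by simp
  mul_mem' {s t} hs ht := by
    simp only [Set.mem_ofPred_eq] at hs ht ⊢
    rw [map_mul, Module.End.mul_apply, ht, hs]
  inv_mem' {s} hs := by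
    simp only [Set.mem_ofPred_eq] at hs ⊢
    conv_lhs => rw [← hs]
    rw [← Module.End.mul_apply, ← map_mul]; simp

variable (n) in
/-- The velocity at time `0` of a curve, as a vector of the model space of the tangent space at its
initial point. -/
def velocity (γ : ℝ → G) : EuclideanSpace ℝ (Fin n) := mfderiv 𝓘(ℝ, ℝ) (𝓡 n) γ 0 (1 : ℝ)

/-- `𝔨`, the Lie algebra of the closed subgroup `K`: the velocities at the identity of curves in `K`. -/
def kLie : Set (LieAlg n G) :=
  {X | ∃ γ : ℝ → G, γ 0 = 1 ∧ (∀ t, γ t ∈ stab μ) ∧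
    MDifferentiableAt 𝓘(ℝ, ℝ) (𝓡 n) γ 0 ∧ velocity n γ = X}

/-- `𝔪 = 𝔨^⊥`, the orthogonal complement for `Kil`. -/
def mSub : Submodule ℝ (LieAlg n G) where
  carrier := {Y | ∀ X ∈ kLie μ, Kil n G X Y = 0}
  zero_mem' := by simp
  add_mem' := fun hY hY' X hX ↦ by rw [map_add, hY X hX, hY' X hX, add_zero]
  smul_mem' := fun c Y hY X hX ↦ by rw [map_smul, hY X hX, smul_zero]

theorem Kil_Ad (s : G) (X Y : LieAlg n G) : Kil n G (Ad n G s X) (Ad n G s Y) = Kil n G X Y := by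
  let e : LieAlg n G ≃ₗ⁅ℝ⁆ LieAlg n G :=
    { toFun := Ad n G s
      invFun := Ad n G s⁻¹
      map_add' := map_add _
      map_smul' := map_smul _
      map_lie' := AdCLM_lie s _ _
      left_inv := fun X ↦ by rw [← Module.End.mul_apply, ← map_mul]; simp
      right_inv := fun X ↦ by rw [← Module.End.mul_apply, ← map_mul]; simp }
  have := LieAlgebra.killingForm_of_equiv_apply e X Y
  simp only [Kil, LinearMap.neg_apply]
  exact congrArg Neg.neg this

theorem Ad_mem_kLie {s : G} (hs : s ∈ stab μ) {X : LieAlg n G} (hX : X ∈ kLie μ) :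
    Ad n G s X ∈ kLie μ := by
  obtain ⟨γ, h0, hγ, hd, rfl⟩ := hX
  refine ⟨fun t ↦ s * γ t * s⁻¹, by simp [h0], fun t ↦ mul_mem (mul_mem hs (hγ t)) (inv_mem hs),
    (conj_mdiff n s (γ 0)).comp 0 hd, ?_⟩
  have := mfderiv_comp_apply (I := 𝓘(ℝ, ℝ)) (I' := 𝓡 n) (I'' := 𝓡 n) 0
    (conj_mdiff n s (γ 0)) hd (1 : ℝ)
  exact this.trans (mfderiv_congr_base n _ h0 _)

theorem Ad_mem_mSub {s : G} (hs : s ∈ stab μ) {Y : LieAlg n G} (hY : Y ∈ mSub μ) :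
    Ad n G s Y ∈ mSub μ := by
  intro X hX
  have := hY _ (Ad_mem_kLie μ (inv_mem hs) hX)
  rw [← Kil_Ad s, ← Module.End.mul_apply, ← map_mul] at this
  simpa using this

/-- The action `Ad` of `K` on `𝔪`. -/
def AdM (s : stab μ) : mSub μ →ₗ[ℝ] mSub μ :=
  (Ad n G s).restrict fun _ hY ↦ Ad_mem_mSub μ s.2 hY

/-- The Kirillov-Kostant-Souriau form `ω(X, Y) = μ([X, Y])` on `𝔪`. -/
def omega (X Y : mSub μ) : ℝ := μ ⁅(X : LieAlg n G), (Y : LieAlg n G)⁆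

/-- A `G`-invariant almost Hermitian structure on `G/K`: a `K`-invariant inner product `g` on `𝔪` and a
`K`-invariant complex structure `J` on `𝔪` that is orthogonal for `g`. -/
@[ext]
structure AlmostHermitian where
  /-- the inner product -/
  g : LinearMap.BilinForm ℝ (mSub μ)
  /-- the complex structure -/
  J : mSub μ →ₗ[ℝ] mSub μ
  g_symm : ∀ X Y, g X Y = g Y X
  g_pos : ∀ X, X ≠ 0 → 0 < g X X
  J_sq : ∀ X, J (J X) = -X
  g_J : ∀ X Y, g (J X) (J Y) = g X Y
  g_Ad : ∀ (s : stab μ) X Y, g (AdM μ s X) (AdM μ s Y) = g X Y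
  J_Ad : ∀ (s : stab μ) X, J (AdM μ s X) = AdM μ s (J X)

variable {μ}

/-- `h` is the canonical Kähler structure `(g_⋄, J_⋄)` of the coadjoint orbit of `μ`: if `Γ` is the
operator on `𝔪` with `ω(X, Y) = Kil(Γ X, Y)` and `Γ = |Γ| J` is its polar decomposition with respect to
`Kil` (with `|Γ|` self-adjoint and positive, and `J` orthogonal), then `J_⋄ = J` and
`g_⋄(X, Y) = ω(X, J Y)`. -/
def AlmostHermitian.IsCanonicalKahler (h : AlmostHermitian μ) : Prop :=
  (∃ Γ absΓ : mSub μ →ₗ[ℝ] mSub μ,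
    (∀ X Y : mSub μ, omega μ X Y = Kil n G (Γ X) Y) ∧
    (∀ X Y : mSub μ, Kil n G (absΓ X) Y = Kil n G X (absΓ Y)) ∧
    (∀ X : mSub μ, 0 ≤ Kil n G (absΓ X) X) ∧
    (∀ X Y : mSub μ, Kil n G (h.J X) (h.J Y) = Kil n G X Y) ∧
    Γ = absΓ ∘ₗ h.J) ∧
  ∀ X Y : mSub μ, h.g X Y = omega μ X (h.J Y)

/-! ### Smooth functions on `G` and left-invariant differentiation -/

section Smooth

variable (𝕜 : Type*) [RCLike 𝕜] {F : Type*} [AddCommGroup F] [Module 𝕜 F]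

variable (n) in
/-- Smoothness of a function on `G` with values in a finite-dimensional vector space: the composites
with all linear functionals (equivalently, all coordinates) are smooth. -/
def IsSmooth (ψ : G → F) : Prop :=
  ∀ ℓ : F →ₗ[𝕜] 𝕜, ContMDiff (𝓡 n) 𝓘(ℝ, 𝕜) ∞ (fun x ↦ ℓ (ψ x))

/-- The derivative at `t = 0` of `f (x exp (t X))` for a scalar function `f`, that is, the derivative of
`f` at `x` along the left-invariant vector field of `X`. -/
def leftDeriv (f : G → 𝕜) (x : G) (X : LieAlg n G) : 𝕜 :=
  mfderiv (𝓡 n) 𝓘(ℝ, 𝕜) f x (mulInvariantVectorField X x)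

/-- The derivative at `t = 0` of `ψ (x exp (t X))` for a function `ψ` with values in a finite-dimensional
vector space, computed in the coordinates of a basis. -/
def leftDerivVec [FiniteDimensional 𝕜 F] (ψ : G → F) (x : G) (X : LieAlg n G) : F :=
  ∑ i, leftDeriv 𝕜 (fun y ↦ (Module.finBasis 𝕜 F).coord i (ψ y)) x X • Module.finBasis 𝕜 F i

end Smooth

/-! ### Tangent fields and connections on `G/K` -/

variable (μ) in
/-- The elements of `A = C^∞(G/K)`, viewed as functions on `G`. -/
def IsBaseFunction (f : G → ℝ) : Prop :=
  ContMDiff (𝓡 n) 𝓘(ℝ, ℝ) ∞ f ∧ ∀ (x : G) (s : stab μ), f (x * s) = f x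

/-- The elements of the module `𝒯(G/K)` of smooth vector fields on `G/K`. -/
def IsTangentField (V : G → mSub μ) : Prop :=
  IsSmooth n ℝ V ∧ ∀ (x : G) (s : stab μ), V (x * s) = AdM μ s⁻¹ (V x)

/-- The derivation `δ_V` of `C^∞(G/K)` given by a vector field `V`. -/
def fieldDeriv (V : G → mSub μ) (f : G → ℝ) (x : G) : ℝ :=
  leftDeriv ℝ f x (V x : LieAlg n G)

/-- The canonical connection `∇^c` on `𝒯(G/K)`. -/
def canonicalConnection (V W : G → mSub μ) (x : G) : mSub μ :=
  leftDerivVec ℝ W x (V x : LieAlg n G)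

variable (μ) in
/-- A connection `∇` on `𝒯(G/K)`, given by its difference `L` from the canonical connection: a tensor
field such that `(∇_V W)(x) = (∇^c_V W)(x) + L(x)(V(x), W(x))` defines a vector field on `G/K` for all
vector fields `V` and `W` on `G/K`. -/
@[ext]
structure Connection where
  /-- the tensor field `L = ∇ - ∇^c` -/
  L : G → mSub μ →ₗ[ℝ] mSub μ →ₗ[ℝ] mSub μ
  isTangentField : ∀ V W : G → mSub μ, IsTangentField V → IsTangentField W →
    IsTangentField fun x ↦ canonicalConnection V W x + L x (V x) (W x)

namespace Connection

variable (c : Connection μ) (h : AlmostHermitian μ)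

/-- `∇_V W`. -/
def cov (V W : G → mSub μ) (x : G) : mSub μ :=
  canonicalConnection V W x + c.L x (V x) (W x)

/-- `∇` is compatible with the Riemannian metric. -/
def IsMetric : Prop :=
  ∀ U V W : G → mSub μ, IsTangentField U → IsTangentField V → IsTangentField W → ∀ x,
    fieldDeriv U (fun y ↦ h.g (V y) (W y)) x =
      h.g (c.cov U V x) (W x) + h.g (V x) (c.cov U W x)

/-- `∇` has torsion zero: `∇_V W - ∇_W V = [V, W]`, where the bracket is the commutator of vector fields
as derivations of `C^∞(G/K)`. -/
def IsTorsionFree : Prop :=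
  ∀ V W : G → mSub μ, IsTangentField V → IsTangentField W →
    ∀ f : G → ℝ, IsBaseFunction μ f → ∀ x,
      fieldDeriv (fun y ↦ c.cov V W y - c.cov W V y) f x =
        fieldDeriv V (fieldDeriv W f) x - fieldDeriv W (fieldDeriv V f) x

/-- `∇` is the Levi-Civita connection of the Riemannian metric. -/
def IsLeviCivita : Prop := c.IsMetric h ∧ c.IsTorsionFree

/-- Each `∇_V` commutes with `J`. -/
def CommutesWithJ : Prop :=
  ∀ V W : G → mSub μ, IsTangentField V → IsTangentField W → ∀ x,
    c.cov V (fun y ↦ h.J (W y)) x = h.J (c.cov V W x)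

/-- Each `L_V` commutes with `J`, that is, `∇` and `∇^c` differ by an operator commuting with `J`. -/
def TensorCommutesWithJ : Prop :=
  ∀ (x : G) (X Y : mSub μ), c.L x X (h.J Y) = h.J (c.L x X Y)

end Connection

/-! ### Spinors -/

namespace AlmostHermitian

variable (h : AlmostHermitian μ)

/-- `𝔪_J`: the space `𝔪` as a complex vector space, with multiplication by `i` given by `J`. -/
def MJ (_h : AlmostHermitian μ) : Type := mSub μ

instance : AddCommGroup h.MJ := inferInstanceAs (AddCommGroup (mSub μ))

/-- The identity map from `𝔪` to `𝔪_J`. -/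
def toMJ : mSub μ ≃+ h.MJ := AddEquiv.refl _

instance : Module ℂ h.MJ where
  smul c X := h.toMJ (c.re • h.toMJ.symm X + c.im • h.J (h.toMJ.symm X))
  one_smul X := by
    change h.toMJ ((1 : ℂ).re • h.toMJ.symm X + (1 : ℂ).im • h.J (h.toMJ.symm X)) = X
    simp
  mul_smul a b X := by
    apply h.toMJ.symm.injective
    change ((a * b).re • h.toMJ.symm X + (a * b).im • h.J (h.toMJ.symm X) : mSub μ) =
      a.re • (b.re • h.toMJ.symm X + b.im • h.J (h.toMJ.symm X)) +
        a.im • h.J (b.re • h.toMJ.symm X + b.im • h.J (h.toMJ.symm X))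
    simp only [Complex.mul_re, Complex.mul_im, map_add, map_smul, h.J_sq]
    module
  smul_zero c := by
    change h.toMJ (c.re • h.toMJ.symm 0 + c.im • h.J (h.toMJ.symm 0)) = 0
    simp
  smul_add c X Y := by
    apply h.toMJ.symm.injective
    change (c.re • (h.toMJ.symm X + h.toMJ.symm Y) + c.im • h.J (h.toMJ.symm X + h.toMJ.symm Y) :
      mSub μ) = (c.re • h.toMJ.symm X + c.im • h.J (h.toMJ.symm X)) +
        (c.re • h.toMJ.symm Y + c.im • h.J (h.toMJ.symm Y))
    simp only [map_add]
    module
  add_smul a b X := by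
    apply h.toMJ.symm.injective
    change ((a + b).re • h.toMJ.symm X + (a + b).im • h.J (h.toMJ.symm X) : mSub μ) =
      (a.re • h.toMJ.symm X + a.im • h.J (h.toMJ.symm X)) +
        (b.re • h.toMJ.symm X + b.im • h.J (h.toMJ.symm X))
    simp only [Complex.add_re, Complex.add_im]
    module
  zero_smul X := by
    change h.toMJ ((0 : ℂ).re • h.toMJ.symm X + (0 : ℂ).im • h.J (h.toMJ.symm X)) = 0
    simp

theorem smul_def (c : ℂ) (X : h.MJ) :
    c • X = h.toMJ (c.re • h.toMJ.symm X + c.im • h.J (h.toMJ.symm X)) := rfl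

instance : Module.Finite ℂ h.MJ := by
  let b := Module.finBasis ℝ (mSub μ)
  refine Module.finite_def.2 (Submodule.fg_def.2
    ⟨Set.range fun i ↦ h.toMJ (b i), Set.finite_range _, top_le_iff.1 fun X _ ↦ ?_⟩)
  have hX : X = ∑ i, ((b.repr (h.toMJ.symm X) i : ℝ) : ℂ) • h.toMJ (b i) := by
    apply h.toMJ.symm.injective
    rw [map_sum]
    conv_lhs => rw [← b.sum_repr (h.toMJ.symm X)]
    simp only [smul_def, Complex.ofReal_re, Complex.ofReal_im, zero_smul, add_zero,
      AddEquiv.symm_apply_apply]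
  rw [hX]
  exact Submodule.sum_mem _ fun i _ ↦ Submodule.smul_mem _ _ (Submodule.subset_span ⟨i, rfl⟩)

/-- The complex inner product `⟨X, Y⟩_J = g(X, Y) + i g(J X, Y)` on `𝔪_J`, linear in the second
variable. -/
def herm : h.MJ →ₗ⋆[ℂ] h.MJ →ₗ[ℂ] ℂ :=
  LinearMap.mk₂'ₛₗ (starRingEnd ℂ) (RingHom.id ℂ)
    (fun X Y ↦ (h.g (h.toMJ.symm X) (h.toMJ.symm Y) : ℂ) +
      Complex.I * (h.g (h.J (h.toMJ.symm X)) (h.toMJ.symm Y) : ℂ))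
    (fun X X' Y ↦ by simp; ring)
    (fun c X Y ↦ by
      simp only [smul_def, AddEquiv.symm_apply_apply, map_add, map_smul, h.J_sq]
      apply Complex.ext <;> simp)
    (fun X Y Y' ↦ by simp; ring)
    (fun c X Y ↦ by
      have e : h.g (h.toMJ.symm X) (h.J (h.toMJ.symm Y)) =
          -h.g (h.J (h.toMJ.symm X)) (h.toMJ.symm Y) := by
        rw [← h.g_J, h.J_sq]; simp
      simp only [smul_def, AddEquiv.symm_apply_apply, map_add, map_smul, h.g_J, e]
      apply Complex.ext <;> simp <;> ring)

/-- A real linear operator on `𝔪` that commutes with `J`, as a complex linear operator on `𝔪_J`. -/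
def complexify (T : mSub μ →ₗ[ℝ] mSub μ) (hT : ∀ X, T (h.J X) = h.J (T X)) :
    h.MJ →ₗ[ℂ] h.MJ where
  toFun X := h.toMJ (T (h.toMJ.symm X))
  map_add' X Y := by simp
  map_smul' c X := by simp [smul_def, hT]

/-- The space `𝒮 = ℱ(𝔪_J)` of spinors. -/
abbrev Spinor : Type := Fock h.MJ

/-- The action of `K` on spinors by algebra automorphisms extending the action `Ad` on `𝔪`. -/
def AdS (s : stab μ) : h.Spinor →ₐ[ℂ] h.Spinor :=
  ExteriorAlgebra.map (h.complexify (AdM μ s) fun X ↦ (h.J_Ad s X).symm)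

/-- The Clifford action `κ(X)` of `X ∈ 𝔪` on spinors. -/
def kappa (X : mSub μ) : h.Spinor →ₗ[ℂ] h.Spinor := cliff h.herm (h.toMJ X)

/-- The elements of `𝒮(G/K, χ)`, the spinor fields on `G/K` twisted by a character `χ` of `K`. -/
def IsSpinorField (χ : stab μ →ₜ* Circle) (ψ : G → h.Spinor) : Prop :=
  IsSmooth n ℂ ψ ∧
    ∀ (x : G) (s : stab μ), ψ (x * s) = (starRingEnd ℂ) (χ s : ℂ) • h.AdS s⁻¹ (ψ x)

/-- The inner product of spinor fields from `L²(G/K, 𝒮)`; the invariant measure on `G/K` is the image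
of a Haar measure `ν` on `G`. -/
def l2Inner [MeasurableSpace G] (ν : MeasureTheory.Measure G) (ψ φ : G → h.Spinor) : ℂ :=
  ∫ x, fockInner h.herm (ψ x) (φ x) ∂ν

theorem g_nondegenerate : h.g.Nondegenerate := by
  constructor
  · intro X hX
    by_contra h0
    exact (h.g_pos X h0).ne' (hX X)
  · intro X hX
    by_contra h0
    exact (h.g_pos X h0).ne' (hX X)

end AlmostHermitian

section Dirac

variable (h : AlmostHermitian μ) (c : Connection μ) (hc : c.TensorCommutesWithJ h)

/-- `∇^𝒮_X ψ (x)` for a tangent vector `X ∈ 𝔪` at `x`: the spinor connection is the sum of the canonical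
connection and of the derivation of the exterior algebra extending `L_X`. -/
def spinorConnection (ψ : G → h.Spinor) (x : G) (X : mSub μ) : h.Spinor :=
  leftDerivVec ℂ ψ x (X : LieAlg n G) + extDer (h.complexify (c.L x X) (hc x X)) (ψ x)

/-- The Dirac operator `D ψ = κ(grad ψ)`: with respect to a basis `(bᵢ)` of `𝔪` and its dual basis `(bⁱ)`
for the metric, the gradient is `∑ᵢ bᵢ ⊗ ∇^𝒮_{bⁱ} ψ`, and `D ψ = ∑ᵢ κ(bᵢ) ∇^𝒮_{bⁱ} ψ`. -/
def dirac (ψ : G → h.Spinor) (x : G) : h.Spinor :=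
  ∑ i, h.kappa (Module.finBasis ℝ (mSub μ) i)
    (spinorConnection h c hc ψ x
      (LinearMap.BilinForm.dualBasis h.g h.g_nondegenerate (Module.finBasis ℝ (mSub μ)) i))

/-- `D` maps `𝒮(G/K, χ)` into itself and is formally self-adjoint on it:
`⟨D ψ, φ⟩ = ⟨ψ, D φ⟩` for the inner product of `L²(G/K, 𝒮)`. -/
def IsFormallySelfAdjoint [MeasurableSpace G] (ν : MeasureTheory.Measure G)
    (χ : stab μ →ₜ* Circle) (D : (G → h.Spinor) → G → h.Spinor) : Prop :=
  (∀ ψ, h.IsSpinorField χ ψ → h.IsSpinorField χ (D ψ)) ∧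
    ∀ ψ φ, h.IsSpinorField χ ψ → h.IsSpinorField χ φ →
      h.l2Inner ν (D ψ) φ = h.l2Inner ν ψ (D φ)

end Dirac

end LieGroup

end CoadjointDirac

end

noncomputable section

namespace CoadjointDirac

/-! ### Calculus on `G` -/

section Calculus

variable {n : ℕ} {G : Type*} [TopologicalSpace G] [ChartedSpace (EuclideanSpace ℝ (Fin n)) G]
  [Group G] [LieGroup (𝓡 n) ∞ G] {𝕜 : Type*} [RCLike 𝕜]

/-! Positivity of `Kil` turns the problem into linear algebra on `𝔪`. Averaging over the compact
group gives an `ad`-invariant inner product, so each `ad X` is skew and `Kil(X, X) = -tr (ad X)²` is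
positive for `X ≠ 0` (`Kil_pos`). Hence `μ = Kil(Z, ·)` for some `Z`, the algebra `𝔨` is the
centralizer of `Z`, `𝔤 = 𝔪 ⊕ 𝔨`, and `Γ` is `ad Z` restricted to `𝔪`. It is skew, injective and
`Ad(K)`-equivariant, so its polar decomposition exists, is unique and commutes with `Ad(K)`
(`exists_polar`).

The canonical connection preserves the constant metric and has torsion `-[X, Y]_𝔪`. Being
Levi-Civita therefore means that each `L(x)_X` is `g`-skew and `L_X Y - L_Y X = [X, Y]_𝔪`
(`isLeviCivita_iff`). The Koszul formula solves this uniquely by a tensor `lcTensor` that does not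
depend on `x`.

`L` commutes with `J` for the usual Kähler reasons. Closedness of `ω` is the Jacobi identity. For
integrability, `Γ` is a derivation of `[·, ·]_𝔪`: if `Γ X = c J X` and `Γ Y = d J Y` with `c, d >
0`, then `u = [JX, JY]_𝔪 - [X, Y]_𝔪` and `v = [JX, Y]_𝔪 + [X, JY]_𝔪` satisfy `Γ v = (c + d) u` and
`Γ u = -(c + d) v`. So `J v = u`, which says that the Nijenhuis tensor vanishes
(`nijenhuis_eq_zero`).

For self-adjointness, `κ(X)` and the derivations `L^𝒮_X` are skew-adjoint, and `[L^𝒮_X, κ(Y)] =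
κ(L_X Y)`. In a `g`-orthonormal basis `e`, this makes `⟨Dψ, φ⟩ - ⟨ψ, Dφ⟩` the sum of `-∑ e_i ⟨ψ,
κ(e_i) φ⟩` and of `⟨ψ, κ(∑ L_{e_i} e_i) φ⟩` (`fockInner_dirac`). The second term is zero because
`g(∑ L_{e_i} e_i, Z)` is the trace of `Y ↦ [Z, Y]_𝔪`, which is skew for `Kil`. The first integrates
to zero because Haar measure on a compact group is right invariant (`integral_leftDeriv`). -/

variable (n G) in
theorem isManifold_lieGroup : IsManifold (𝓡 n) ∞ G :=
  (inferInstance : ContMDiffMul (𝓡 n) ∞ G).toIsManifold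

variable (n G) in
theorem isManifold_one_lieGroup : IsManifold (𝓡 n) 1 G :=
  have := isManifold_lieGroup n G
  IsManifold.of_le (n := ∞) (by exact_mod_cast le_top)

variable (n G) in
theorem isManifold_two_lieGroup : IsManifold (𝓡 n) 2 G :=
  have := isManifold_lieGroup n G
  IsManifold.of_le (n := ∞) (le_trans (by norm_num) three_le)

/-- Derivatives along left-invariant fields, `Ad` and integrals along translates are all treated as
partial derivatives of a smooth function on `G × ℝ`; this gives their smooth dependence on the
point. -/
theorem contMDiff_deriv_snd {F : G × ℝ → 𝕜}
    (hF : ContMDiff ((𝓡 n).prod 𝓘(ℝ, ℝ)) 𝓘(ℝ, 𝕜) ∞ F) :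
    ContMDiff ((𝓡 n).prod 𝓘(ℝ, ℝ)) 𝓘(ℝ, 𝕜) ∞
      (fun p : G × ℝ ↦ deriv (fun t ↦ F (p.1, t)) p.2) := by
  have := isManifold_lieGroup n G
  intro p₀
  have h := ContMDiffAt.mfderiv_apply (I := 𝓘(ℝ, ℝ)) (I' := 𝓘(ℝ, 𝕜)) (J := (𝓡 n).prod 𝓘(ℝ, ℝ))
    (J' := (𝓡 n).prod 𝓘(ℝ, ℝ)) (n := ∞) (m := ∞) (x₀ := p₀)
    (fun (p : G × ℝ) t ↦ F (p.1, t)) (Prod.snd : G × ℝ → ℝ) (id : G × ℝ → G × ℝ) (fun _ ↦ (1 : ℝ))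
    ((hF.comp ((contMDiff_fst.comp contMDiff_fst).prodMk contMDiff_snd)).contMDiffAt)
    contMDiff_snd.contMDiffAt contMDiff_id.contMDiffAt contMDiffAt_const (by simp)
  refine h.congr_of_eventuallyEq (Filter.Eventually.of_forall fun p ↦ ?_)
  simp only [inTangentCoordinates_model_space, mfderiv_eq_fderiv, id]
  rfl

variable (n) in
-- Such a curve replaces `t ↦ exp (t X)`: first derivatives at `0` see only the velocity, so a curve
-- that is a bounded oscillation in a chart does as well.
theorem exists_contMDiff_curve (X : LieAlg n G) :
    ∃ γ : ℝ → G, ContMDiff 𝓘(ℝ, ℝ) (𝓡 n) ∞ γ ∧ γ 0 = 1 ∧ velocity n γ = X := by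
  have := isManifold_lieGroup n G
  have := isManifold_one_lieGroup n G
  let X' : EuclideanSpace ℝ (Fin n) := X
  set φ := extChartAt (𝓡 n) (1 : G) with hφ
  obtain ⟨δ, hδ, hball⟩ := Metric.isOpen_iff.1 (isOpen_extChartAt_target (I := 𝓡 n) (1 : G))
    (φ 1) (mem_extChartAt_target 1)
  obtain ⟨ε, hε, hεX⟩ : ∃ ε : ℝ, 0 < ε ∧ ε * ‖X'‖ < δ := by
    refine ⟨δ / (‖X'‖ + 1), by positivity, ?_⟩
    rw [div_mul_eq_mul_div, div_lt_iff₀ (by positivity)]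
    nlinarith [norm_nonneg X']
  -- `ε sin (t / ε)` has derivative `1` at `0` and is bounded by `ε`, so the curve stays inside the
  -- chart for all times.
  let c : ℝ → EuclideanSpace ℝ (Fin n) := fun t ↦ φ 1 + (ε * Real.sin (t / ε)) • X'
  have hc : ContDiff ℝ ∞ c := by
    refine contDiff_const.add (ContDiff.smul (f := fun t ↦ ε * Real.sin (t / ε)) (g := fun _ ↦ X')
      ?_ contDiff_const)
    exact contDiff_const.mul (Real.contDiff_sin.comp (contDiff_id.div_const ε))
  have hcm : ∀ t, c t ∈ φ.target := by
    intro t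
    refine hball ?_
    rw [Metric.mem_ball, dist_eq_norm, add_sub_cancel_left, norm_smul, norm_mul,
      Real.norm_of_nonneg hε.le, Real.norm_eq_abs]
    refine lt_of_le_of_lt ?_ hεX
    have := Real.abs_sin_le_one (t / ε)
    calc ε * |Real.sin (t / ε)| * ‖X'‖ ≤ ε * 1 * ‖X'‖ := by gcongr
      _ = ε * ‖X'‖ := by ring
  have hcd : HasDerivAt c X' 0 := by
    have h1 : HasDerivAt (fun t : ℝ ↦ ε * Real.sin (t / ε)) 1 0 := by
      have := (((hasDerivAt_id (0 : ℝ)).div_const ε).sin).const_mul ε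
      simpa [hε.ne'] using this
    have h2 := (h1.smul_const X').const_add (φ 1)
    rwa [one_smul] at h2
  have hsm : ContMDiff 𝓘(ℝ, ℝ) (𝓡 n) ∞ (φ.symm ∘ c) :=
    (contMDiffOn_extChartAt_symm (1 : G)).comp_contMDiff hc.contMDiff hcm
  have hc0 : c 0 = φ 1 := by simp [c]
  refine ⟨φ.symm ∘ c, hsm, ?_, ?_⟩
  · rw [Function.comp_apply, hc0, hφ, extChartAt_to_inv]
  · have h1 : MDifferentiableAt 𝓘(ℝ, EuclideanSpace ℝ (Fin n)) (𝓡 n) φ.symm (c 0) := by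
      have := mdifferentiableWithinAt_extChartAt_symm (I := 𝓡 n) (hcm 0)
      rwa [modelWithCornersSelf_coe, Set.range_id, mdifferentiableWithinAt_univ] at this
    have h2 := mfderiv_comp_apply (I := 𝓘(ℝ, ℝ)) (I' := 𝓘(ℝ, EuclideanSpace ℝ (Fin n)))
      (I'' := 𝓡 n) 0 h1 hcd.differentiableAt.mdifferentiableAt (1 : ℝ)
    have h3 := mfderivWithin_range_extChartAt_symm (I := 𝓡 n) (x := (1 : G))
    rw [modelWithCornersSelf_coe, Set.range_id, mfderivWithin_univ] at h3
    have h4 : mfderiv 𝓘(ℝ, ℝ) 𝓘(ℝ, EuclideanSpace ℝ (Fin n)) c 0 (1 : ℝ) = X' := by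
      rw [mfderiv_eq_fderiv]
      exact hcd.deriv
    have h5 : ∀ v : EuclideanSpace ℝ (Fin n), v = φ 1 → 
      (mfderiv 𝓘(ℝ, EuclideanSpace ℝ (Fin n)) (𝓡 n) φ.symm v X' : EuclideanSpace ℝ (Fin n)) = X' := by
      rintro v rfl
      exact congrArg (fun f : EuclideanSpace ℝ (Fin n) →L[ℝ] EuclideanSpace ℝ (Fin n) ↦ f X') h3
    rw [h4] at h2
    exact h2.trans (h5 _ hc0)

theorem hasDerivAt_of_hasMFDerivAt {g : ℝ → 𝕜} {t : ℝ} {L : ℝ →L[ℝ] 𝕜}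
    (h : HasMFDerivAt 𝓘(ℝ, ℝ) 𝓘(ℝ, 𝕜) g t L) : HasDerivAt g (L 1) t := by
  have h2 : HasFDerivAt g L t := h.hasFDerivAt
  exact h2.hasDerivAt

theorem hasDerivAt_comp_curve {f : G → 𝕜} {γ : ℝ → G} {t : ℝ}
    (hf : MDifferentiableAt (𝓡 n) 𝓘(ℝ, 𝕜) f (γ t)) (hγ : MDifferentiableAt 𝓘(ℝ, ℝ) (𝓡 n) γ t) :
    HasDerivAt (fun s ↦ f (γ s))
      (mfderiv (𝓡 n) 𝓘(ℝ, 𝕜) f (γ t) (mfderiv 𝓘(ℝ, ℝ) (𝓡 n) γ t (1 : ℝ))) t := by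
  have h := HasMFDerivAt.comp t hf.hasMFDerivAt hγ.hasMFDerivAt
  exact hasDerivAt_of_hasMFDerivAt (𝕜 := 𝕜) (g := fun s ↦ f (γ s)) (L := (mfderiv (𝓡 n) 𝓘(ℝ, 𝕜) f (γ t)).comp
    (mfderiv 𝓘(ℝ, ℝ) (𝓡 n) γ t)) h

theorem hasDerivAt_comp_of_hasMFDerivAt {f : G → 𝕜} {γ : ℝ → G} {t : ℝ} {X : LieAlg n G}
    (hf : MDifferentiableAt (𝓡 n) 𝓘(ℝ, 𝕜) f (γ t))
    (hγ : HasMFDerivAt 𝓘(ℝ, ℝ) (𝓡 n) γ t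
      ((1 : ℝ →L[ℝ] ℝ).smulRight (mulInvariantVectorField X (γ t)))) :
    HasDerivAt (fun s ↦ f (γ s)) (leftDeriv 𝕜 f (γ t) X) t := by
  have h := hasDerivAt_comp_curve hf hγ.mdifferentiableAt
  rw [hγ.mfderiv] at h
  refine h.congr_deriv ?_
  unfold leftDeriv
  congr 1
  exact one_smul ℝ _

variable (n) in
theorem mdifferentiableAt_mul_left (a x : G) :
    MDifferentiableAt (𝓡 n) (𝓡 n) (fun y : G ↦ a * y) x :=
  (contMDiff_mul_left (I := 𝓡 n) (n := ∞) (a := a)).contMDiffAt.mdifferentiableAt (by simp)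

theorem leftDeriv_eq_mfderiv {f : G → 𝕜} (x : G)
    (hf : MDifferentiableAt (𝓡 n) 𝓘(ℝ, 𝕜) f x) (X : LieAlg n G) :
    leftDeriv 𝕜 f x X = mfderiv (𝓡 n) 𝓘(ℝ, 𝕜) (fun y ↦ f (x * y)) 1 X := by
  have hf' : MDifferentiableAt (𝓡 n) 𝓘(ℝ, 𝕜) f (x * 1) := by rwa [mul_one]
  have h := mfderiv_comp_apply (I := 𝓡 n) (I' := 𝓡 n) (I'' := 𝓘(ℝ, 𝕜)) 1 hf'
    (mdifferentiableAt_mul_left n x 1) X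
  refine Eq.trans ?_ h.symm
  unfold leftDeriv mulInvariantVectorField
  have : ∀ y : G, y = x → ∀ v : EuclideanSpace ℝ (Fin n),
    (mfderiv (𝓡 n) 𝓘(ℝ, 𝕜) f x v : 𝕜) = mfderiv (𝓡 n) 𝓘(ℝ, 𝕜) f y v := by rintro y rfl v; rfl
  exact this _ (mul_one x) _

theorem hasDerivAt_leftDeriv {f : G → 𝕜} {γ : ℝ → G} {X : LieAlg n G} (x : G)
    (hf : MDifferentiableAt (𝓡 n) 𝓘(ℝ, 𝕜) f x) (h0 : γ 0 = 1)
    (hγ : MDifferentiableAt 𝓘(ℝ, ℝ) (𝓡 n) γ 0) (hX : velocity n γ = X) :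
    HasDerivAt (fun t ↦ f (x * γ t)) (leftDeriv 𝕜 f x X) 0 := by
  have hf' : MDifferentiableAt (𝓡 n) 𝓘(ℝ, 𝕜) (fun y ↦ f (x * y)) (γ 0) := by
    refine MDifferentiableAt.comp (I' := 𝓡 n) (γ 0) ?_ (mdifferentiableAt_mul_left n x _)
    rwa [h0, mul_one]
  have h := hasDerivAt_comp_curve hf' hγ
  refine h.congr_deriv ?_
  rw [leftDeriv_eq_mfderiv x hf]
  have : ∀ y : G, y = 1 → ∀ v : EuclideanSpace ℝ (Fin n),
    (mfderiv (𝓡 n) 𝓘(ℝ, 𝕜) (fun y ↦ f (x * y)) y v : 𝕜) =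
      mfderiv (𝓡 n) 𝓘(ℝ, 𝕜) (fun y ↦ f (x * y)) 1 v := by rintro y rfl v; rfl
  exact (this _ h0 _).trans (by rw [← hX]; rfl)

/-- The derivative is the partial derivative in `t`, at `t = 0`, of the smooth function `f (x
γ(t))`. -/
theorem contMDiff_leftDeriv {f : G → 𝕜} (hf : ContMDiff (𝓡 n) 𝓘(ℝ, 𝕜) ∞ f) (X : LieAlg n G) :
    ContMDiff (𝓡 n) 𝓘(ℝ, 𝕜) ∞ (fun x ↦ leftDeriv 𝕜 f x X) := by
  obtain ⟨γ, hγ, h0, hX⟩ := exists_contMDiff_curve n X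
  have hF : ContMDiff ((𝓡 n).prod 𝓘(ℝ, ℝ)) 𝓘(ℝ, 𝕜) ∞ (fun p : G × ℝ ↦ f (p.1 * γ p.2)) :=
    hf.comp (contMDiff_fst.mul (hγ.comp contMDiff_snd))
  have := (contMDiff_deriv_snd hF).comp
    (contMDiff_id.prodMk (contMDiff_const (I := 𝓡 n) (M := G) (c := (0 : ℝ))))
  convert this using 2 with x
  exact (hasDerivAt_leftDeriv x (hf.contMDiffAt.mdifferentiableAt (by simp)) h0
    (hγ.contMDiffAt.mdifferentiableAt (by simp)) hX).deriv.symm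

/-- The bracket of `𝔤` is that of left-invariant fields; in the chart at `x` the identity becomes
the one expressing the Lie bracket of vector fields on a vector space as a commutator of
derivations. -/
theorem leftDeriv_lie {f : G → 𝕜} (hf : ContMDiff (𝓡 n) 𝓘(ℝ, 𝕜) ∞ f) (x : G) (X Y : LieAlg n G) :
    leftDeriv 𝕜 f x ⁅X, Y⁆ =
      leftDeriv 𝕜 (fun y ↦ leftDeriv 𝕜 f y Y) x X - leftDeriv 𝕜 (fun y ↦ leftDeriv 𝕜 f y X) x Y := by
  have := isManifold_lieGroup n G
  have := isManifold_one_lieGroup n G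
  have := isManifold_two_lieGroup n G
  set φ := extChartAt (𝓡 n) x with hφ
  let E := EuclideanSpace ℝ (Fin n)
  let V : LieAlg n G → E → E := fun X ↦
    VectorField.mpullbackWithin 𝓘(ℝ, E) (𝓡 n) φ.symm (mulInvariantVectorField X) (Set.range (𝓡 n))
  have htar : φ.target ∈ nhds (φ x) := extChartAt_target_mem_nhds x
  have hs : ContMDiffOn 𝓘(ℝ, E) (𝓡 n) ∞ φ.symm φ.target := contMDiffOn_extChartAt_symm x
  have hcomp : ∀ h : G → 𝕜, ContMDiff (𝓡 n) 𝓘(ℝ, 𝕜) ∞ h → ContDiffAt ℝ ∞ (fun v ↦ h (φ.symm v)) (φ x) := by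
    intro h hh
    have : ContMDiffOn 𝓘(ℝ, E) 𝓘(ℝ, 𝕜) ∞ (fun v ↦ h (φ.symm v)) φ.target := hh.comp_contMDiffOn hs
    exact this.contDiffOn.contDiffAt htar
  have hV : ∀ X, DifferentiableAt ℝ (V X) (φ x) := by
    intro X
    have h := (mdifferentiableAt_mulInvariantVectorField X
      (g := x)).mdifferentiableWithinAt (s := Set.univ)
      |>.differentiableWithinAt_mpullbackWithin_vectorField
    have hu : φ.symm ⁻¹' Set.univ ∩ Set.range (𝓡 n) = Set.univ := by simp
    have h' : DifferentiableWithinAt ℝ (V X) (φ.symm ⁻¹' Set.univ ∩ Set.range (𝓡 n)) (φ x) := h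
    rw [hu] at h'
    exact h'.differentiableAt Filter.univ_mem
  have hd : ∀ h : G → 𝕜, ContMDiff (𝓡 n) 𝓘(ℝ, 𝕜) ∞ h → ∀ (X : LieAlg n G), ∀ v ∈ φ.target,
      fderiv ℝ (fun v ↦ h (φ.symm v)) v (V X v) = leftDeriv 𝕜 h (φ.symm v) X := by
    intro h hh X v hv
    have hi := isInvertible_mfderivWithin_extChartAt_symm (I := 𝓡 n) (x := x) hv
    have e1 : mfderivWithin 𝓘(ℝ, E) (𝓡 n) φ.symm (Set.range (𝓡 n)) v (V X v) =
        mulInvariantVectorField X (φ.symm v) := by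
      obtain ⟨e, he⟩ := hi
      simp only [V, VectorField.mpullbackWithin_apply]
      rw [← he, ContinuousLinearMap.inverse_equiv]
      exact e.apply_symm_apply _
    have hr : Set.range (𝓡 n) = Set.univ := by simp
    rw [hr, mfderivWithin_univ] at e1
    have hsv : MDifferentiableAt 𝓘(ℝ, E) (𝓡 n) φ.symm v :=
      ((hs v hv).contMDiffAt (extChartAt_target_mem_nhds' hv)).mdifferentiableAt (by simp)
    have e2 := mfderiv_comp_apply (I := 𝓘(ℝ, E)) (I' := 𝓡 n) (I'' := 𝓘(ℝ, 𝕜)) v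
      (hh.contMDiffAt.mdifferentiableAt (by simp)) hsv (V X v)
    rw [e1] at e2
    rw [← mfderiv_eq_fderiv]
    exact e2
  have hsymm : ∀ w : E, (mfderiv 𝓘(ℝ, E) (𝓡 n) φ.symm (φ x) w : E) = w := by
    intro w
    have h3 := mfderivWithin_range_extChartAt_symm (I := 𝓡 n) (x := x)
    have hr : Set.range (𝓡 n) = Set.univ := by simp
    rw [hr, mfderivWithin_univ] at h3
    exact congrArg (fun f : E →L[ℝ] E ↦ f w) h3
  have hfx : ∀ w : E, (mfderiv (𝓡 n) 𝓘(ℝ, 𝕜) f x w : 𝕜) =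
      fderiv ℝ (fun v ↦ f (φ.symm v)) (φ x) w := by
    intro w
    have hsv : MDifferentiableAt 𝓘(ℝ, E) (𝓡 n) φ.symm (φ x) :=
      ((hs _ (mem_extChartAt_target x)).contMDiffAt htar).mdifferentiableAt (by simp)
    have e2 := mfderiv_comp_apply (I := 𝓘(ℝ, E)) (I' := 𝓡 n) (I'' := 𝓘(ℝ, 𝕜)) (φ x)
      (hf.contMDiffAt.mdifferentiableAt (by simp)) hsv w
    rw [← mfderiv_eq_fderiv]
    refine Eq.trans ?_ e2.symm
    have : ∀ y : G, y = x → ∀ v : E, (mfderiv (𝓡 n) 𝓘(ℝ, 𝕜) f x v : 𝕜) =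
      mfderiv (𝓡 n) 𝓘(ℝ, 𝕜) f y v := by rintro y rfl v; rfl
    refine (this _ (extChartAt_to_inv (I := 𝓡 n) x) w).trans ?_
    exact congrArg (fun v : E ↦ (mfderiv (𝓡 n) 𝓘(ℝ, 𝕜) f (φ.symm (φ x)) v : 𝕜)) (hsymm w).symm
  -- The differential of the chart at its own base point is the identity, so the bracket at `x`
  -- needs no transport.
  have hbr : (mulInvariantVectorField ⁅X, Y⁆ x : E) =
      VectorField.lieBracket ℝ (V X) (V Y) (φ x) := by
    have h1 := congrFun (mulInvariantVector_mlieBracket (I := 𝓡 n) X Y) x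
    refine h1.trans ?_
    rw [← VectorField.mlieBracketWithin_univ, VectorField.mlieBracketWithin_apply]
    have hr : φ.symm ⁻¹' Set.univ ∩ Set.range (𝓡 n) = Set.univ := by simp
    have hid : ∀ w : E, (ContinuousLinearMap.id ℝ E).inverse w = w := by simp
    rw [hr, mfderiv_extChartAt_self]
    refine (hid _).trans ?_
    exact congrFun (VectorField.lieBracketWithin_univ (𝕜 := ℝ) (V := V X) (W := V Y)) (φ x)
  have hd2 : ∀ h : G → 𝕜, ContMDiff (𝓡 n) 𝓘(ℝ, 𝕜) ∞ h → ∀ X Y : LieAlg n G,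
      fderiv ℝ (fun v ↦ fderiv ℝ (fun v ↦ h (φ.symm v)) v (V X v)) (φ x) (V Y (φ x)) =
        leftDeriv 𝕜 (fun y ↦ leftDeriv 𝕜 h y X) x Y := by
    intro h hh X Y
    have e : (fun v ↦ fderiv ℝ (fun v ↦ h (φ.symm v)) v (V X v)) =ᶠ[nhds (φ x)]
        (fun v ↦ leftDeriv 𝕜 h (φ.symm v) X) :=
      Filter.eventually_of_mem htar fun v hv ↦ hd h hh X v hv
    rw [e.fderiv_eq, hd _ (contMDiff_leftDeriv hh X) Y _ (mem_extChartAt_target x)]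
    rw [hφ, extChartAt_to_inv]
  have key := VectorField.fderiv_apply_lieBracket (hcomp f hf)
    (by rw [minSmoothness_of_isRCLikeNormedField]; exact le_trans (by norm_num) three_le)
    (hV Y) (hV X)
  rw [hd2 f hf, hd2 f hf, ← hbr] at key
  rw [← key]
  exact hfx _

end Calculus

theorem deriv_deriv_comm {E : Type*} [NormedAddCommGroup E] [NormedSpace ℝ E] {H : ℝ × ℝ → E}
    (hH : ContDiff ℝ ∞ H) :
    deriv (fun t ↦ deriv (fun u ↦ H (t, u)) 0) 0 = deriv (fun u ↦ deriv (fun t ↦ H (t, u)) 0) 0 := by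
  have hd : Differentiable ℝ H := hH.differentiable (by simp)
  have h1 : ∀ t u : ℝ, deriv (fun u ↦ H (t, u)) u = fderiv ℝ H (t, u) (0, 1) := fun t u ↦
    ((hd (t, u)).hasFDerivAt.comp_hasDerivAt u ((hasDerivAt_const u t).prodMk (hasDerivAt_id u))).deriv
  have h2 : ∀ t u : ℝ, deriv (fun t ↦ H (t, u)) t = fderiv ℝ H (t, u) (1, 0) := fun t u ↦
    ((hd (t, u)).hasFDerivAt.comp_hasDerivAt t ((hasDerivAt_id t).prodMk (hasDerivAt_const t u))).deriv
  simp only [h1, h2]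
  have hd2 : Differentiable ℝ (fderiv ℝ H) := (hH.fderiv_right (m := ∞) (by simp)).differentiable (by simp)
  have h3 : HasDerivAt (fun t : ℝ ↦ fderiv ℝ H (t, 0) (0, 1)) (fderiv ℝ (fderiv ℝ H) (0, 0) (1, 0) (0, 1)) 0 := by
    have := HasFDerivAt.comp_hasDerivAt (0 : ℝ) (f := fun t : ℝ ↦ (t, (0 : ℝ))) (hd2 (0, 0)).hasFDerivAt
      ((hasDerivAt_id (0 : ℝ)).prodMk (hasDerivAt_const (0 : ℝ) (0 : ℝ)))
    exact this.clm_apply (hasDerivAt_const (0 : ℝ) ((0 : ℝ), (1 : ℝ))) |>.congr_deriv (by simp)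
  have h4 : HasDerivAt (fun u : ℝ ↦ fderiv ℝ H (0, u) (1, 0)) (fderiv ℝ (fderiv ℝ H) (0, 0) (0, 1) (1, 0)) 0 := by
    have := HasFDerivAt.comp_hasDerivAt (0 : ℝ) (f := fun t : ℝ ↦ ((0 : ℝ), t)) (hd2 (0, 0)).hasFDerivAt
      ((hasDerivAt_const (0 : ℝ) (0 : ℝ)).prodMk (hasDerivAt_id (0 : ℝ)))
    exact this.clm_apply (hasDerivAt_const (0 : ℝ) ((1 : ℝ), (0 : ℝ))) |>.congr_deriv (by simp)
  rw [h3.deriv, h4.deriv]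
  refine (hH.contDiffAt.isSymmSndFDerivAt ?_) _ _
  rw [minSmoothness_of_isRCLikeNormedField]; exact le_trans (by norm_num) three_le

section Calculus

variable {n : ℕ} {G : Type*} [TopologicalSpace G] [ChartedSpace (EuclideanSpace ℝ (Fin n)) G]
  [Group G] [LieGroup (𝓡 n) ∞ G] {𝕜 : Type*} [RCLike 𝕜]

section Scalar
variable {f f' : G → 𝕜} (x : G)

theorem leftDeriv_add_right (f : G → 𝕜) (X Y : LieAlg n G) :
    leftDeriv 𝕜 f x (X + Y) = leftDeriv 𝕜 f x X + leftDeriv 𝕜 f x Y := by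
  unfold leftDeriv
  rw [mulInvariantVectorField_add]
  exact map_add _ _ _

theorem leftDeriv_smul_right (f : G → 𝕜) (c : ℝ) (X : LieAlg n G) :
    leftDeriv 𝕜 f x (c • X) = c • leftDeriv 𝕜 f x X := by
  unfold leftDeriv
  rw [mulInvariantVectorField_smul]
  exact (mfderiv (𝓡 n) 𝓘(ℝ, 𝕜) f x).map_smul c _

/-- The differential of a function at `x`, in the left trivialization of the tangent bundle. -/
def leftDifferential (f : G → 𝕜) : LieAlg n G →ₗ[ℝ] 𝕜 where
  toFun X := leftDeriv 𝕜 f x X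
  map_add' := leftDeriv_add_right x f
  map_smul' := leftDeriv_smul_right x f

theorem hasDerivAt_leftDeriv_of_contMDiff (hf : ContMDiff (𝓡 n) 𝓘(ℝ, 𝕜) ∞ f) {γ : ℝ → G}
    (hγ : ContMDiff 𝓘(ℝ, ℝ) (𝓡 n) ∞ γ) (h0 : γ 0 = 1) :
    HasDerivAt (fun t ↦ f (x * γ t)) (leftDeriv 𝕜 f x (velocity n γ : LieAlg n G)) 0 :=
  hasDerivAt_leftDeriv x (hf.contMDiffAt.mdifferentiableAt (by simp)) h0
    (hγ.contMDiffAt.mdifferentiableAt (by simp)) rfl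

theorem leftDeriv_const (c : 𝕜) (X : LieAlg n G) : leftDeriv 𝕜 (fun _ : G ↦ c) x X = 0 := by
  obtain ⟨γ, hγ, h0, rfl⟩ := exists_contMDiff_curve n X
  exact (hasDerivAt_leftDeriv_of_contMDiff x contMDiff_const hγ h0).unique (hasDerivAt_const _ _)

theorem contMDiff_fun_mul (hf : ContMDiff (𝓡 n) 𝓘(ℝ, 𝕜) ∞ f) (hf' : ContMDiff (𝓡 n) 𝓘(ℝ, 𝕜) ∞ f') :
    ContMDiff (𝓡 n) 𝓘(ℝ, 𝕜) ∞ (fun y ↦ f y * f' y) :=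
  (contDiff_mul (𝕜 := ℝ) (𝔸 := 𝕜)).contMDiff.comp (hf.prodMk_space hf')

theorem leftDeriv_mul (hf : ContMDiff (𝓡 n) 𝓘(ℝ, 𝕜) ∞ f) (hf' : ContMDiff (𝓡 n) 𝓘(ℝ, 𝕜) ∞ f')
    (X : LieAlg n G) :
    leftDeriv 𝕜 (fun y ↦ f y * f' y) x X = leftDeriv 𝕜 f x X * f' x + f x * leftDeriv 𝕜 f' x X := by
  obtain ⟨γ, hγ, h0, rfl⟩ := exists_contMDiff_curve n X
  have hm : ContMDiff (𝓡 n) 𝓘(ℝ, 𝕜) ∞ (fun y ↦ f y * f' y) := contMDiff_fun_mul hf hf'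
  have h := (hasDerivAt_leftDeriv_of_contMDiff x hm hγ h0).unique
    ((hasDerivAt_leftDeriv_of_contMDiff x hf hγ h0).mul
      (hasDerivAt_leftDeriv_of_contMDiff x hf' hγ h0))
  simpa [h0] using h

theorem leftDeriv_const_mul (hf : ContMDiff (𝓡 n) 𝓘(ℝ, 𝕜) ∞ f) (c : 𝕜) (X : LieAlg n G) :
    leftDeriv 𝕜 (fun y ↦ c * f y) x X = c * leftDeriv 𝕜 f x X := by
  rw [leftDeriv_mul x contMDiff_const hf, leftDeriv_const, zero_mul, zero_add]

theorem leftDeriv_sum {ι : Type*} (s : Finset ι) {f : ι → G → 𝕜}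
    (hf : ∀ i ∈ s, ContMDiff (𝓡 n) 𝓘(ℝ, 𝕜) ∞ (f i)) (X : LieAlg n G) :
    leftDeriv 𝕜 (fun y ↦ ∑ i ∈ s, f i y) x X = ∑ i ∈ s, leftDeriv 𝕜 (f i) x X := by
  obtain ⟨γ, hγ, h0, rfl⟩ := exists_contMDiff_curve n X
  exact (hasDerivAt_leftDeriv_of_contMDiff x (contMDiff_finsetSum hf) hγ h0).unique
    (HasDerivAt.fun_sum fun i hi ↦ hasDerivAt_leftDeriv_of_contMDiff x (hf i hi) hγ h0)

theorem contMDiff_conj (hf : ContMDiff (𝓡 n) 𝓘(ℝ, 𝕜) ∞ f) :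
    ContMDiff (𝓡 n) 𝓘(ℝ, 𝕜) ∞ (fun y ↦ conj (f y)) :=
  ((RCLike.conjCLE : 𝕜 ≃L[ℝ] 𝕜).contDiff (n := ∞)).contMDiff.comp hf

theorem leftDeriv_conj (hf : ContMDiff (𝓡 n) 𝓘(ℝ, 𝕜) ∞ f) (X : LieAlg n G) :
    leftDeriv 𝕜 (fun y ↦ conj (f y)) x X = conj (leftDeriv 𝕜 f x X) := by
  obtain ⟨γ, hγ, h0, rfl⟩ := exists_contMDiff_curve n X
  refine (hasDerivAt_leftDeriv_of_contMDiff x (contMDiff_conj hf) hγ h0).unique ?_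
  exact (RCLike.conjCLE : 𝕜 ≃L[ℝ] 𝕜).hasFDerivAt.comp_hasDerivAt (0 : ℝ)
    (hasDerivAt_leftDeriv_of_contMDiff x hf hγ h0)

theorem contMDiff_mul_left_comp (hf : ContMDiff (𝓡 n) 𝓘(ℝ, 𝕜) ∞ f) (a : G) :
    ContMDiff (𝓡 n) 𝓘(ℝ, 𝕜) ∞ (fun y ↦ f (a * y)) :=
  hf.comp contMDiff_mul_left

theorem contMDiff_mul_right_comp (hf : ContMDiff (𝓡 n) 𝓘(ℝ, 𝕜) ∞ f) (a : G) :
    ContMDiff (𝓡 n) 𝓘(ℝ, 𝕜) ∞ (fun y ↦ f (y * a)) :=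
  hf.comp contMDiff_mul_right

theorem leftDeriv_mul_left (hf : ContMDiff (𝓡 n) 𝓘(ℝ, 𝕜) ∞ f) (a : G) (X : LieAlg n G) :
    leftDeriv 𝕜 (fun y ↦ f (a * y)) x X = leftDeriv 𝕜 f (a * x) X := by
  obtain ⟨γ, hγ, h0, rfl⟩ := exists_contMDiff_curve n X
  refine (hasDerivAt_leftDeriv_of_contMDiff x (contMDiff_mul_left_comp hf a) hγ h0).unique ?_
  simpa only [mul_assoc] using hasDerivAt_leftDeriv_of_contMDiff (a * x) hf hγ h0

theorem velocity_conj {γ : ℝ → G} (hγ : MDifferentiableAt 𝓘(ℝ, ℝ) (𝓡 n) γ 0) (h0 : γ 0 = 1) (s : G) :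
    velocity n (fun t ↦ s * γ t * s⁻¹) = AdCLM n s (velocity n γ : LieAlg n G) := by
  have := mfderiv_comp_apply (I := 𝓘(ℝ, ℝ)) (I' := 𝓡 n) (I'' := 𝓡 n) 0
    (conj_mdiff n s (γ 0)) hγ (1 : ℝ)
  exact this.trans (mfderiv_congr_base n _ h0 _)

theorem contMDiff_conj_curve {γ : ℝ → G} (hγ : ContMDiff 𝓘(ℝ, ℝ) (𝓡 n) ∞ γ) (s : G) :
    ContMDiff 𝓘(ℝ, ℝ) (𝓡 n) ∞ (fun t ↦ s * γ t * s⁻¹) :=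
  (conj_contMDiff n s).comp hγ

/-- Because `x γ(t) s = (x s) (s⁻¹ γ(t) s)`, and the conjugated curve has velocity `Ad_{s⁻¹} X`. -/
theorem leftDeriv_mul_right (hf : ContMDiff (𝓡 n) 𝓘(ℝ, 𝕜) ∞ f) (s : G) (X : LieAlg n G) :
    leftDeriv 𝕜 (fun y ↦ f (y * s)) x X = leftDeriv 𝕜 f (x * s) (Ad n G s⁻¹ X) := by
  obtain ⟨γ, hγ, h0, rfl⟩ := exists_contMDiff_curve n X
  refine (hasDerivAt_leftDeriv_of_contMDiff x (contMDiff_mul_right_comp hf s) hγ h0).unique ?_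
  have h := hasDerivAt_leftDeriv_of_contMDiff (x * s) hf (contMDiff_conj_curve hγ s⁻¹) (by simp [h0])
  rw [velocity_conj (hγ.contMDiffAt.mdifferentiableAt (by simp)) h0] at h
  simp only [mul_assoc, mul_inv_cancel_left, inv_inv] at h
  simpa only [mul_assoc] using! h

end Scalar

theorem mulInvariantVectorField_one (X : LieAlg n G) :
    (mulInvariantVectorField X (1 : G) : LieAlg n G) = X := by
  unfold mulInvariantVectorField
  have : (fun x : G ↦ 1 * x) = id := by funext x; simp
  rw [this, mfderiv_id]
  rfl

/-- The functional is read in the chart at `1` and cut off by a bump function. Identities in `𝔤` can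
then be tested by differentiating scalar functions. -/
theorem exists_contMDiff_leftDeriv_one_eq [T2Space G] (ℓ : LieAlg n G →ₗ[ℝ] ℝ) :
    ∃ f : G → ℝ, ContMDiff (𝓡 n) 𝓘(ℝ, ℝ) ∞ f ∧ ∀ X : LieAlg n G, leftDeriv ℝ f 1 X = ℓ X := by
  have := isManifold_lieGroup n G
  have := isManifold_one_lieGroup n G
  let E := EuclideanSpace ℝ (Fin n)
  let L : E →L[ℝ] ℝ := LinearMap.toContinuousLinearMap (ℓ : E →ₗ[ℝ] ℝ)
  let b : SmoothBumpFunction (𝓡 n) (1 : G) := Classical.choice inferInstance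
  have hφ : ContMDiffOn (𝓡 n) 𝓘(ℝ, ℝ) ∞ (fun y ↦ L (extChartAt (𝓡 n) (1 : G) y))
      (chartAt E (1 : G)).source :=
    L.contDiff.contMDiff.comp_contMDiffOn contMDiffOn_extChartAt
  refine ⟨fun y ↦ b y • L (extChartAt (𝓡 n) (1 : G) y), b.contMDiff_smul hφ, fun X ↦ ?_⟩
  have he : (fun y ↦ b y • L (extChartAt (𝓡 n) (1 : G) y)) =ᶠ[nhds 1]
      (fun y ↦ L (extChartAt (𝓡 n) (1 : G) y)) := by
    filter_upwards [b.eventuallyEq_one] with y hy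
    simp [hy]
  unfold leftDeriv
  rw [he.mfderiv_eq]
  have h := mfderiv_comp_apply (I := 𝓡 n) (I' := 𝓘(ℝ, E)) (I'' := 𝓘(ℝ, ℝ)) (1 : G)
    (g := L) (f := extChartAt (𝓡 n) (1 : G))
    L.differentiableAt.mdifferentiableAt
    (mdifferentiableAt_extChartAt (mem_chart_source _ _)) (mulInvariantVectorField X (1 : G))
  refine h.trans ?_
  rw [mfderiv_eq_fderiv, L.fderiv, mfderiv_extChartAt_self]
  exact congrArg ℓ (mulInvariantVectorField_one X)

end Calculus

/-! ### Linear algebra of an inner product given as a bilinear form -/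

section InnerForm

variable {V : Type*} [AddCommGroup V] [Module ℝ V] [FiniteDimensional ℝ V]
  {B : LinearMap.BilinForm ℝ V}

/-- The spectral theorem. The inner product space structure is local to the proof, since `𝔪` carries
two inner products, `Kil` and `g`. -/
theorem exists_orthonormal_eigenbasis (hs : ∀ x y, B x y = B y x) (hp : ∀ x, x ≠ 0 → 0 < B x x)
    (T : V →ₗ[ℝ] V) (hT : ∀ x y, B (T x) y = B x (T y)) :
    ∃ (b : Module.Basis (Fin (Module.finrank ℝ V)) ℝ V) (c : Fin (Module.finrank ℝ V) → ℝ),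
      (∀ i j, B (b i) (b j) = if i = j then 1 else 0) ∧ ∀ i, T (b i) = c i • b i := by
  let core : InnerProductSpace.Core ℝ V :=
    { inner := fun x y ↦ B x y
      conj_inner_symm := fun x y ↦ by simp [hs x y]
      re_inner_nonneg := fun x ↦ by
        by_cases h : x = 0
        · simp [h]
        · exact (hp x h).le
      add_left := fun x y z ↦ by simp
      smul_left := fun x y r ↦ by simp
      definite := fun x hx ↦ by
        by_contra h
        exact (hp x h).ne' hx }
  let := core.toNormedAddCommGroup
  let := InnerProductSpace.ofCore core.toCore
  have hsym : T.IsSymmetric := hT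
  refine ⟨(hsym.eigenvectorBasis rfl).toBasis, fun i ↦ hsym.eigenvalues rfl i, fun i j ↦ ?_, fun i ↦ ?_⟩
  · have := orthonormal_iff_ite.1 (hsym.eigenvectorBasis rfl).orthonormal i j
    simp only [OrthonormalBasis.coe_toBasis]
    exact this
  · simp

theorem exists_orthonormal_basis (hs : ∀ x y, B x y = B y x) (hp : ∀ x, x ≠ 0 → 0 < B x x) :
    ∃ b : Module.Basis (Fin (Module.finrank ℝ V)) ℝ V,
      ∀ i j, B (b i) (b j) = if i = j then 1 else 0 := by
  obtain ⟨b, -, hb, -⟩ := exists_orthonormal_eigenbasis hs hp 0 (by simp)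
  exact ⟨b, hb⟩

section OrthonormalBasis

variable {ι : Type*} [Fintype ι] [DecidableEq ι] {b : Module.Basis ι ℝ V}

theorem repr_eq_form (hb : ∀ i j, B (b i) (b j) = if i = j then 1 else 0) (x : V) (i : ι) :
    b.repr x i = B (b i) x := by
  have h : B (b i) (∑ j, b.repr x j • b j) = b.repr x i := by
    rw [map_sum]
    simp [hb]
  rw [← h, b.sum_repr]

theorem trace_eq_sum_form (hb : ∀ i j, B (b i) (b j) = if i = j then 1 else 0) (T : V →ₗ[ℝ] V) :
    LinearMap.trace ℝ V T = ∑ i, B (b i) (T (b i)) := by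
  rw [LinearMap.trace_eq_matrix_trace ℝ b, Matrix.trace]
  refine Finset.sum_congr rfl fun i _ ↦ ?_
  rw [Matrix.diag_apply, LinearMap.toMatrix_apply, repr_eq_form hb]

end OrthonormalBasis

theorem form_ext (hp : ∀ x, x ≠ 0 → 0 < B x x) {x y : V} (h : ∀ z, B x z = B y z) : x = y := by
  by_contra hne
  have := hp (x - y) (sub_ne_zero.2 hne)
  rw [map_sub B, LinearMap.sub_apply, h, sub_self] at this
  exact this.false

theorem form_self_nonneg (hp : ∀ x, x ≠ 0 → 0 < B x x) (x : V) : 0 ≤ B x x := by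
  by_cases h : x = 0
  · simp [h]
  · exact (hp x h).le

/-- In an orthonormal basis `tr T² = -∑ |T b_i|²`. -/
theorem trace_sq_nonpos_of_skew (hs : ∀ x y, B x y = B y x) (hp : ∀ x, x ≠ 0 → 0 < B x x)
    {T : V →ₗ[ℝ] V} (hT : ∀ x y, B (T x) y = -B x (T y)) :
    LinearMap.trace ℝ V (T ∘ₗ T) ≤ 0 ∧ (LinearMap.trace ℝ V (T ∘ₗ T) = 0 → T = 0) := by
  obtain ⟨b, hb⟩ := exists_orthonormal_basis hs hp
  have h : LinearMap.trace ℝ V (T ∘ₗ T) = -∑ i, B (T (b i)) (T (b i)) := by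
    rw [trace_eq_sum_form hb, ← Finset.sum_neg_distrib]
    refine Finset.sum_congr rfl fun i _ ↦ ?_
    rw [hT, neg_neg]; rfl
  rw [h]
  refine ⟨neg_nonpos.2 (Finset.sum_nonneg fun i _ ↦ form_self_nonneg hp _), fun h0 ↦ b.ext fun i ↦ ?_⟩
  have := (Finset.sum_eq_zero_iff_of_nonneg fun i _ ↦ form_self_nonneg hp _).1 (neg_eq_zero.1 h0) i
    (Finset.mem_univ i)
  by_contra hne
  exact (hp _ hne).ne' this

theorem trace_eq_zero_of_skew (hs : ∀ x y, B x y = B y x) (hp : ∀ x, x ≠ 0 → 0 < B x x)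
    {T : V →ₗ[ℝ] V} (hT : ∀ x, B x (T x) = 0) : LinearMap.trace ℝ V T = 0 := by
  obtain ⟨b, hb⟩ := exists_orthonormal_basis hs hp
  rw [trace_eq_sum_form hb]
  exact Finset.sum_eq_zero fun i _ ↦ hT _

/-- A positive operator is determined on the eigenvectors of its square. -/
theorem eq_smul_of_sq_eq (hp : ∀ x, x ≠ 0 → 0 < B x x) {P : V →ₗ[ℝ] V}
    (hP : ∀ x, 0 ≤ B (P x) x) {v : V} {c : ℝ} (hc : 0 < c) (h : P (P v) = (c ^ 2) • v) :
    P v = c • v := by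
  by_contra hne
  -- `(P + c)(P - c) v = 0`, so a nonzero `w` would be an eigenvector of `P` for the negative
  -- eigenvalue `-c`.
  set w := P v - c • v with hw
  have h1 : P w = -(c • w) := by
    rw [hw, map_sub, map_smul, h]; module
  have h2 := hP w
  rw [h1] at h2
  have h3 := hp w (sub_ne_zero.2 hne)
  simp only [map_neg, map_smul, LinearMap.neg_apply, LinearMap.smul_apply, smul_eq_mul] at h2
  nlinarith

/-- The data of the polar decomposition `Γ = P J` of an invertible skew operator. -/
structure IsPolar (B : LinearMap.BilinForm ℝ V) (Γ P J : V →ₗ[ℝ] V) : Prop where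
  symm : ∀ x y, B (P x) y = B x (P y)
  nonneg : ∀ x, 0 ≤ B (P x) x
  orth : ∀ x y, B (J x) (J y) = B x y
  eq : Γ = P ∘ₗ J

namespace IsPolar

variable {Γ P J : V →ₗ[ℝ] V}

/-- Taking adjoints in `Γ = P J`, with `Γ` skew and `J` orthogonal, gives `P = -J Γ`; then `P² = -P
J Γ = -Γ²`. -/
theorem sq (h : IsPolar B Γ P J) (hp : ∀ x, x ≠ 0 → 0 < B x x)
    (hΓ : ∀ x y, B (Γ x) y = -B x (Γ y)) (x : V) : P (P x) = -Γ (Γ x) := by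
  have hinj : Function.Injective J := by
    refine (injective_iff_map_eq_zero J).2 fun x hx ↦ ?_
    by_contra hne
    have := hp x hne
    rw [← h.orth, hx] at this
    simp at this
  have hsurj := LinearMap.injective_iff_surjective.1 hinj
  have h1 : ∀ y, P y = -J (Γ y) := by
    intro y
    refine form_ext hp fun z ↦ ?_
    obtain ⟨z, rfl⟩ := hsurj z
    have hz : P (J z) = Γ z := (LinearMap.congr_fun h.eq z).symm
    rw [h.symm, hz, map_neg, LinearMap.neg_apply, h.orth, hΓ, neg_neg]
  conv_lhs => rw [h1 x]
  rw [map_neg, h.eq]; rfl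

end IsPolar

/-- `A = -Γ²` is self-adjoint and positive definite; `P = √A` and `J = P⁻¹ Γ`. Both `P` and `P⁻¹`
are polynomials in `A`, by interpolation at the eigenvalues, so they commute with whatever commutes
with `A`. This gives `J² = -1`, the commutation of `J` with every `S` that commutes with `Γ` (later
`Ad(K)`), and uniqueness. -/
theorem exists_polar (hs : ∀ x y, B x y = B y x) (hp : ∀ x, x ≠ 0 → 0 < B x x)
    {Γ : V →ₗ[ℝ] V} (hΓ : ∀ x y, B (Γ x) y = -B x (Γ y)) (hinj : ∀ x, Γ x = 0 → x = 0) :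
    ∃ P J : V →ₗ[ℝ] V, IsPolar B Γ P J ∧ (∀ x, J (J x) = -x) ∧ (∀ x, P (J x) = J (P x)) ∧
      (∀ x, x ≠ 0 → 0 < B (P x) x) ∧
      (∀ S : V →ₗ[ℝ] V, (∀ x, S (Γ x) = Γ (S x)) → ∀ x, J (S x) = S (J x)) ∧
      ∀ P' J', IsPolar B Γ P' J' → P' = P ∧ J' = J := by
  let A : Module.End ℝ V := -(Γ ∘ₗ Γ)
  have hA : ∀ x, A x = -Γ (Γ x) := fun x ↦ rfl
  have hAB : ∀ x y, B (A x) y = B (Γ x) (Γ y) := fun x y ↦ by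
    rw [hA, map_neg, LinearMap.neg_apply, hΓ, neg_neg]
  obtain ⟨b, c, hb, hc⟩ := exists_orthonormal_eigenbasis hs hp A fun x y ↦ by
    rw [hAB, hs x (A y), hAB, hs]
  have hcpos : ∀ i, 0 < c i := fun i ↦ by
    have h1 := hAB (b i) (b i)
    rw [hc, map_smul, LinearMap.smul_apply, hb, if_pos rfl, smul_eq_mul, mul_one] at h1
    rw [h1]
    exact hp _ fun h0 ↦ b.ne_zero i (hinj _ h0)
  have hpoly : ∀ f : ℝ → ℝ, ∃ p : Polynomial ℝ, ∀ i, p.eval (c i) = f (c i) := fun f ↦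
    ⟨Lagrange.interpolate (Finset.univ.image c) id f, fun i ↦
      Lagrange.eval_interpolate_at_node (v := id) f (Function.injective_id.injOn)
        (Finset.mem_image_of_mem c (Finset.mem_univ i))⟩
  have haeval : ∀ (p : Polynomial ℝ) i, Polynomial.aeval A p (b i) = p.eval (c i) • b i := fun p i ↦
    Module.End.aeval_apply_of_hasEigenvector
      ⟨Module.End.mem_eigenspace_iff.2 (hc i), b.ne_zero i⟩
  have hcomm : ∀ (p : Polynomial ℝ) (S : Module.End ℝ V), (∀ x, S (A x) = A (S x)) →
      ∀ x, S (Polynomial.aeval A p x) = Polynomial.aeval A p (S x) := by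
    intro p S hS x
    have h1 : S * A = A * S := LinearMap.ext hS
    have h2 : Commute S (Polynomial.aeval A p) := by
      induction p using Polynomial.induction_on' with
      | add p q hp hq => rw [map_add]; exact hp.add_right hq
      | monomial k a =>
        rw [Polynomial.aeval_monomial]
        exact (Algebra.commute_algebraMap_right a S).mul_right ((show Commute S A from h1).pow_right k)
    exact LinearMap.congr_fun h2 x
  obtain ⟨p, hpc⟩ := hpoly Real.sqrt
  obtain ⟨q, hqc⟩ := hpoly fun t ↦ (Real.sqrt t)⁻¹
  let P : V →ₗ[ℝ] V := Polynomial.aeval A p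
  let R : V →ₗ[ℝ] V := Polynomial.aeval A q
  have hPb : ∀ i, P (b i) = Real.sqrt (c i) • b i := fun i ↦ by rw [← hpc]; exact haeval p i
  have hRb : ∀ i, R (b i) = (Real.sqrt (c i))⁻¹ • b i := fun i ↦ by
    have := haeval q i; rw [hqc] at this; exact this
  have hsq : ∀ i, Real.sqrt (c i) ≠ 0 := fun i ↦ (Real.sqrt_pos.2 (hcpos i)).ne'
  have hPR : ∀ x, P (R x) = x := by
    intro x
    have : P ∘ₗ R = LinearMap.id := b.ext fun i ↦ by simp [hPb, hRb, hsq]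
    exact LinearMap.congr_fun this x
  have hRP : ∀ x, R (P x) = x := by
    intro x
    have : R ∘ₗ P = LinearMap.id := b.ext fun i ↦ by simp [hPb, hRb, hsq]
    exact LinearMap.congr_fun this x
  have hPP : ∀ x, P (P x) = A x := by
    intro x
    have : P ∘ₗ P = A := b.ext fun i ↦ by
      simp only [LinearMap.comp_apply, hPb, map_smul, smul_smul, hc]
      rw [Real.mul_self_sqrt (hcpos i).le]
    exact LinearMap.congr_fun this x
  have hdiag : ∀ (T : V →ₗ[ℝ] V) (d : _ → ℝ), (∀ i, T (b i) = d i • b i) →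
      ∀ x y, B (T x) y = B x (T y) := by
    intro T d hd x y
    have : B.compLeft T = B.compRight T := by
      refine LinearMap.BilinForm.ext_basis b fun i j ↦ ?_
      simp only [LinearMap.BilinForm.compLeft_apply, LinearMap.BilinForm.compRight_apply, hd,
        map_smul, LinearMap.smul_apply, hb]
      by_cases hij : i = j
      · simp [hij]
      · simp [hij]
    exact LinearMap.congr_fun₂ this x y
  have hPs := hdiag P _ hPb
  have hRs := hdiag R _ hRb
  have hΓA : ∀ x, Γ (A x) = A (Γ x) := fun x ↦ by simp [hA]
  have hRΓ : ∀ x, Γ (R x) = R (Γ x) := hcomm q Γ hΓA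
  have hPΓ : ∀ x, Γ (P x) = P (Γ x) := hcomm p Γ hΓA
  have hPpos : ∀ x, x ≠ 0 → 0 < B (P x) x := by
    intro x hx
    have h1 : B (P x) x = ∑ i, Real.sqrt (c i) * (b.repr x i) ^ 2 := by
      conv_lhs => rw [← b.sum_repr x]
      simp only [map_sum, map_smul, LinearMap.sum_apply, LinearMap.smul_apply, hPb, hb, smul_eq_mul]
      refine Finset.sum_congr rfl fun i _ ↦ ?_
      simp
      ring
    rw [h1]
    obtain ⟨i, hi⟩ : ∃ i, b.repr x i ≠ 0 := by
      by_contra! h0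
      exact hx (b.repr.map_eq_zero_iff.1 (Finsupp.ext h0))
    refine Finset.sum_pos' (fun i _ ↦ by positivity) ⟨i, Finset.mem_univ i, ?_⟩
    have := Real.sqrt_pos.2 (hcpos i)
    positivity
  have hPnn : ∀ x, 0 ≤ B (P x) x := fun x ↦ by
    by_cases h : x = 0
    · simp [h]
    · exact (hPpos x h).le
  have hPinj : ∀ x y, P x = P y → x = y := fun x y h ↦ by rw [← hRP x, h, hRP]
  refine ⟨P, R ∘ₗ Γ, ⟨hPs, hPnn, fun x y ↦ ?_, ?_⟩, fun x ↦ ?_, fun x ↦ ?_, hPpos, ?_, ?_⟩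
  · simp only [LinearMap.comp_apply]
    rw [← hRΓ x, ← hRΓ y, ← hAB, ← hPP, hPR, hPs, hPR]
  · ext x; exact (hPR _).symm
  · simp only [LinearMap.comp_apply]
    have h1 : Γ (Γ x) = -P (P x) := by rw [hPP, hA, neg_neg]
    rw [hRΓ, h1, map_neg, map_neg, hRP, hRP]
  · simp only [LinearMap.comp_apply]
    rw [hPR, hPΓ, hRP]
  · intro S hS x
    simp only [LinearMap.comp_apply]
    rw [← hS]
    exact (hcomm q S (fun x ↦ by simp [hA, hS]) _).symm
  · intro P' J' h'
    have hP'2 : ∀ x, P' (P' x) = A x := h'.sq hp hΓ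
    have hP'P : ∀ x, P' (P x) = P (P' x) := hcomm p P' fun x ↦ by rw [← hP'2, ← hP'2]
    have e : P' = P := by
      ext x
      by_contra hne
      -- `P` and `P'` commute and have the same square, so `(P + P')(P' - P) = 0`; but `P + P'` is
      -- positive definite.
      have h1 : P (P' x - P x) = -P' (P' x - P x) := by
        rw [map_sub, map_sub, hPP, hP'2, hP'P]; abel
      have h2 := hPpos _ (sub_ne_zero.2 hne)
      rw [h1] at h2
      have h3 := h'.nonneg (P' x - P x)
      simp only [map_neg, LinearMap.neg_apply] at h2
      linarith
    refine ⟨e, ?_⟩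
    ext x
    refine hPinj _ _ ?_
    have h1 := LinearMap.congr_fun h'.eq x
    rw [e] at h1
    simp only [LinearMap.comp_apply] at h1 ⊢
    rw [← h1, hPR]

end InnerForm

/-! ### Derivatives of vector-valued functions on `G` -/

section VectorCalculus

variable {n : ℕ} {G : Type*} [TopologicalSpace G] [ChartedSpace (EuclideanSpace ℝ (Fin n)) G]
  [Group G] [LieGroup (𝓡 n) ∞ G] {𝕜 : Type*} [RCLike 𝕜]
  {F F' : Type*} [AddCommGroup F] [Module 𝕜 F] [FiniteDimensional 𝕜 F]
  [AddCommGroup F'] [Module 𝕜 F'] [FiniteDimensional 𝕜 F']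

theorem IsSmooth.comp_linearMap {ψ : G → F} (hψ : IsSmooth n 𝕜 ψ) (T : F →ₗ[𝕜] F') :
    IsSmooth n 𝕜 (fun x ↦ T (ψ x)) := fun ℓ ↦ hψ (ℓ ∘ₗ T)

theorem IsSmooth.add {ψ φ : G → F} (hψ : IsSmooth n 𝕜 ψ) (hφ : IsSmooth n 𝕜 φ) :
    IsSmooth n 𝕜 (fun x ↦ ψ x + φ x) := fun ℓ ↦ by
  simp only [map_add]; exact (hψ ℓ).add (hφ ℓ)

theorem IsSmooth.sum {ι : Type*} (s : Finset ι) {ψ : ι → G → F} (hψ : ∀ i, IsSmooth n 𝕜 (ψ i)) :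
    IsSmooth n 𝕜 (fun x ↦ ∑ i ∈ s, ψ i x) := fun ℓ ↦ by
  simp only [map_sum]; exact contMDiff_finsetSum fun i _ ↦ hψ i ℓ

theorem IsSmooth.mul_right {ψ : G → F} (hψ : IsSmooth n 𝕜 ψ) (s : G) :
    IsSmooth n 𝕜 (fun x ↦ ψ (x * s)) := fun ℓ ↦ contMDiff_mul_right_comp (hψ ℓ) s

theorem linear_leftDerivVec (ℓ : F →ₗ[𝕜] 𝕜) {ψ : G → F} (hψ : IsSmooth n 𝕜 ψ) (x : G)
    (X : LieAlg n G) : ℓ (leftDerivVec 𝕜 ψ x X) = leftDeriv 𝕜 (fun y ↦ ℓ (ψ y)) x X := by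
  set b := Module.finBasis 𝕜 F
  have h : ∀ y, ℓ (ψ y) = ∑ i, ℓ (b i) * b.coord i (ψ y) := fun y ↦ by
    have h : ℓ (∑ i, b.repr (ψ y) i • b i) = ∑ i, ℓ (b i) * b.coord i (ψ y) := by
      rw [map_sum]
      simp [mul_comm]
    rw [← h, b.sum_repr]
  have h2 : ∀ i, ContMDiff (𝓡 n) 𝓘(ℝ, 𝕜) ∞ fun y ↦ ℓ (b i) * b.coord i (ψ y) := fun i ↦
    contMDiff_fun_mul contMDiff_const (hψ (b.coord i))
  simp only [h]
  rw [leftDeriv_sum x _ (fun i _ ↦ h2 i), leftDerivVec, map_sum]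
  refine Finset.sum_congr rfl fun i _ ↦ ?_
  rw [leftDeriv_const_mul x (hψ (b.coord i)), map_smul, smul_eq_mul, mul_comm]

theorem vec_ext {v w : F} (h : ∀ ℓ : F →ₗ[𝕜] 𝕜, ℓ v = ℓ w) : v = w :=
  (Module.finBasis 𝕜 F).ext_elem fun i ↦ h ((Module.finBasis 𝕜 F).coord i)

theorem linearMap_leftDerivVec (T : F →ₗ[𝕜] F') {ψ : G → F} (hψ : IsSmooth n 𝕜 ψ) (x : G)
    (X : LieAlg n G) : T (leftDerivVec 𝕜 ψ x X) = leftDerivVec 𝕜 (fun y ↦ T (ψ y)) x X :=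
  vec_ext (𝕜 := 𝕜) fun ℓ ↦ by
    rw [linear_leftDerivVec ℓ (hψ.comp_linearMap T)]
    exact linear_leftDerivVec (ℓ ∘ₗ T) hψ x X

theorem isSmooth_leftDerivVec {ψ : G → F} (hψ : IsSmooth n 𝕜 ψ) (X : LieAlg n G) :
    IsSmooth n 𝕜 (fun x ↦ leftDerivVec 𝕜 ψ x X) := fun ℓ ↦ by
  simp only [linear_leftDerivVec ℓ hψ]
  exact contMDiff_leftDeriv (hψ ℓ) X

theorem leftDerivVec_add_right [Module ℝ F] [IsScalarTower ℝ 𝕜 F] (ψ : G → F) (x : G)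
    (X Y : LieAlg n G) :
    leftDerivVec 𝕜 ψ x (X + Y) = leftDerivVec 𝕜 ψ x X + leftDerivVec 𝕜 ψ x Y := by
  simp only [leftDerivVec, leftDeriv_add_right, add_smul, Finset.sum_add_distrib]

theorem leftDerivVec_smul_right [Module ℝ F] [IsScalarTower ℝ 𝕜 F] (ψ : G → F) (x : G) (c : ℝ)
    (X : LieAlg n G) : leftDerivVec 𝕜 ψ x (c • X) = c • leftDerivVec 𝕜 ψ x X := by
  simp only [leftDerivVec, leftDeriv_smul_right, Finset.smul_sum, smul_assoc]

theorem leftDerivVec_mul_right {ψ : G → F} (hψ : IsSmooth n 𝕜 ψ) (x s : G) (X : LieAlg n G) :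
    leftDerivVec 𝕜 (fun y ↦ ψ (y * s)) x X = leftDerivVec 𝕜 ψ (x * s) (Ad n G s⁻¹ X) :=
  vec_ext (𝕜 := 𝕜) fun ℓ ↦ by
    rw [linear_leftDerivVec ℓ (hψ.mul_right s), linear_leftDerivVec ℓ hψ,
      leftDeriv_mul_right x (hψ ℓ)]

theorem leftDerivVec_mul_left {ψ : G → F} (hψ : IsSmooth n 𝕜 ψ) (x s : G) (X : LieAlg n G) :
    leftDerivVec 𝕜 (fun y ↦ ψ (s * y)) x X = leftDerivVec 𝕜 ψ (s * x) X :=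
  vec_ext (𝕜 := 𝕜) fun ℓ ↦ by
    rw [linear_leftDerivVec (ψ := fun y ↦ ψ (s * y)) ℓ (fun ℓ ↦ contMDiff_mul_left_comp (hψ ℓ) s),
      linear_leftDerivVec ℓ hψ, leftDeriv_mul_left x (hψ ℓ)]

end VectorCalculus

/-! ### Smoothness and differential of the adjoint representation -/

section Adjoint

variable {n : ℕ} {G : Type*} [TopologicalSpace G] [ChartedSpace (EuclideanSpace ℝ (Fin n)) G]
  [Group G] [LieGroup (𝓡 n) ∞ G]

theorem sum_coord_smul_leftDeriv {ι : Type*} [Fintype ι] (b : Module.Basis ι ℝ (LieAlg n G))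
    (f : G → ℝ) (x : G) (X : LieAlg n G) :
    leftDeriv ℝ f x X = ∑ i, b.coord i X * leftDeriv ℝ f x (b i) := by
  have h := congrArg (leftDifferential x f) (b.sum_repr X)
  rw [map_sum] at h
  simp only [map_smul] at h
  exact h.symm

theorem contMDiff_leftDeriv_field {f : G → ℝ} (hf : ContMDiff (𝓡 n) 𝓘(ℝ, ℝ) ∞ f)
    {V : G → LieAlg n G} (hV : IsSmooth n ℝ V) :
    ContMDiff (𝓡 n) 𝓘(ℝ, ℝ) ∞ (fun y ↦ leftDeriv ℝ f y (V y)) := by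
  let b := Module.finBasis ℝ (LieAlg n G)
  have h : (fun y ↦ leftDeriv ℝ f y (V y)) =
      fun y ↦ ∑ i, b.coord i (V y) * leftDeriv ℝ f y (b i) :=
    funext fun y ↦ sum_coord_smul_leftDeriv b f y (V y)
  rw [h]
  exact contMDiff_finsetSum fun i _ ↦ contMDiff_fun_mul (hV (b.coord i)) (contMDiff_leftDeriv hf _)

/-- The Leibniz rule: one term differentiates `f` twice with the field frozen at its value at `x`,
the other differentiates the field. -/
theorem leftDeriv_leftDeriv_field {f : G → ℝ} (hf : ContMDiff (𝓡 n) 𝓘(ℝ, ℝ) ∞ f)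
    {V : G → LieAlg n G} (hV : IsSmooth n ℝ V) (x : G) (Y : LieAlg n G) :
    leftDeriv ℝ (fun y ↦ leftDeriv ℝ f y (V y)) x Y =
      leftDeriv ℝ (fun y ↦ leftDeriv ℝ f y (V x)) x Y +
        leftDeriv ℝ f x (leftDerivVec ℝ V x Y) := by
  let b := Module.finBasis ℝ (LieAlg n G)
  have h1 : ∀ i, ContMDiff (𝓡 n) 𝓘(ℝ, ℝ) ∞ fun y ↦ b.coord i (V y) * leftDeriv ℝ f y (b i) :=
    fun i ↦ contMDiff_fun_mul (hV (b.coord i)) (contMDiff_leftDeriv hf _)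
  have h2 : ∀ i, ContMDiff (𝓡 n) 𝓘(ℝ, ℝ) ∞ fun y ↦ b.coord i (V x) * leftDeriv ℝ f y (b i) :=
    fun i ↦ contMDiff_fun_mul contMDiff_const (contMDiff_leftDeriv hf _)
  rw [sum_coord_smul_leftDeriv b f x (leftDerivVec ℝ V x Y)]
  have h3 : (fun y ↦ leftDeriv ℝ f y (V y)) =
      fun y ↦ ∑ i, b.coord i (V y) * leftDeriv ℝ f y (b i) :=
    funext fun y ↦ sum_coord_smul_leftDeriv b f y (V y)
  have h4 : (fun y ↦ leftDeriv ℝ f y (V x)) =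
      fun y ↦ ∑ i, b.coord i (V x) * leftDeriv ℝ f y (b i) :=
    funext fun y ↦ sum_coord_smul_leftDeriv b f y (V x)
  rw [h3, h4]
  rw [leftDeriv_sum x _ (fun i _ ↦ h1 i), leftDeriv_sum x _ (fun i _ ↦ h2 i),
    ← Finset.sum_add_distrib]
  refine Finset.sum_congr rfl fun i _ ↦ ?_
  rw [leftDeriv_mul x (hV (b.coord i)) (contMDiff_leftDeriv hf _),
    leftDeriv_const_mul x (contMDiff_leftDeriv hf _), linear_leftDerivVec (b.coord i) hV]
  ring

variable [T2Space G]

/-- If `f` has differential `ℓ` at `1`, then `ℓ (Ad_s Y)` is the derivative at `t = 0` of `f (s γ(t)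
s⁻¹)`, which is smooth in `(s, t)`. -/
theorem isSmooth_Ad (Y : LieAlg n G) : IsSmooth n ℝ (fun s : G ↦ Ad n G s Y) := by
  intro ℓ
  obtain ⟨f, hf, hfℓ⟩ := exists_contMDiff_leftDeriv_one_eq ℓ
  obtain ⟨γ, hγ, h0, rfl⟩ := exists_contMDiff_curve n Y
  have hF : ContMDiff ((𝓡 n).prod 𝓘(ℝ, ℝ)) 𝓘(ℝ, ℝ) ∞
      (fun p : G × ℝ ↦ f (p.1 * γ p.2 * p.1⁻¹)) :=
    hf.comp ((contMDiff_fst.mul (hγ.comp contMDiff_snd)).mul contMDiff_fst.inv)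
  have := (contMDiff_deriv_snd hF).comp
    (contMDiff_id.prodMk (contMDiff_const (I := 𝓡 n) (M := G) (c := (0 : ℝ))))
  convert this using 2 with s
  have h := hasDerivAt_leftDeriv_of_contMDiff 1 hf (contMDiff_conj_curve hγ s) (by simp [h0])
  rw [velocity_conj (hγ.contMDiffAt.mdifferentiableAt (by simp)) h0, hfℓ] at h
  simp only [one_mul] at h
  exact h.deriv.symm

theorem isSmooth_Ad_inv (Y : LieAlg n G) : IsSmooth n ℝ (fun s : G ↦ Ad n G s⁻¹ Y) := fun ℓ ↦
  (isSmooth_Ad Y ℓ).comp (contMDiff_inv (𝓡 n) ∞)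

/-- The two mixed derivatives of `f (γ(t) δ(u))` at the origin agree. One order gives `X Y f`; the
other gives `Y X f` plus `df` applied to the derivative sought. By `leftDeriv_lie` that derivative
is `[X, Y]`. -/
theorem leftDerivVec_Ad_inv_one (X Y : LieAlg n G) :
    leftDerivVec ℝ (fun s : G ↦ Ad n G s⁻¹ X) 1 Y = ⁅X, Y⁆ := by
  refine vec_ext (𝕜 := ℝ) fun ℓ ↦ ?_
  obtain ⟨f, hf, hfℓ⟩ := exists_contMDiff_leftDeriv_one_eq ℓ
  obtain ⟨γ, hγ, h0, hX⟩ := exists_contMDiff_curve n X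
  obtain ⟨δ, hδ, h0', hY⟩ := exists_contMDiff_curve n Y
  have hH : ContDiff ℝ ∞ (fun p : ℝ × ℝ ↦ f (γ p.1 * δ p.2)) := by
    rw [← contMDiff_iff_contDiff]
    exact hf.comp ((hγ.comp contDiff_fst.contMDiff).mul (hδ.comp contDiff_snd.contMDiff))
  have h1 : ∀ t, deriv (fun u ↦ f (γ t * δ u)) 0 = leftDeriv ℝ f (γ t) Y := fun t ↦ by
    rw [← hY]
    exact (hasDerivAt_leftDeriv_of_contMDiff (γ t) hf hδ h0').deriv
  have h2 : ∀ u, deriv (fun t ↦ f (γ t * δ u)) 0 = leftDeriv ℝ f (δ u) (Ad n G (δ u)⁻¹ X) := fun u ↦ by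
    have h : HasDerivAt (fun t ↦ f (1 * γ t * δ u))
        (leftDeriv ℝ (fun y ↦ f (y * δ u)) 1 X) 0 := by
      rw [← hX]
      exact hasDerivAt_leftDeriv_of_contMDiff 1 (contMDiff_mul_right_comp hf (δ u)) hγ h0
    rw [leftDeriv_mul_right 1 hf] at h
    simp only [one_mul] at h
    exact h.deriv
  have key := deriv_deriv_comm hH
  simp only [h1, h2] at key
  have h3 := hasDerivAt_leftDeriv_of_contMDiff 1 (contMDiff_leftDeriv hf Y) hγ h0
  have h4 := hasDerivAt_leftDeriv_of_contMDiff 1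
    (contMDiff_leftDeriv_field hf (isSmooth_Ad_inv X)) hδ h0'
  simp only [one_mul, hX, hY] at h3 h4
  rw [h3.deriv, h4.deriv, leftDeriv_leftDeriv_field hf (isSmooth_Ad_inv X)] at key
  have h5 := leftDeriv_lie hf 1 X Y
  simp only [inv_one, map_one, Module.End.one_apply] at key
  rw [← hfℓ, ← hfℓ, h5, key]
  ring

theorem leftDerivVec_Ad_inv (s : G) (X Y : LieAlg n G) :
    leftDerivVec ℝ (fun s : G ↦ Ad n G s⁻¹ X) s Y = ⁅Ad n G s⁻¹ X, Y⁆ := by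
  have h := leftDerivVec_mul_left (isSmooth_Ad_inv X) 1 s Y
  rw [mul_one] at h
  rw [← h, ← leftDerivVec_Ad_inv_one]
  simp only [mul_inv_rev, map_mul, Module.End.mul_apply]

end Adjoint

/-! ### The product rule for bilinear pairings -/

section BilinearCalculus

variable {n : ℕ} {G : Type*} [TopologicalSpace G] [ChartedSpace (EuclideanSpace ℝ (Fin n)) G]
  [Group G] [LieGroup (𝓡 n) ∞ G]
  {F F' : Type*} [AddCommGroup F] [AddCommGroup F']

section Real

variable [Module ℝ F] [FiniteDimensional ℝ F] [Module ℝ F'] [FiniteDimensional ℝ F']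
  (B : F →ₗ[ℝ] F' →ₗ[ℝ] ℝ) {V : G → F} {W : G → F'}

theorem bilin_eq_sum {ι ι' : Type*} [Fintype ι] [Fintype ι'] (b : Module.Basis ι ℝ F)
    (b' : Module.Basis ι' ℝ F') (v : F) (w : F') :
    B v w = ∑ i, ∑ j, B (b i) (b' j) * (b.coord i v * b'.coord j w) := by
  have h : B (∑ i, b.repr v i • b i) (∑ j, b'.repr w j • b' j) =
      ∑ i, ∑ j, B (b i) (b' j) * (b.coord i v * b'.coord j w) := by
    simp only [map_sum, LinearMap.sum_apply, map_smul, LinearMap.smul_apply, smul_eq_mul,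
      Module.Basis.coord_apply, Finset.mul_sum]
    rw [Finset.sum_comm]
    exact Finset.sum_congr rfl fun i _ ↦ Finset.sum_congr rfl fun j _ ↦ by ring
  rw [← h, b.sum_repr, b'.sum_repr]

theorem contMDiff_bilin (hV : IsSmooth n ℝ V) (hW : IsSmooth n ℝ W) :
    ContMDiff (𝓡 n) 𝓘(ℝ, ℝ) ∞ (fun y ↦ B (V y) (W y)) := by
  let b := Module.finBasis ℝ F
  let b' := Module.finBasis ℝ F'
  rw [funext fun y ↦ bilin_eq_sum B b b' (V y) (W y)]
  exact contMDiff_finsetSum fun i _ ↦ contMDiff_finsetSum fun j _ ↦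
    contMDiff_fun_mul contMDiff_const (contMDiff_fun_mul (hV (b.coord i)) (hW (b'.coord j)))

theorem leftDeriv_bilin (hV : IsSmooth n ℝ V) (hW : IsSmooth n ℝ W) (x : G) (X : LieAlg n G) :
    leftDeriv ℝ (fun y ↦ B (V y) (W y)) x X =
      B (leftDerivVec ℝ V x X) (W x) + B (V x) (leftDerivVec ℝ W x X) := by
  let b := Module.finBasis ℝ F
  let b' := Module.finBasis ℝ F'
  have h1 : ∀ i j, ContMDiff (𝓡 n) 𝓘(ℝ, ℝ) ∞ (fun y ↦ b.coord i (V y) * b'.coord j (W y)) :=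
    fun i j ↦ contMDiff_fun_mul (hV (b.coord i)) (hW (b'.coord j))
  have h2 : ∀ i j, ContMDiff (𝓡 n) 𝓘(ℝ, ℝ) ∞
      (fun y ↦ B (b i) (b' j) * (b.coord i (V y) * b'.coord j (W y))) :=
    fun i j ↦ contMDiff_fun_mul contMDiff_const (h1 i j)
  rw [funext fun y ↦ bilin_eq_sum B b b' (V y) (W y), bilin_eq_sum B b b' _ (W x),
    bilin_eq_sum B b b' (V x), leftDeriv_sum x _ (fun i _ ↦ contMDiff_finsetSum fun j _ ↦ h2 i j),
    ← Finset.sum_add_distrib]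
  refine Finset.sum_congr rfl fun i _ ↦ ?_
  rw [leftDeriv_sum x _ (fun j _ ↦ h2 i j), ← Finset.sum_add_distrib]
  refine Finset.sum_congr rfl fun j _ ↦ ?_
  rw [leftDeriv_const_mul x (h1 i j), leftDeriv_mul x (hV (b.coord i)) (hW (b'.coord j)),
    linear_leftDerivVec (b.coord i) hV, linear_leftDerivVec (b'.coord j) hW]
  ring

end Real

end BilinearCalculus

/-! ### Positivity of the negative Killing form -/

section Killing

variable {n : ℕ} {G : Type*} [TopologicalSpace G] [ChartedSpace (EuclideanSpace ℝ (Fin n)) G]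
  [Group G] [LieGroup (𝓡 n) ∞ G]

theorem Kil_symm (X Y : LieAlg n G) : Kil n G X Y = Kil n G Y X := by
  simp only [Kil, LinearMap.neg_apply]
  exact congrArg Neg.neg (LieModule.traceForm_comm ℝ _ _ X Y)

theorem Kil_lie_left (X Y Z : LieAlg n G) : Kil n G ⁅X, Y⁆ Z = -Kil n G Y ⁅X, Z⁆ := by
  simp only [Kil, LinearMap.neg_apply]
  exact congrArg Neg.neg (LieModule.traceForm_apply_lie_apply' ℝ (LieAlg n G) (LieAlg n G) X Y Z)

/-- Weyl's averaging: a Euclidean inner product in coordinates is averaged over `G`, and the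
resulting `Ad`-invariance is differentiated at `1`. -/
theorem exists_invariant_form [T2Space G] [CompactSpace G] [MeasurableSpace G] [BorelSpace G]
    (ν : MeasureTheory.Measure G) [ν.IsHaarMeasure] :
    ∃ B : LinearMap.BilinForm ℝ (LieAlg n G), (∀ X Y, B X Y = B Y X) ∧ (∀ X, X ≠ 0 → 0 < B X X) ∧
      ∀ X Y Z : LieAlg n G, B ⁅X, Y⁆ Z = -B Y ⁅X, Z⁆ := by
  have : IsTopologicalGroup G := topologicalGroup_of_lieGroup (𝓡 n) ∞
  let b := Module.finBasis ℝ (LieAlg n G)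
  let Φ : LieAlg n G → LieAlg n G → G → ℝ := fun X Y s ↦
    ∑ i, b.coord i (Ad n G s⁻¹ X) * b.coord i (Ad n G s⁻¹ Y)
  have hcont : ∀ X Y, Continuous (Φ X Y) := fun X Y ↦ continuous_finsetSum _ fun i _ ↦
    (isSmooth_Ad_inv X (b.coord i)).continuous.mul (isSmooth_Ad_inv Y (b.coord i)).continuous
  have hint : ∀ X Y, MeasureTheory.Integrable (Φ X Y) ν := fun X Y ↦
    (hcont X Y).integrable_of_hasCompactSupport (HasCompactSupport.of_compactSpace _)
  let B : LinearMap.BilinForm ℝ (LieAlg n G) := LinearMap.mk₂ ℝ (fun X Y ↦ ∫ s, Φ X Y s ∂ν)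
    (fun X X' Y ↦ by
      rw [← MeasureTheory.integral_add (hint X Y) (hint X' Y)]
      congr 1; funext s
      simp only [Φ, map_add, add_mul, Finset.sum_add_distrib])
    (fun c X Y ↦ by
      rw [smul_eq_mul, ← MeasureTheory.integral_const_mul]
      congr 1; funext s
      simp only [Φ, map_smul, smul_eq_mul, Finset.mul_sum, mul_assoc])
    (fun X Y Y' ↦ by
      rw [← MeasureTheory.integral_add (hint X Y) (hint X Y')]
      congr 1; funext s
      simp only [Φ, map_add, mul_add, Finset.sum_add_distrib])
    (fun c X Y ↦ by
      rw [smul_eq_mul, ← MeasureTheory.integral_const_mul]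
      congr 1; funext s
      simp only [Φ, map_smul, smul_eq_mul, Finset.mul_sum, mul_left_comm])
  have hB : ∀ X Y, B X Y = ∫ s, Φ X Y s ∂ν := fun X Y ↦ rfl
  have hinv : ∀ (t : G) X Y, B (Ad n G t⁻¹ X) (Ad n G t⁻¹ Y) = B X Y := by
    intro t X Y
    rw [hB, hB, ← MeasureTheory.integral_mul_left_eq_self (Φ X Y) t]
    congr 1; funext s
    simp only [Φ, mul_inv_rev, map_mul, Module.End.mul_apply]
  refine ⟨B, fun X Y ↦ ?_, fun X hX ↦ ?_, fun Z X Y ↦ ?_⟩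
  · rw [hB, hB]
    congr 1; funext s
    exact Finset.sum_congr rfl fun i _ ↦ mul_comm _ _
  · rw [hB]
    refine (hcont X X).integral_pos_of_hasCompactSupport_nonneg_nonzero
      (HasCompactSupport.of_compactSpace _) (fun s ↦ Finset.sum_nonneg fun i _ ↦ mul_self_nonneg _)
      (x := 1) fun h0 ↦ hX ?_
    refine b.ext_elem fun i ↦ ?_
    have := (Finset.sum_eq_zero_iff_of_nonneg fun i _ ↦ mul_self_nonneg _).1 h0 i (Finset.mem_univ i)
    simpa using this
  · have h1 := leftDeriv_bilin B (isSmooth_Ad_inv X) (isSmooth_Ad_inv Y) (1 : G) Z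
    simp only [hinv] at h1
    rw [leftDeriv_const, leftDerivVec_Ad_inv_one, leftDerivVec_Ad_inv_one] at h1
    simp only [inv_one, map_one, Module.End.one_apply] at h1
    rw [← lie_skew Z X, ← lie_skew Z Y, map_neg, map_neg, LinearMap.neg_apply]
    linarith

/-- `ad X` is skew for an invariant inner product, so `-tr (ad X)² ≥ 0` with equality only if `ad X
= 0`; the adjoint representation of a semisimple Lie algebra is faithful. -/
theorem Kil_pos [T2Space G] [CompactSpace G] [LieAlgebra.IsSemisimple ℝ (LieAlg n G)]
    (X : LieAlg n G) (hX : X ≠ 0) : 0 < Kil n G X X := by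
  have : IsTopologicalGroup G := topologicalGroup_of_lieGroup (𝓡 n) ∞
  borelize G
  obtain ⟨B, hs, hp, hB⟩ := exists_invariant_form (n := n) (G := G) MeasureTheory.Measure.haar
  obtain ⟨h1, h2⟩ := trace_sq_nonpos_of_skew hs hp (T := LieAlgebra.ad ℝ (LieAlg n G) X)
    fun Y Z ↦ hB X Y Z
  have h3 : Kil n G X X = -LinearMap.trace ℝ _
      (LieAlgebra.ad ℝ (LieAlg n G) X ∘ₗ LieAlgebra.ad ℝ (LieAlg n G) X) := rfl
  refine lt_of_le_of_ne (by rw [h3]; linarith) fun h0 ↦ hX ?_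
  have h4 := h2 (by rw [h3] at h0; linarith)
  exact (LieModule.toEnd_eq_zero_iff (R := ℝ) (L := LieAlg n G) (M := LieAlg n G)).1 h4

end Killing

/-! ### The Lie algebra of the stabilizer -/

section Stabilizer

variable {n : ℕ} {G : Type*} [TopologicalSpace G] [ChartedSpace (EuclideanSpace ℝ (Fin n)) G]
  [Group G] [LieGroup (𝓡 n) ∞ G] {μ : Module.Dual ℝ (LieAlg n G)}

theorem mem_stab_iff {s : G} : s ∈ stab μ ↔ ∀ Y : LieAlg n G, μ (Ad n G s⁻¹ Y) = μ Y :=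
  LinearMap.ext_iff

theorem apply_Ad_of_mem_stab {s : G} (hs : s ∈ stab μ) (Y : LieAlg n G) : μ (Ad n G s Y) = μ Y := by
  have := mem_stab_iff.1 (inv_mem hs) Y
  rwa [inv_inv] at this

/-- Along the left-invariant field of `X` the function `s ↦ μ(Ad_{s⁻¹} Y)` has derivative
`μ([Ad_{s⁻¹} Y, X])`. Differentiating along a curve in `K` gives one direction. Conversely, if
`μ([X, ·]) = 0`, these functions are constant along the integral curve of `X` through `1`, which
therefore lies in `K`. -/
theorem mem_kLie_iff [T2Space G] {X : LieAlg n G} : X ∈ kLie μ ↔ ∀ Y : LieAlg n G, μ ⁅X, Y⁆ = 0 := by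
  have hd : ∀ (s : G) (X Y : LieAlg n G),
      leftDeriv ℝ (fun s ↦ μ (Ad n G s⁻¹ Y)) s X = μ ⁅Ad n G s⁻¹ Y, X⁆ := fun s X Y ↦ by
    rw [← linear_leftDerivVec μ (isSmooth_Ad_inv Y), leftDerivVec_Ad_inv]
  have hsm : ∀ Y, ContMDiff (𝓡 n) 𝓘(ℝ, ℝ) ∞ fun s : G ↦ μ (Ad n G s⁻¹ Y) := fun Y ↦
    isSmooth_Ad_inv Y μ
  constructor
  · rintro ⟨γ, h0, hγ, hm, hX⟩ Y
    have h := hasDerivAt_leftDeriv (X := X) 1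
      ((hsm Y).contMDiffAt.mdifferentiableAt (by simp)) h0 hm hX
    have e : (fun t ↦ μ (Ad n G (1 * γ t)⁻¹ Y)) = fun _ ↦ μ Y := funext fun t ↦ by
      rw [one_mul]; exact mem_stab_iff.1 (hγ t) Y
    rw [e] at h
    have h2 := h.unique (hasDerivAt_const _ _)
    rw [hd, inv_one, map_one, Module.End.one_apply] at h2
    rw [← lie_skew, map_neg, h2, neg_zero]
  · intro hX
    have := isManifold_lieGroup n G
    have := isManifold_one_lieGroup n G
    obtain ⟨γ, h0, hγ⟩ := exists_isMIntegralCurveAt_of_contMDiffAt_boundaryless (I := 𝓡 n)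
      (v := mulInvariantVectorField X) (x₀ := (1 : G)) 0
      ((contMDiffAt_mulInvariantVectorField X).of_le (by
        rw [minSmoothness_of_isRCLikeNormedField]; exact one_le_two))
    obtain ⟨ε, hε, hb⟩ := Metric.eventually_nhds_iff_ball.1 hγ
    have hmem : ∀ t ∈ Metric.ball (0 : ℝ) ε, γ t ∈ stab μ := by
      intro t ht
      refine mem_stab_iff.2 fun Y ↦ ?_
      have h1 : ∀ u ∈ Metric.ball (0 : ℝ) ε, HasDerivAt (fun u ↦ μ (Ad n G (γ u)⁻¹ Y)) 0 u := by
        intro u hu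
        have h := hasDerivAt_comp_of_hasMFDerivAt (X := X)
          ((hsm Y).contMDiffAt.mdifferentiableAt (by simp)) (hb u hu)
        rwa [hd, ← lie_skew, map_neg, hX, neg_zero] at h
      have h2 := (convex_ball (0 : ℝ) ε).is_const_of_fderivWithin_eq_zero (𝕜 := ℝ)
        (f := fun u ↦ μ (Ad n G (γ u)⁻¹ Y))
        (fun u hu ↦ (h1 u hu).differentiableAt.differentiableWithinAt)
        (fun u hu ↦ by
          rw [fderivWithin_of_isOpen Metric.isOpen_ball hu, (h1 u hu).hasFDerivAt.fderiv]
          ext; simp) ht (Metric.mem_ball_self hε)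
      simpa [h0] using h2
    classical
    -- The integral curve is only local. Since differentiability is required at `0` alone, it may be
    -- continued by the constant `1`, which is in `K`.
    have he : (fun t ↦ if t ∈ Metric.ball (0 : ℝ) ε then γ t else 1) =ᶠ[nhds 0] γ := by
      filter_upwards [Metric.ball_mem_nhds 0 hε] with t ht
      rw [if_pos ht]
    have hγ0 := hγ.hasMFDerivAt
    have hγ1 := hγ0.congr_of_eventuallyEq he
    refine ⟨fun t ↦ if t ∈ Metric.ball (0 : ℝ) ε then γ t else 1, ?_, fun t ↦ ?_, ?_, ?_⟩
    · simp [hε, h0]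
    · by_cases ht : t ∈ Metric.ball (0 : ℝ) ε
      · simp only [ht, if_true]; exact hmem t ht
      · simp only [ht, if_false]; exact one_mem _
    · exact hγ1.mdifferentiableAt
    · unfold velocity
      have h1 : ∀ y : G, y = 1 → (mulInvariantVectorField X y : EuclideanSpace ℝ (Fin n)) = X := by
        rintro y rfl; exact mulInvariantVectorField_one X
      rw [hγ1.mfderiv]
      exact (one_smul ℝ _).trans (h1 _ h0)

end Stabilizer

/-! ### The splitting of the Lie algebra and the canonical Kähler structure -/

section Orbit

variable {n : ℕ} {G : Type*} [TopologicalSpace G] [ChartedSpace (EuclideanSpace ℝ (Fin n)) G]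
  [Group G] [LieGroup (𝓡 n) ∞ G] [T2Space G] [CompactSpace G]
  [LieAlgebra.IsSemisimple ℝ (LieAlg n G)] {μ : Module.Dual ℝ (LieAlg n G)}

theorem exists_eq_Kil (μ : Module.Dual ℝ (LieAlg n G)) :
    ∃ Z : LieAlg n G, ∀ X, μ X = Kil n G Z X := by
  have hinj : Function.Injective (Kil n G) := by
    refine (injective_iff_map_eq_zero _).2 fun X hX ↦ ?_
    by_contra hne
    have := Kil_pos X hne
    rw [hX] at this
    exact this.false
  obtain ⟨Z, hZ⟩ := (LinearMap.injective_iff_surjective_of_finrank_eq_finrank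
    (Subspace.dual_finrank_eq (K := ℝ) (V := LieAlg n G)).symm).1 hinj μ
  exact ⟨Z, fun X ↦ by rw [hZ]⟩

/-- The element of `𝔤` representing the functional `μ` through the form `Kil`. -/
def dualVec (μ : Module.Dual ℝ (LieAlg n G)) : LieAlg n G := (exists_eq_Kil μ).choose

theorem Kil_dualVec (μ : Module.Dual ℝ (LieAlg n G)) (X : LieAlg n G) :
    Kil n G (dualVec μ) X = μ X := ((exists_eq_Kil μ).choose_spec X).symm

/-- By invariance of `Kil`. This is why `Γ` is the restriction of `ad (dualVec μ)`. -/
theorem apply_lie_eq_Kil (X Y : LieAlg n G) : μ ⁅X, Y⁆ = Kil n G ⁅dualVec μ, X⁆ Y := by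
  have h := Kil_lie_left X (dualVec μ) Y
  rw [← Kil_dualVec, ← lie_skew (dualVec μ) X, map_neg (Kil n G), LinearMap.neg_apply, h, neg_neg]

theorem mem_kLie_iff_lie_eq_zero {X : LieAlg n G} : X ∈ kLie μ ↔ ⁅dualVec μ, X⁆ = 0 := by
  rw [mem_kLie_iff]
  simp only [apply_lie_eq_Kil]
  refine ⟨fun h ↦ ?_, fun h Y ↦ by rw [h, map_zero, LinearMap.zero_apply]⟩
  by_contra hne
  exact (Kil_pos _ hne).ne' (h _)

theorem lie_dualVec_mem_mSub (X : LieAlg n G) : ⁅dualVec μ, X⁆ ∈ mSub μ := fun Y hY ↦ by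
  rw [Kil_symm, Kil_lie_left, mem_kLie_iff_lie_eq_zero.1 hY, map_zero, neg_zero]

variable (μ) in
/-- The Lie algebra `𝔨` as a subspace of `𝔤`. -/
def kSub : Submodule ℝ (LieAlg n G) :=
  LinearMap.ker (LieAlgebra.ad ℝ (LieAlg n G) (dualVec μ))

theorem mem_kSub {X : LieAlg n G} : X ∈ kSub μ ↔ X ∈ kLie μ := by
  rw [mem_kLie_iff_lie_eq_zero]; exact LinearMap.mem_ker

variable (μ) in
-- `Kil` is definite, so no nonzero vector of `𝔨` is orthogonal to `𝔨`.
theorem isCompl_mSub_kSub : IsCompl (mSub μ) (kSub μ) := by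
  have h : mSub μ = LinearMap.BilinForm.orthogonal (Kil n G) (kSub μ) := by
    ext Y
    exact forall_congr' fun X ↦ imp_congr mem_kSub.symm Iff.rfl
  rw [h]
  refine ((LinearMap.BilinForm.isCompl_orthogonal_iff_disjoint ?_).2 ?_).symm
  · intro X Y hXY
    rw [Kil_symm, hXY]
  · rw [← h, Submodule.disjoint_def]
    intro X h1 h2
    by_contra hne
    exact (Kil_pos X hne).ne' (h2 X (mem_kSub.1 h1))

variable (μ) in
/-- The projection of `𝔤 = 𝔪 ⊕ 𝔨` onto `𝔪`. -/
def projM : LieAlg n G →ₗ[ℝ] mSub μ := (mSub μ).projectionOnto (kSub μ) (isCompl_mSub_kSub μ)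

@[simp] theorem projM_coe (Y : mSub μ) : projM μ (Y : LieAlg n G) = Y :=
  Submodule.projectionOnto_apply_left (isCompl_mSub_kSub μ) Y

theorem projM_of_mem_kLie {X : LieAlg n G} (hX : X ∈ kLie μ) : projM μ X = 0 :=
  (Submodule.projectionOnto_apply_eq_zero_iff (isCompl_mSub_kSub μ)).2 (mem_kSub.2 hX)

theorem sub_projM_mem (X : LieAlg n G) : X - projM μ X ∈ kLie μ := by
  rw [← mem_kSub, ← Submodule.ker_projectionOnto (isCompl_mSub_kSub μ), LinearMap.mem_ker]
  have := projM_coe (projM μ X)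
  rw [map_sub]
  exact sub_eq_zero.2 this.symm

theorem projM_eq_of_sub_mem {X : LieAlg n G} {Y : mSub μ} (h : X - Y ∈ kLie μ) : projM μ X = Y := by
  have := projM_of_mem_kLie h
  rw [map_sub, projM_coe] at this
  exact sub_eq_zero.1 this

theorem projM_Ad (s : stab μ) (X : LieAlg n G) : projM μ (Ad n G s X) = AdM μ s (projM μ X) := by
  refine projM_eq_of_sub_mem ?_
  have := Ad_mem_kLie μ s.2 (sub_projM_mem (μ := μ) X)
  rwa [map_sub] at this

theorem Kil_projM (X : LieAlg n G) (Y : mSub μ) :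
    Kil n G (projM μ X : LieAlg n G) Y = Kil n G X Y := by
  have := Y.2 _ (sub_projM_mem (μ := μ) X)
  rw [map_sub, LinearMap.sub_apply] at this
  linarith

theorem lie_dualVec_projM (X : LieAlg n G) :
    ⁅dualVec μ, (projM μ X : LieAlg n G)⁆ = ⁅dualVec μ, X⁆ := by
  have := mem_kLie_iff_lie_eq_zero.1 (sub_projM_mem (μ := μ) X)
  rw [lie_sub, sub_eq_zero] at this
  exact this.symm

theorem apply_lie_of_mem_kLie {X : LieAlg n G} (hX : X ∈ kLie μ) (Y : LieAlg n G) :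
    μ ⁅X, Y⁆ = 0 := mem_kLie_iff.1 hX Y

theorem apply_lie_projM (X : LieAlg n G) (Y : LieAlg n G) :
    μ ⁅(projM μ X : LieAlg n G), Y⁆ = μ ⁅X, Y⁆ := by
  have := apply_lie_of_mem_kLie (sub_projM_mem (μ := μ) X) Y
  rw [sub_lie, map_sub] at this
  linarith

variable (μ) in
/-- The restriction of `Kil` to `𝔪`. -/
def KilM : LinearMap.BilinForm ℝ (mSub μ) := (Kil n G).restrict (mSub μ)

theorem KilM_apply (X Y : mSub μ) : KilM μ X Y = Kil n G X Y := rfl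

theorem KilM_symm (X Y : mSub μ) : KilM μ X Y = KilM μ Y X := Kil_symm _ _

theorem KilM_pos (X : mSub μ) (hX : X ≠ 0) : 0 < KilM μ X X :=
  Kil_pos _ (by simpa using hX)

variable (μ) in
/-- The operator `Γ` on `𝔪` with `ω(X, Y) = Kil(Γ X, Y)`. -/
def gammaOp : mSub μ →ₗ[ℝ] mSub μ :=
  (LieAlgebra.ad ℝ (LieAlg n G) (dualVec μ)).restrict fun X _ ↦ lie_dualVec_mem_mSub X

theorem gammaOp_coe (X : mSub μ) : (gammaOp μ X : LieAlg n G) = ⁅dualVec μ, (X : LieAlg n G)⁆ := rfl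

theorem omega_eq_KilM (X Y : mSub μ) : omega μ X Y = KilM μ (gammaOp μ X) Y :=
  apply_lie_eq_Kil _ _

/-- `ad (dualVec μ)` kills `𝔨` and has its image in `𝔪`, hence commutes with the projection. -/
theorem gammaOp_projM (X : LieAlg n G) : gammaOp μ (projM μ X) = projM μ ⁅dualVec μ, X⁆ := by
  rw [← lie_dualVec_projM, ← gammaOp_coe, projM_coe]

theorem gammaOp_skew (X Y : mSub μ) : KilM μ (gammaOp μ X) Y = -KilM μ X (gammaOp μ Y) :=
  Kil_lie_left _ _ _

theorem gammaOp_injective (X : mSub μ) (hX : gammaOp μ X = 0) : X = 0 := by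
  have h1 : (X : LieAlg n G) ∈ kLie μ := mem_kLie_iff_lie_eq_zero.2 (congrArg Subtype.val hX)
  rw [← projM_coe X, projM_of_mem_kLie h1]

theorem AdM_coe (s : stab μ) (X : mSub μ) : (AdM μ s X : LieAlg n G) = Ad n G s X := rfl

theorem omega_AdM (s : stab μ) (X Y : mSub μ) :
    omega μ (AdM μ s X) (AdM μ s Y) = omega μ X Y := by
  unfold omega
  rw [AdM_coe, AdM_coe, ← apply_Ad_of_mem_stab s.2 ⁅(X : LieAlg n G), (Y : LieAlg n G)⁆]
  exact congrArg μ (AdCLM_lie _ _ _).symm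

theorem KilM_AdM (s : stab μ) (X Y : mSub μ) :
    KilM μ (AdM μ s X) (AdM μ s Y) = KilM μ X Y := Kil_Ad _ _ _

theorem AdM_mul_apply (s t : stab μ) (X : mSub μ) : AdM μ (s * t) X = AdM μ s (AdM μ t X) :=
  Subtype.ext (AdFun_mul _ _ _)

theorem AdM_one_apply (X : mSub μ) : AdM μ 1 X = X := Subtype.ext (AdFun_one _)

theorem AdM_inv_apply (s : stab μ) (X : mSub μ) : AdM μ s (AdM μ s⁻¹ X) = X := by
  rw [← AdM_mul_apply, mul_inv_cancel, AdM_one_apply]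

theorem AdM_inv_apply' (s : stab μ) (X : mSub μ) : AdM μ s⁻¹ (AdM μ s X) = X := by
  rw [← AdM_mul_apply, inv_mul_cancel, AdM_one_apply]

theorem gammaOp_AdM (s : stab μ) (X : mSub μ) : gammaOp μ (AdM μ s X) = AdM μ s (gammaOp μ X) :=
  form_ext KilM_pos fun Y ↦ by
    rw [← AdM_inv_apply s Y, ← omega_eq_KilM, omega_AdM, KilM_AdM, omega_eq_KilM]

theorem AlmostHermitian.IsCanonicalKahler.exists_isPolar {h : AlmostHermitian μ}
    (hh : h.IsCanonicalKahler) : ∃ P, IsPolar (KilM μ) (gammaOp μ) P h.J := by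
  obtain ⟨⟨Γ, P, h1, h2, h3, h4, h5⟩, -⟩ := hh
  have : Γ = gammaOp μ := LinearMap.ext fun X ↦ form_ext KilM_pos fun Y ↦ by
    rw [← omega_eq_KilM, h1]; rfl
  subst this
  exact ⟨P, h2, h3, h4, h5⟩

variable (μ) in
-- The metric is `g(X, Y) = Kil(|Γ| X, Y)`, which shows symmetry and positivity; its `K`-invariance
-- is clearer from `ω(X, J Y)`. Uniqueness is that of the polar decomposition.
theorem existsUnique_isCanonicalKahler : ∃! h : AlmostHermitian μ, h.IsCanonicalKahler := by
  obtain ⟨P, J, hPJ, hJ2, hcomm, hpos, hS, huniq⟩ :=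
    exists_polar KilM_symm KilM_pos gammaOp_skew (gammaOp_injective (μ := μ))
  have hΓ : ∀ X, gammaOp μ X = P (J X) := fun X ↦ LinearMap.congr_fun hPJ.eq X
  have hg : ∀ X Y, KilM μ (P X) Y = omega μ X (J Y) := fun X Y ↦ by
    rw [omega_eq_KilM, hΓ, hcomm, hPJ.orth]
  have hJAd : ∀ (s : stab μ) X, J (AdM μ s X) = AdM μ s (J X) := fun s X ↦
    hS (AdM μ s) (fun X ↦ (gammaOp_AdM s X).symm) X
  refine ⟨{ g := (KilM μ).compLeft P
            J := J
            g_symm := fun X Y ↦ ?_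
            g_pos := fun X hX ↦ hpos X hX
            J_sq := hJ2
            g_J := fun X Y ↦ ?_
            g_Ad := fun s X Y ↦ ?_
            J_Ad := hJAd }, ⟨⟨gammaOp μ, P, omega_eq_KilM, hPJ.symm, hPJ.nonneg, hPJ.orth, hPJ.eq⟩,
              hg⟩, fun h hh ↦ ?_⟩
  · simp only [LinearMap.BilinForm.compLeft_apply]
    rw [hPJ.symm, KilM_symm]
  · simp only [LinearMap.BilinForm.compLeft_apply]
    rw [hcomm, hPJ.orth]
  · simp only [LinearMap.BilinForm.compLeft_apply]
    rw [hg, hJAd, omega_AdM, hg]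
  · obtain ⟨P', hP'⟩ := hh.exists_isPolar
    have hJJ := (huniq P' h.J hP').2
    refine AlmostHermitian.ext (LinearMap.ext₂ fun X Y ↦ ?_) hJJ
    rw [hh.2, hJJ]
    exact (hg X Y).symm

namespace AlmostHermitian.IsCanonicalKahler

variable {h : AlmostHermitian μ} (hh : h.IsCanonicalKahler)
include hh

theorem gammaOp_comm (X : mSub μ) : gammaOp μ (h.J X) = h.J (gammaOp μ X) := by
  obtain ⟨P, hP⟩ := hh.exists_isPolar
  obtain ⟨P', J', hPJ, -, hcomm, -, -, huniq⟩ :=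
    exists_polar KilM_symm KilM_pos gammaOp_skew (gammaOp_injective (μ := μ))
  obtain ⟨rfl, hJ⟩ := huniq P h.J hP
  have h1 : ∀ X, gammaOp μ X = P (h.J X) := fun X ↦ LinearMap.congr_fun hP.eq X
  rw [h1, h1, hJ, hcomm]

/-- On such a `v` the operator `|Γ|` acts as `c`, so `J` is `Γ / c` there. The criterion applies to
brackets of eigenvectors, where only `Γ² v` is known. -/
theorem smul_J_eq {v : mSub μ} {c : ℝ} (hc : 0 < c)
    (hv : gammaOp μ (gammaOp μ v) = -(c ^ 2) • v) : c • h.J v = gammaOp μ v := by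
  obtain ⟨P, hP⟩ := hh.exists_isPolar
  obtain ⟨P', J', hPJ, -, hcomm, -, -, huniq⟩ :=
    exists_polar KilM_symm KilM_pos gammaOp_skew (gammaOp_injective (μ := μ))
  obtain ⟨rfl, hJ⟩ := huniq P h.J hP
  have h1 : P v = c • v := eq_smul_of_sq_eq KilM_pos hP.nonneg hc (by
    rw [hP.sq KilM_pos gammaOp_skew, hv, neg_smul, neg_neg])
  have h2 : gammaOp μ v = P (h.J v) := LinearMap.congr_fun hP.eq v
  rw [h2, hJ, hcomm, h1, map_smul]

theorem exists_eigenbasis : ∃ (b : Module.Basis (Fin (Module.finrank ℝ (mSub μ))) ℝ (mSub μ))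
    (c : Fin (Module.finrank ℝ (mSub μ)) → ℝ), ∀ i, 0 < c i ∧ gammaOp μ (b i) = c i • h.J (b i) := by
  obtain ⟨P, hP⟩ := hh.exists_isPolar
  obtain ⟨P', J', hPJ, -, hcomm, hpos, -, huniq⟩ :=
    exists_polar KilM_symm KilM_pos gammaOp_skew (gammaOp_injective (μ := μ))
  obtain ⟨rfl, hJ⟩ := huniq P h.J hP
  obtain ⟨b, c, hb, hc⟩ := exists_orthonormal_eigenbasis KilM_symm KilM_pos P hP.symm
  refine ⟨b, c, fun i ↦ ⟨?_, ?_⟩⟩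
  · have := hpos (b i) (b.ne_zero i)
    rwa [hc, map_smul, LinearMap.smul_apply, hb, if_pos rfl, smul_eq_mul, mul_one] at this
  · have h2 : gammaOp μ (b i) = P (h.J (b i)) := LinearMap.congr_fun hP.eq (b i)
    rw [h2, hJ, hcomm, hc, map_smul]

end AlmostHermitian.IsCanonicalKahler

end Orbit

section LeviCivita

variable {n : ℕ} {G : Type*} [TopologicalSpace G] [ChartedSpace (EuclideanSpace ℝ (Fin n)) G]
  [Group G] [LieGroup (𝓡 n) ∞ G] [T2Space G] [CompactSpace G]
  [LieAlgebra.IsSemisimple ℝ (LieAlg n G)] {μ : Module.Dual ℝ (LieAlg n G)}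

/-! ### Functions and vector fields on the orbit -/

/-- Up to sign conventions these are the fields generated by the left action of `G` on the orbit. -/
theorem isTangentField_projM_Ad (Z : LieAlg n G) :
    IsTangentField (μ := μ) fun x : G ↦ projM μ (Ad n G x⁻¹ Z) := by
  refine ⟨(isSmooth_Ad_inv Z).comp_linearMap (projM μ), fun x s ↦ ?_⟩
  have h : Ad n G (x * s)⁻¹ Z = Ad n G (s⁻¹ : stab μ) (Ad n G x⁻¹ Z) := by
    rw [← Module.End.mul_apply, ← map_mul, mul_inv_rev]; rfl
  exact (congrArg (projM μ) h).trans (projM_Ad _ _)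

/-- Makes it possible to pass from identities between vector fields to pointwise identities between
tensors. -/
theorem exists_isTangentField (x : G) (X : mSub μ) :
    ∃ V : G → mSub μ, IsTangentField V ∧ V x = X := by
  refine ⟨_, isTangentField_projM_Ad (Ad n G x (X : LieAlg n G)), ?_⟩
  have h : Ad n G x⁻¹ (Ad n G x (X : LieAlg n G)) = X := by
    rw [← Module.End.mul_apply, ← map_mul]; simp
  rw [h, projM_coe]

theorem isBaseFunction_coAd (Y : LieAlg n G) :
    IsBaseFunction μ fun x : G ↦ μ (Ad n G x⁻¹ Y) := by
  refine ⟨isSmooth_Ad_inv Y μ, fun x s ↦ ?_⟩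
  have h : Ad n G (x * s)⁻¹ Y = Ad n G (s : G)⁻¹ (Ad n G x⁻¹ Y) := by
    rw [← Module.End.mul_apply, ← map_mul, mul_inv_rev]
  exact (congrArg μ h).trans (apply_Ad_of_mem_stab (inv_mem s.2) _)

/-- The functions `x ↦ μ(Ad_{x⁻¹} Y)`, which are the linear coordinates on the coadjoint orbit,
already separate tangent vectors: a vector annihilated by all of them lies in `𝔨 ∩ 𝔪`. -/
theorem eq_zero_of_leftDeriv_base {x : G} {X : mSub μ}
    (h : ∀ f : G → ℝ, IsBaseFunction μ f → leftDeriv ℝ f x (X : LieAlg n G) = 0) : X = 0 := by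
  have h1 : (X : LieAlg n G) ∈ kLie μ := mem_kLie_iff.2 fun Y ↦ by
    have h2 := h _ (isBaseFunction_coAd (Ad n G x Y))
    have h3 := linear_leftDerivVec μ (isSmooth_Ad_inv (Ad n G x Y)) x (X : LieAlg n G)
    rw [leftDerivVec_Ad_inv] at h3
    have h4 : Ad n G x⁻¹ (Ad n G x Y) = Y := by
      rw [← Module.End.mul_apply, ← map_mul]; simp
    rw [h4] at h3
    rw [← lie_skew, map_neg, h3, h2, neg_zero]
  rw [← projM_coe X, projM_of_mem_kLie h1]

theorem leftDeriv_base_of_mem_kLie {f : G → ℝ} (hf : IsBaseFunction μ f) (x : G) {X : LieAlg n G}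
    (hX : X ∈ kLie μ) : leftDeriv ℝ f x X = 0 := by
  obtain ⟨γ, h0, hγ, hd, hv⟩ := hX
  have h1 := hasDerivAt_leftDeriv x (hf.1.contMDiffAt.mdifferentiableAt (by simp)) h0 hd hv
  have h2 : (fun t ↦ f (x * γ t)) = fun _ ↦ f x := funext fun t ↦ hf.2 x ⟨γ t, hγ t⟩
  rw [h2] at h1
  exact h1.unique (hasDerivAt_const _ _)

theorem leftDeriv_base_projM {f : G → ℝ} (hf : IsBaseFunction μ f) (x : G) (X : LieAlg n G) :
    leftDeriv ℝ f x (projM μ X : LieAlg n G) = leftDeriv ℝ f x X := by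
  have h := leftDeriv_base_of_mem_kLie hf x (sub_projM_mem (μ := μ) X)
  have h2 : leftDeriv ℝ f x (X - (projM μ X : LieAlg n G)) + leftDeriv ℝ f x (projM μ X : LieAlg n G) =
      leftDeriv ℝ f x X := by rw [← leftDeriv_add_right, sub_add_cancel]
  rw [← h2, h, zero_add]

theorem IsTangentField.isSmooth_coe {V : G → mSub μ} (hV : IsTangentField V) :
    IsSmooth n ℝ fun x ↦ (V x : LieAlg n G) := hV.1.comp_linearMap (mSub μ).subtype

theorem IsTangentField.add {V W : G → mSub μ} (hV : IsTangentField V)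
    (hW : IsTangentField W) : IsTangentField fun x ↦ V x + W x :=
  ⟨hV.1.add hW.1, fun x s ↦ by beta_reduce; rw [hV.2, hW.2, map_add]⟩

theorem isTangentField_canonicalConnection {V W : G → mSub μ} (hV : IsTangentField V)
    (hW : IsTangentField W) : IsTangentField (canonicalConnection V W) := by
  refine ⟨fun ℓ ↦ ?_, fun x s ↦ ?_⟩
  · unfold canonicalConnection
    simp only [linear_leftDerivVec ℓ hW.1]
    exact contMDiff_leftDeriv_field (hW.1 ℓ) hV.isSmooth_coe
  · unfold canonicalConnection
    rw [hV.2, AdM_coe, linearMap_leftDerivVec (AdM μ s⁻¹) hW.1]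
    have h := leftDerivVec_mul_right hW.1 x (s : G) (V x : LieAlg n G)
    simp only [hW.2] at h
    exact h.symm

variable (μ) in
/-- The bracket of `𝔤` followed by the projection onto `𝔪`. -/
def bracketM : mSub μ →ₗ[ℝ] mSub μ →ₗ[ℝ] mSub μ :=
  LinearMap.mk₂ ℝ (fun X Y ↦ projM μ ⁅(X : LieAlg n G), (Y : LieAlg n G)⁆)
    (fun X X' Y ↦ by simp) (fun c X Y ↦ by simp) (fun X Y Y' ↦ by simp) (fun c X Y ↦ by simp)

theorem bracketM_apply (X Y : mSub μ) :
    bracketM μ X Y = projM μ ⁅(X : LieAlg n G), (Y : LieAlg n G)⁆ := rfl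

theorem bracketM_skew (X Y : mSub μ) : bracketM μ X Y = -bracketM μ Y X := by
  rw [bracketM_apply, bracketM_apply, ← lie_skew, map_neg]

theorem bracketM_AdM (s : stab μ) (X Y : mSub μ) :
    bracketM μ (AdM μ s X) (AdM μ s Y) = AdM μ s (bracketM μ X Y) := by
  rw [bracketM_apply, bracketM_apply, ← projM_Ad, AdM_coe, AdM_coe]
  exact congrArg _ (AdCLM_lie _ _ _).symm

/-- Computes the torsion of the canonical connection. The second-order terms leave the
left-invariant bracket `[V(x), W(x)]`, whose `𝔨`-component annihilates functions on the orbit. -/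
theorem fieldDeriv_commutator {V W : G → mSub μ} (hV : IsTangentField V) (hW : IsTangentField W)
    {f : G → ℝ} (hf : IsBaseFunction μ f) (x : G) :
    fieldDeriv V (fieldDeriv W f) x - fieldDeriv W (fieldDeriv V f) x =
      leftDeriv ℝ f x ((canonicalConnection V W x - canonicalConnection W V x +
        bracketM μ (V x) (W x) : mSub μ) : LieAlg n G) := by
  have hcan : ∀ {V W : G → mSub μ}, IsTangentField W →
      ((canonicalConnection V W x : mSub μ) : LieAlg n G) =
        leftDerivVec ℝ (fun y ↦ (W y : LieAlg n G)) x (V x : LieAlg n G) := fun hW ↦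
    linearMap_leftDerivVec (mSub μ).subtype hW.1 x _
  have h1 := leftDeriv_leftDeriv_field hf.1 hW.isSmooth_coe x (V x : LieAlg n G)
  have h2 := leftDeriv_leftDeriv_field hf.1 hV.isSmooth_coe x (W x : LieAlg n G)
  have h3 := leftDeriv_lie hf.1 x (V x : LieAlg n G) (W x : LieAlg n G)
  rw [← hcan hW] at h1
  rw [← hcan hV] at h2
  have h4 := leftDeriv_base_projM hf x ⁅(V x : LieAlg n G), (W x : LieAlg n G)⁆
  have h5 : ∀ A B C : mSub μ, leftDeriv ℝ f x ((A - B + C : mSub μ) : LieAlg n G) =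
      leftDeriv ℝ f x (A : LieAlg n G) - leftDeriv ℝ f x (B : LieAlg n G) +
        leftDeriv ℝ f x (C : LieAlg n G) := fun A B C ↦ by
    have := map_add ((leftDifferential x f) ∘ₗ (mSub μ).subtype) (A - B) C
    rw [map_sub] at this
    exact this
  rw [h5, bracketM_apply, h4, h3]
  unfold fieldDeriv
  rw [h1, h2]
  ring

/-! ### The Levi-Civita connection -/

/-- The derivatives of the fields cancel: the canonical connection satisfies the product rule for
the constant form `g`, and its torsion is `-[X, Y]_𝔪`. What remains is algebraic, because fields
take arbitrary values at `x` and base functions separate tangent vectors. -/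
theorem isLeviCivita_iff (c : Connection μ) (h : AlmostHermitian μ) : c.IsLeviCivita h ↔
    (∀ x X Y Z, h.g (c.L x X Y) Z + h.g Y (c.L x X Z) = 0) ∧
      ∀ x X Y, c.L x X Y - c.L x Y X = bracketM μ X Y := by
  refine and_congr ?_ ?_
  · have key : ∀ U V W : G → mSub μ, IsTangentField U → IsTangentField V → IsTangentField W →
        ∀ x, (fieldDeriv U (fun y ↦ h.g (V y) (W y)) x =
          h.g (c.cov U V x) (W x) + h.g (V x) (c.cov U W x) ↔
            h.g (c.L x (U x) (V x)) (W x) + h.g (V x) (c.L x (U x) (W x)) = 0) := by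
      intro U V W hU hV hW x
      have h1 := leftDeriv_bilin h.g hV.1 hW.1 x (U x : LieAlg n G)
      unfold fieldDeriv Connection.cov canonicalConnection
      rw [h1, map_add, map_add, LinearMap.add_apply]
      constructor <;> intro h <;> linarith
    constructor
    · intro hm x X Y Z
      obtain ⟨U, hU, rfl⟩ := exists_isTangentField x X
      obtain ⟨V, hV, rfl⟩ := exists_isTangentField x Y
      obtain ⟨W, hW, rfl⟩ := exists_isTangentField x Z
      exact (key U V W hU hV hW x).1 (hm U V W hU hV hW x)
    · intro hL U V W hU hV hW x
      exact (key U V W hU hV hW x).2 (hL _ _ _ _)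
  · have key : ∀ V W : G → mSub μ, IsTangentField V → IsTangentField W →
        ∀ x f, IsBaseFunction μ f → (fieldDeriv (fun y ↦ c.cov V W y - c.cov W V y) f x =
          fieldDeriv V (fieldDeriv W f) x - fieldDeriv W (fieldDeriv V f) x ↔
            leftDeriv ℝ f x ((c.L x (V x) (W x) - c.L x (W x) (V x) - bracketM μ (V x) (W x) :
              mSub μ) : LieAlg n G) = 0) := by
      intro V W hV hW x f hf
      rw [fieldDeriv_commutator hV hW hf, ← sub_eq_zero]
      have h5 : ∀ A B : mSub μ, leftDeriv ℝ f x ((A - B : mSub μ) : LieAlg n G) =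
          leftDeriv ℝ f x (A : LieAlg n G) - leftDeriv ℝ f x (B : LieAlg n G) := fun A B ↦
        map_sub ((leftDifferential x f) ∘ₗ (mSub μ).subtype) A B
      unfold fieldDeriv
      rw [← h5]
      have h6 : c.cov V W x - c.cov W V x - (canonicalConnection V W x - canonicalConnection W V x +
          bracketM μ (V x) (W x)) =
          c.L x (V x) (W x) - c.L x (W x) (V x) - bracketM μ (V x) (W x) := by
        unfold Connection.cov; abel
      rw [h6]
    constructor
    · intro ht x X Y
      obtain ⟨V, hV, rfl⟩ := exists_isTangentField x X
      obtain ⟨W, hW, rfl⟩ := exists_isTangentField x Y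
      rw [← sub_eq_zero]
      exact eq_zero_of_leftDeriv_base fun f hf ↦ (key V W hV hW x f hf).1 (ht V W hV hW f hf x)
    · intro hL V W hV hW f hf x
      refine (key V W hV hW x f hf).2 ?_
      rw [hL, sub_self]
      exact map_zero (leftDifferential x f)

namespace AlmostHermitian

variable (h : AlmostHermitian μ)

/-- The functional `Z ↦ g(∇_X Y, Z)` given by the Koszul formula. -/
def koszul : mSub μ →ₗ[ℝ] mSub μ →ₗ[ℝ] Module.Dual ℝ (mSub μ) :=
  LinearMap.mk₂ ℝ (fun X Y ↦ (1 / 2 : ℝ) • (h.g (bracketM μ X Y) - h.g X ∘ₗ bracketM μ Y -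
      h.g Y ∘ₗ bracketM μ X))
    (fun X X' Y ↦ by
      simp only [map_add, LinearMap.add_apply, LinearMap.add_comp, LinearMap.comp_add]; module)
    (fun c X Y ↦ by
      simp only [map_smul, LinearMap.smul_apply, LinearMap.smul_comp, LinearMap.comp_smul]; module)
    (fun X Y Y' ↦ by
      simp only [map_add, LinearMap.add_comp, LinearMap.comp_add]; module)
    (fun c X Y ↦ by
      simp only [map_smul, LinearMap.smul_comp, LinearMap.comp_smul]; module)

/-- The tensor field `L` of the Levi-Civita connection, which is constant on `G`. -/
def lcTensor : mSub μ →ₗ[ℝ] mSub μ →ₗ[ℝ] mSub μ :=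
  h.koszul.compr₂ (LinearMap.BilinForm.toDual h.g h.g_nondegenerate).symm.toLinearMap

theorem g_lcTensor (X Y Z : mSub μ) : h.g (h.lcTensor X Y) Z =
    (1 / 2 : ℝ) * (h.g (bracketM μ X Y) Z - h.g X (bracketM μ Y Z) - h.g Y (bracketM μ X Z)) :=
  LinearMap.BilinForm.apply_toDual_symm_apply (hB := h.g_nondegenerate) (h.koszul X Y) Z

theorem ext_g {X Y : mSub μ} (hXY : ∀ Z, h.g X Z = h.g Y Z) : X = Y := form_ext h.g_pos hXY

theorem lcTensor_skew (X Y Z : mSub μ) :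
    h.g (h.lcTensor X Y) Z + h.g Y (h.lcTensor X Z) = 0 := by
  rw [h.g_symm Y, g_lcTensor, g_lcTensor, bracketM_skew Z Y, map_neg, h.g_symm _ Z, h.g_symm _ Y]
  ring

theorem lcTensor_torsion (X Y : mSub μ) :
    h.lcTensor X Y - h.lcTensor Y X = bracketM μ X Y := by
  refine h.ext_g fun Z ↦ ?_
  rw [map_sub, LinearMap.sub_apply, g_lcTensor, g_lcTensor, bracketM_skew Y X, map_neg,
    LinearMap.neg_apply]
  ring

theorem lcTensor_unique {L : mSub μ →ₗ[ℝ] mSub μ →ₗ[ℝ] mSub μ}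
    (h1 : ∀ X Y Z, h.g (L X Y) Z + h.g Y (L X Z) = 0)
    (h2 : ∀ X Y, L X Y - L Y X = bracketM μ X Y) : L = h.lcTensor := by
  refine LinearMap.ext₂ fun X Y ↦ h.ext_g fun Z ↦ ?_
  rw [g_lcTensor, ← h2 X Y, ← h2 Y Z, ← h2 X Z]
  simp only [map_sub, LinearMap.sub_apply]
  have := h1 X Y Z
  have := h1 Y X Z
  have := h1 Z X Y
  have := h.g_symm Y (L Z X)
  rw [h.g_symm (L Z X) Y] at *
  have := h.g_symm X (L Z Y)
  linarith

theorem lcTensor_AdM (s : stab μ) (X Y : mSub μ) :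
    h.lcTensor (AdM μ s X) (AdM μ s Y) = AdM μ s (h.lcTensor X Y) := by
  refine h.ext_g fun Z ↦ ?_
  rw [← AdM_inv_apply s Z, h.g_Ad, g_lcTensor, g_lcTensor]
  simp only [bracketM_AdM, h.g_Ad]

theorem isTangentField_lcTensor {V W : G → mSub μ} (hV : IsTangentField V)
    (hW : IsTangentField W) : IsTangentField fun x ↦ h.lcTensor (V x) (W x) :=
  ⟨fun ℓ ↦ contMDiff_bilin (h.lcTensor.compr₂ ℓ) hV.1 hW.1, fun x s ↦ by
    beta_reduce; rw [hV.2, hW.2, lcTensor_AdM]⟩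

/-- The Levi-Civita connection. -/
def lcConnection : Connection μ where
  L _ := h.lcTensor
  isTangentField _ _ hV hW :=
    (isTangentField_canonicalConnection hV hW).add (h.isTangentField_lcTensor hV hW)

theorem isLeviCivita_lcConnection : h.lcConnection.IsLeviCivita h :=
  (isLeviCivita_iff _ h).2 ⟨fun _ ↦ h.lcTensor_skew, fun _ ↦ h.lcTensor_torsion⟩

variable {h}

theorem eq_lcConnection {c : Connection μ} (hc : c.IsLeviCivita h) : c = h.lcConnection := by
  obtain ⟨h1, h2⟩ := (isLeviCivita_iff c h).1 hc
  exact Connection.ext (funext fun x ↦ h.lcTensor_unique (h1 x) (h2 x))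

variable (h) in
theorem existsUnique_isLeviCivita : ∃! c : Connection μ, c.IsLeviCivita h :=
  ⟨_, h.isLeviCivita_lcConnection, fun _ hc ↦ eq_lcConnection hc⟩

end AlmostHermitian

end LeviCivita

/-! ### Integrability of `J` and the Kähler property -/

section Integrable

variable {n : ℕ} {G : Type*} [TopologicalSpace G] [ChartedSpace (EuclideanSpace ℝ (Fin n)) G]
  [Group G] [LieGroup (𝓡 n) ∞ G] [T2Space G] [CompactSpace G]
  [LieAlgebra.IsSemisimple ℝ (LieAlg n G)] {μ : Module.Dual ℝ (LieAlg n G)}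

/-- The Jacobi identity for `dualVec μ`, projected to `𝔪`. The projected bracket need not satisfy
Jacobi itself, yet `Γ` is a derivation of it. -/
theorem gammaOp_bracketM (X Y : mSub μ) : gammaOp μ (bracketM μ X Y) =
    bracketM μ (gammaOp μ X) Y + bracketM μ X (gammaOp μ Y) := by
  rw [bracketM_apply, gammaOp_projM, leibniz_lie, map_add]
  rfl

namespace AlmostHermitian

/-- The Nijenhuis tensor of `J` at the base point. -/
def nijenhuis (h : AlmostHermitian μ) : mSub μ →ₗ[ℝ] mSub μ →ₗ[ℝ] mSub μ :=
  (bracketM μ).compl₁₂ h.J h.J - bracketM μ -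
    ((bracketM μ).compl₁₂ h.J LinearMap.id).compr₂ h.J -
      ((bracketM μ).compl₁₂ LinearMap.id h.J).compr₂ h.J

variable {h : AlmostHermitian μ}

theorem nijenhuis_apply (X Y : mSub μ) : h.nijenhuis X Y =
    bracketM μ (h.J X) (h.J Y) - bracketM μ X Y - h.J (bracketM μ (h.J X) Y) -
      h.J (bracketM μ X (h.J Y)) := by
  simp [nijenhuis]

theorem g_J_right (X Y : mSub μ) : h.g X (h.J Y) = -h.g (h.J X) Y := by
  rw [← h.g_J, h.J_sq]; simp

variable (hh : h.IsCanonicalKahler)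
include hh

/-- By bilinearity it suffices to take eigenvectors `X`, `Y` of `|Γ|`. In complex terms, the bracket
of eigenvectors of `Γ` for `i c` and `i d` is in the eigenspace for `i (c + d)`; positivity of `c +
d` keeps it in the same eigenspace of `J`. The proof is the real form of this. -/
theorem IsCanonicalKahler.nijenhuis_eq_zero : h.nijenhuis = 0 := by
  obtain ⟨b, c, hb⟩ := hh.exists_eigenbasis
  refine b.ext fun i ↦ b.ext fun j ↦ ?_
  obtain ⟨hi, hX⟩ := hb i
  obtain ⟨hj, hY⟩ := hb j
  generalize b i = X at *
  generalize b j = Y at *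
  have hJX : gammaOp μ (h.J X) = -(c i • X) := by
    rw [hh.gammaOp_comm, hX, map_smul, h.J_sq, smul_neg]
  have hJY : gammaOp μ (h.J Y) = -(c j • Y) := by
    rw [hh.gammaOp_comm, hY, map_smul, h.J_sq, smul_neg]
  have hv : gammaOp μ (bracketM μ (h.J X) Y + bracketM μ X (h.J Y)) =
      (c i + c j) • (bracketM μ (h.J X) (h.J Y) - bracketM μ X Y) := by
    simp only [map_add, gammaOp_bracketM, hX, hY, hJX, hJY, map_smul, map_neg, LinearMap.smul_apply,
      LinearMap.neg_apply]
    module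
  have hu : gammaOp μ (bracketM μ (h.J X) (h.J Y) - bracketM μ X Y) =
      -(c i + c j) • (bracketM μ (h.J X) Y + bracketM μ X (h.J Y)) := by
    simp only [map_sub, gammaOp_bracketM, hX, hY, hJX, hJY, map_smul, map_neg, LinearMap.smul_apply,
      LinearMap.neg_apply]
    module
  -- `hv` and `hu` give `Γ² v = -(c i + c j)² v`, so `(c i + c j) J v = Γ v`, and `hv` turns this
  -- into the vanishing of the Nijenhuis tensor.
  have h1 := hh.smul_J_eq (add_pos hi hj) (v := bracketM μ (h.J X) Y + bracketM μ X (h.J Y)) (by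
    rw [hv, map_smul, hu]; module)
  rw [hv] at h1
  have h2 := smul_right_injective _ (add_pos hi hj).ne' h1
  rw [nijenhuis_apply, LinearMap.zero_apply, LinearMap.zero_apply, sub_sub, ← map_add, h2, sub_self]

theorem IsCanonicalKahler.g_J_eq_omega (X Y : mSub μ) : h.g X (h.J Y) = -omega μ X Y := by
  rw [hh.2, h.J_sq, omega_eq_KilM, omega_eq_KilM, map_neg]

/-- The form `ω` is closed. -/
theorem IsCanonicalKahler.g_bracketM_cyclic (X Y Z : mSub μ) :
    h.g (bracketM μ X Y) (h.J Z) + h.g (bracketM μ Y Z) (h.J X) +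
      h.g (bracketM μ Z X) (h.J Y) = 0 := by
  rw [hh.g_J_eq_omega, hh.g_J_eq_omega, hh.g_J_eq_omega]
  simp only [omega, bracketM_apply, apply_lie_projM]
  rw [← neg_add, ← neg_add, ← map_add, ← map_add]
  have := lie_jacobi (X : LieAlg n G) (Y : LieAlg n G) (Z : LieAlg n G)
  rw [← lie_skew, ← lie_skew (Y : LieAlg n G) ⁅_, _⁆, ← lie_skew (Z : LieAlg n G) ⁅_, _⁆, ← neg_add,
    ← neg_add, neg_eq_zero] at this
  rw [neg_eq_zero, ← map_zero μ, ← this]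
  congr 1
  abel

/-- The classical argument that `∇J = 0` follows from `dω = 0` and `N = 0`: after the Koszul formula
the claim is a linear combination of closedness at `(X, Y, Z)`, closedness at `(X, JY, JZ)` and
`g(JX, N(Y, Z)) = 0`. -/
theorem IsCanonicalKahler.lcTensor_J (X Y : mSub μ) :
    h.lcTensor X (h.J Y) = h.J (h.lcTensor X Y) := by
  refine h.ext_g fun Z ↦ ?_
  have hN : h.g (h.J X) (h.nijenhuis Y Z) = 0 := by simp [hh.nijenhuis_eq_zero]
  rw [nijenhuis_apply, map_sub, map_sub, map_sub, h.g_J, h.g_J] at hN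
  have h1 := hh.g_bracketM_cyclic X Y Z
  have h2 := hh.g_bracketM_cyclic X (h.J Y) (h.J Z)
  have h3 : h.g (h.J (h.lcTensor X Y)) Z = -h.g (h.lcTensor X Y) (h.J Z) := by
    rw [g_J_right, neg_neg]
  rw [h3, g_lcTensor, g_lcTensor]
  rw [h.J_sq, h.J_sq, bracketM_skew (h.J Z) X] at h2
  rw [bracketM_skew Z X] at h1
  simp only [map_neg, LinearMap.neg_apply] at h1 h2
  rw [h.g_symm (h.J X), h.g_symm (h.J X)] at hN
  rw [h.g_symm (h.J Y), h.g_symm Y (bracketM μ X (h.J Z))]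
  linarith

theorem IsCanonicalKahler.tensorCommutesWithJ {c : Connection μ} (hc : c.IsLeviCivita h) :
    c.TensorCommutesWithJ h := by
  rw [eq_lcConnection hc]
  exact fun _ ↦ hh.lcTensor_J

theorem IsCanonicalKahler.commutesWithJ {c : Connection μ} (hc : c.IsLeviCivita h) :
    c.CommutesWithJ h := fun V W _ hW x ↦ by
  have h1 := linearMap_leftDerivVec h.J hW.1 x (V x : LieAlg n G)
  unfold Connection.cov canonicalConnection
  rw [map_add, h1, hh.tensorCommutesWithJ hc]

end AlmostHermitian

end Integrable

/-! ### Adjoints and commutators of operators on Fock space -/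

section FockOperators

variable {M : Type*} [AddCommGroup M] [Module ℂ M] {B : M →ₗ⋆[ℂ] M →ₗ[ℂ] ℂ}

open ExteriorAlgebra (ι)

theorem annih_ι_mul (X Y : M) (ξ : Fock M) :
    annih B X (ι ℂ Y * ξ) = B X Y • ξ - ι ℂ Y * annih B X ξ :=
  CliffordAlgebra.contractLeft_ι_mul (B X) Y ξ

theorem annih_algebraMap (X : M) (r : ℂ) : annih B X (algebraMap ℂ (Fock M) r) = 0 :=
  CliffordAlgebra.contractLeft_algebraMap _ (B X) r

theorem fockInner_ι_mul (X : M) (ξ η : Fock M) :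
    fockInner B (ι ℂ X * ξ) η = fockInner B ξ (annih B X η) := by
  simp only [fockInner, LinearMap.mk₂'ₛₗ_apply, map_mul]
  have : annihWord B (ι ℂ X) = MulOpposite.op (annih B X) := ExteriorAlgebra.lift_ι_apply ℂ _ _ _
  rw [this]
  rfl

theorem fockInner_algebraMap (r : ℂ) (η : Fock M) :
    fockInner B (algebraMap ℂ (Fock M) r) η = conj r * ExteriorAlgebra.algebraMapInv η := by
  rw [Algebra.algebraMap_eq_smul_one, map_smulₛₗ, LinearMap.smul_apply, smul_eq_mul]
  congr 1
  have := fockInner_zero B (fun _ ↦ 0) η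
  rwa [ExteriorAlgebra.ιMulti_zero_apply] at this

/-- On products of vectors the two sides are determinants of a matrix and of its conjugate
transpose; such products span. -/
theorem fockInner_conj_symm (hB : ∀ X Y, B X Y = conj (B Y X)) (ξ η : Fock M) :
    fockInner B ξ η = conj (fockInner B η ξ) := by
  have hspan := ExteriorAlgebra.ιMulti_span (R := ℂ) (M := M)
  have hξ : ξ ∈ Submodule.span ℂ (Set.range fun x : Σ p, (Fin p → M) ↦
    ExteriorAlgebra.ιMulti ℂ x.1 x.2) := by rw [hspan]; trivial
  have hη : η ∈ Submodule.span ℂ (Set.range fun x : Σ p, (Fin p → M) ↦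
    ExteriorAlgebra.ιMulti ℂ x.1 x.2) := by rw [hspan]; trivial
  induction hξ using Submodule.span_induction with
  | zero => simp
  | add ξ ξ' _ _ h h' => simp [h, h']
  | smul c ξ _ h => simp [h]
  | mem ξ hξ =>
    obtain ⟨⟨p, X⟩, rfl⟩ := hξ
    induction hη using Submodule.span_induction with
    | zero => simp
    | add ξ ξ' _ _ h h' => simp [h, h']
    | smul c ξ _ h => simp [h]
    | mem η hη =>
      obtain ⟨⟨q, Y⟩, rfl⟩ := hη
      rcases eq_or_ne p q with rfl | hpq
      · dsimp only
        rw [fockInner_ιMulti, fockInner_ιMulti, ← Matrix.det_transpose, RingHom.map_det]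
        congr 1
        ext i j
        simp [hB (X j) (Y i)]
      · dsimp only
        rw [fockInner_ιMulti_of_ne B hpq, fockInner_ιMulti_of_ne B hpq.symm, map_zero]

theorem fockInner_annih (hB : ∀ X Y, B X Y = conj (B Y X)) (X : M) (ξ η : Fock M) :
    fockInner B (annih B X ξ) η = fockInner B ξ (ι ℂ X * η) := by
  rw [fockInner_conj_symm hB, ← fockInner_ι_mul, ← fockInner_conj_symm hB]

theorem cliff_apply (X : M) (ξ : Fock M) :
    cliff B X ξ = Complex.I • (annih B X ξ + ι ℂ X * ξ) := rfl

/-- The Clifford action is skew-adjoint. -/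
theorem fockInner_cliff (hB : ∀ X Y, B X Y = conj (B Y X)) (X : M) (ξ η : Fock M) :
    fockInner B (cliff B X ξ) η = -fockInner B ξ (cliff B X η) := by
  rw [cliff_apply, cliff_apply, map_smulₛₗ, LinearMap.smul_apply, map_add, LinearMap.add_apply,
    fockInner_annih hB, fockInner_ι_mul, map_smul, map_add, Complex.conj_I]
  simp only [smul_eq_mul]
  ring

theorem extDer_algebraMap (T : M →ₗ[ℂ] M) (r : ℂ) : extDer T (algebraMap ℂ (Fock M) r) = 0 := by
  rw [Algebra.algebraMap_eq_smul_one, map_smul]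
  have := extDer_mul T 1 1
  rw [mul_one, mul_one, one_mul, left_eq_add] at this
  rw [this, smul_zero]

theorem extDer_ι_mul (T : M →ₗ[ℂ] M) (X : M) (ξ : Fock M) :
    extDer T (ι ℂ X * ξ) = ι ℂ (T X) * ξ + ι ℂ X * extDer T ξ := by
  rw [extDer_mul, extDer_ι]

/-- Induction on the number of factors of `ξ`; skewness of `T` is what cancels the scalar terms from
`a(X)` hitting `Y` and `T Y`. -/
theorem extDer_annih {T : M →ₗ[ℂ] M} (hT : ∀ X Y, B (T X) Y = -B X (T Y)) (X : M) (ξ : Fock M) :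
    extDer T (annih B X ξ) = annih B (T X) ξ + annih B X (extDer T ξ) := by
  induction ξ using CliffordAlgebra.left_induction with
  | algebraMap r =>
    change extDer T (annih B X (algebraMap ℂ (Fock M) r)) =
      annih B (T X) (algebraMap ℂ (Fock M) r) + annih B X (extDer T (algebraMap ℂ (Fock M) r))
    simp only [annih_algebraMap, extDer_algebraMap, map_zero, add_zero]
  | add ξ η h h' => simp only [map_add, h, h']; abel
  | ι_mul ξ Y h =>
    change extDer T (annih B X (ι ℂ Y * ξ)) =
      annih B (T X) (ι ℂ Y * ξ) + annih B X (extDer T (ι ℂ Y * ξ))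
    simp only [annih_ι_mul, extDer_ι_mul, map_add, map_sub, map_smul, h, hT, mul_add]
    module

/-- The derivation `extDer T` normalizes the Clifford action. -/
theorem extDer_cliff {T : M →ₗ[ℂ] M} (hT : ∀ X Y, B (T X) Y = -B X (T Y)) (X : M) (ξ : Fock M) :
    extDer T (cliff B X ξ) = cliff B (T X) ξ + cliff B X (extDer T ξ) := by
  simp only [cliff_apply, map_smul, map_add, extDer_annih hT, extDer_ι_mul]
  module

theorem algebraMapInv_extDer (T : M →ₗ[ℂ] M) (ξ : Fock M) :
    ExteriorAlgebra.algebraMapInv (extDer T ξ) = 0 := by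
  induction ξ using CliffordAlgebra.left_induction with
  | algebraMap r => exact (congrArg _ (extDer_algebraMap T r)).trans (map_zero _)
  | add ξ η h h' => rw [map_add, map_add, h, h', add_zero]
  | ι_mul ξ Y h =>
    refine (congrArg _ (extDer_ι_mul T Y ξ)).trans ?_
    rw [map_add, map_mul, map_mul, h, mul_zero, add_zero]
    simp [ExteriorAlgebra.algebraMapInv]

/-- Factors are moved from `ξ` to the other side as annihilation operators, where `extDer_annih`
applies; the induction ends in degree `0`, which derivations do not reach. -/
theorem fockInner_extDer {T : M →ₗ[ℂ] M} (hT : ∀ X Y, B (T X) Y = -B X (T Y)) (ξ η : Fock M) :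
    fockInner B (extDer T ξ) η = -fockInner B ξ (extDer T η) := by
  induction ξ using CliffordAlgebra.left_induction generalizing η with
  | algebraMap r =>
    change fockInner B (extDer T (algebraMap ℂ (Fock M) r)) η =
      -fockInner B (algebraMap ℂ (Fock M) r) (extDer T η)
    rw [extDer_algebraMap, fockInner_algebraMap, algebraMapInv_extDer]
    simp
  | add ξ ξ' h h' => simp only [map_add, LinearMap.add_apply, h, h']; abel
  | ι_mul ξ Y h =>
    change fockInner B (extDer T (ι ℂ Y * ξ)) η = -fockInner B (ι ℂ Y * ξ) (extDer T η)
    rw [extDer_ι_mul, map_add, LinearMap.add_apply, fockInner_ι_mul, fockInner_ι_mul,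
      fockInner_ι_mul, h, extDer_annih hT, map_add]
    ring

/-- Used to see that `extDer` is linear in `T`. -/
theorem extDer_eq_of_forall {T : M →ₗ[ℂ] M} {D : Fock M →ₗ[ℂ] Fock M}
    (h1 : ∀ r, D (algebraMap ℂ (Fock M) r) = 0)
    (h2 : ∀ X ξ, D (ι ℂ X * ξ) = ι ℂ (T X) * ξ + ι ℂ X * D ξ) : extDer T = D := by
  refine LinearMap.ext fun ξ ↦ ?_
  induction ξ using CliffordAlgebra.left_induction with
  | algebraMap r => exact (extDer_algebraMap T r).trans (h1 r).symm
  | add ξ η h h' => rw [map_add, map_add, h, h']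
  | ι_mul ξ Y h =>
    refine (extDer_ι_mul T Y ξ).trans (Eq.trans ?_ (h2 Y ξ).symm)
    rw [h]

theorem extDer_add (T T' : M →ₗ[ℂ] M) : extDer (T + T') = extDer T + extDer T' :=
  extDer_eq_of_forall (fun r ↦ by simp [extDer_algebraMap]) fun X ξ ↦ by
    simp only [LinearMap.add_apply, extDer_ι_mul, map_add, add_mul, mul_add]; abel

theorem extDer_smul (c : ℂ) (T : M →ₗ[ℂ] M) : extDer (c • T) = c • extDer T :=
  extDer_eq_of_forall (fun r ↦ by simp [extDer_algebraMap]) fun X ξ ↦ by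
    simp only [LinearMap.smul_apply, extDer_ι_mul, map_smul, smul_mul_assoc, mul_smul_comm, smul_add]

theorem map_ι_mul (f : M →ₗ[ℂ] M) (X : M) (ξ : Fock M) : ExteriorAlgebra.map f (ι ℂ X * ξ) =
    ι ℂ (f X) * ExteriorAlgebra.map f ξ := by
  rw [map_mul, ExteriorAlgebra.map_apply_ι]

theorem map_annih {f : M →ₗ[ℂ] M} (hf : ∀ X Y, B (f X) (f Y) = B X Y) (X : M) (ξ : Fock M) :
    ExteriorAlgebra.map f (annih B X ξ) = annih B (f X) (ExteriorAlgebra.map f ξ) := by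
  induction ξ using CliffordAlgebra.left_induction with
  | algebraMap r =>
    change ExteriorAlgebra.map f (annih B X (algebraMap ℂ (Fock M) r)) =
      annih B (f X) (ExteriorAlgebra.map f (algebraMap ℂ (Fock M) r))
    rw [AlgHom.commutes, annih_algebraMap, annih_algebraMap, map_zero]
  | add ξ η h h' => simp only [map_add, h, h']
  | ι_mul ξ Y h =>
    change ExteriorAlgebra.map f (annih B X (ι ℂ Y * ξ)) =
      annih B (f X) (ExteriorAlgebra.map f (ι ℂ Y * ξ))
    rw [annih_ι_mul, map_sub, map_smul, map_ι_mul, map_ι_mul, annih_ι_mul, hf, h]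

theorem map_cliff {f : M →ₗ[ℂ] M} (hf : ∀ X Y, B (f X) (f Y) = B X Y) (X : M) (ξ : Fock M) :
    ExteriorAlgebra.map f (cliff B X ξ) = cliff B (f X) (ExteriorAlgebra.map f ξ) := by
  rw [cliff_apply, cliff_apply, map_smul, map_add, map_annih hf, map_ι_mul]

theorem map_extDer {f T T' : M →ₗ[ℂ] M} (hf : ∀ X, f (T X) = T' (f X)) (ξ : Fock M) :
    ExteriorAlgebra.map f (extDer T ξ) = extDer T' (ExteriorAlgebra.map f ξ) := by
  induction ξ using CliffordAlgebra.left_induction with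
  | algebraMap r =>
    change ExteriorAlgebra.map f (extDer T (algebraMap ℂ (Fock M) r)) =
      extDer T' (ExteriorAlgebra.map f (algebraMap ℂ (Fock M) r))
    rw [AlgHom.commutes, extDer_algebraMap, extDer_algebraMap, map_zero]
  | add ξ η h h' => simp only [map_add, h, h']
  | ι_mul ξ Y h =>
    change ExteriorAlgebra.map f (extDer T (ι ℂ Y * ξ)) =
      extDer T' (ExteriorAlgebra.map f (ι ℂ Y * ξ))
    rw [extDer_ι_mul, map_add, map_ι_mul, map_ι_mul, map_ι_mul, extDer_ι_mul, hf, h]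

theorem cliff_add (X Y : M) : cliff B (X + Y) = cliff B X + cliff B Y := by
  refine LinearMap.ext fun ξ ↦ ?_
  simp only [LinearMap.add_apply, cliff_apply, annih, map_add, add_mul]
  module

theorem cliff_smul_real (c : ℝ) (X : M) : cliff B ((c : ℂ) • X) = (c : ℂ) • cliff B X := by
  refine LinearMap.ext fun ξ ↦ ?_
  simp only [LinearMap.smul_apply, cliff_apply, annih, map_smulₛₗ, Complex.conj_ofReal,
    RingHom.id_apply, smul_mul_assoc]
  module

end FockOperators

/-! ### The product rule for sesquilinear pairings -/

section Sesquilinear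

variable {n : ℕ} {G : Type*} [TopologicalSpace G] [ChartedSpace (EuclideanSpace ℝ (Fin n)) G]
  [Group G] [LieGroup (𝓡 n) ∞ G]
  {F : Type*} [AddCommGroup F] [Module ℂ F] [FiniteDimensional ℂ F]
  (S : F →ₗ⋆[ℂ] F →ₗ[ℂ] ℂ) {ψ φ : G → F}

theorem sesq_eq_sum {ι : Type*} [Fintype ι] (b : Module.Basis ι ℂ F) (v w : F) :
    S v w = ∑ i, ∑ j, S (b i) (b j) * (conj (b.coord i v) * b.coord j w) := by
  have h : S (∑ i, b.repr v i • b i) (∑ j, b.repr w j • b j) =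
      ∑ i, ∑ j, S (b i) (b j) * (conj (b.coord i v) * b.coord j w) := by
    simp only [map_sum, LinearMap.sum_apply, map_smulₛₗ, LinearMap.smul_apply, smul_eq_mul,
      Module.Basis.coord_apply, RingHom.id_apply, Finset.mul_sum]
    rw [Finset.sum_comm]
    exact Finset.sum_congr rfl fun i _ ↦ Finset.sum_congr rfl fun j _ ↦ by ring
  rw [← h, b.sum_repr, b.sum_repr]

theorem contMDiff_sesq (hψ : IsSmooth n ℂ ψ) (hφ : IsSmooth n ℂ φ) :
    ContMDiff (𝓡 n) 𝓘(ℝ, ℂ) ∞ (fun y ↦ S (ψ y) (φ y)) := by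
  have h : (fun y ↦ S (ψ y) (φ y)) = fun y ↦ ∑ i, ∑ j,
      S (Module.finBasis ℂ F i) (Module.finBasis ℂ F j) *
        (conj ((Module.finBasis ℂ F).coord i (ψ y)) * (Module.finBasis ℂ F).coord j (φ y)) :=
    funext fun y ↦ sesq_eq_sum S _ _ _
  rw [h]
  exact contMDiff_finsetSum fun i _ ↦ contMDiff_finsetSum fun j _ ↦
    contMDiff_fun_mul contMDiff_const (contMDiff_fun_mul (contMDiff_conj (hψ _)) (hφ _))

theorem leftDeriv_sesq (hψ : IsSmooth n ℂ ψ) (hφ : IsSmooth n ℂ φ) (x : G) (X : LieAlg n G) :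
    leftDeriv ℂ (fun y ↦ S (ψ y) (φ y)) x X =
      S (leftDerivVec ℂ ψ x X) (φ x) + S (ψ x) (leftDerivVec ℂ φ x X) := by
  have h : (fun y ↦ S (ψ y) (φ y)) = fun y ↦ ∑ i, ∑ j,
      S (Module.finBasis ℂ F i) (Module.finBasis ℂ F j) *
        (conj ((Module.finBasis ℂ F).coord i (ψ y)) * (Module.finBasis ℂ F).coord j (φ y)) :=
    funext fun y ↦ sesq_eq_sum S _ _ _
  have hs : ∀ i j, ContMDiff (𝓡 n) 𝓘(ℝ, ℂ) ∞ (fun y ↦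
      (conj ((Module.finBasis ℂ F).coord i (ψ y)) * (Module.finBasis ℂ F).coord j (φ y))) :=
    fun i j ↦ contMDiff_fun_mul (contMDiff_conj (hψ _)) (hφ _)
  rw [h, leftDeriv_sum x _ fun i _ ↦ contMDiff_finsetSum fun j _ ↦
      contMDiff_fun_mul contMDiff_const (hs i j),
    sesq_eq_sum S (Module.finBasis ℂ F) (leftDerivVec ℂ ψ x X),
    sesq_eq_sum S (Module.finBasis ℂ F) (ψ x), ← Finset.sum_add_distrib]
  refine Finset.sum_congr rfl fun i _ ↦ ?_
  rw [leftDeriv_sum x _ fun j _ ↦ contMDiff_fun_mul contMDiff_const (hs i j),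
    ← Finset.sum_add_distrib]
  refine Finset.sum_congr rfl fun j _ ↦ ?_
  rw [leftDeriv_const_mul x (hs i j), leftDeriv_mul x (contMDiff_conj (hψ _)) (hφ _),
    leftDeriv_conj x (hψ _), linear_leftDerivVec _ hψ, linear_leftDerivVec _ hφ]
  ring

end Sesquilinear

/-! ### Integration by parts on `G` -/

section Integration

open MeasureTheory

variable {n : ℕ} {G : Type*} [TopologicalSpace G] [ChartedSpace (EuclideanSpace ℝ (Fin n)) G]
  [Group G] [LieGroup (𝓡 n) ∞ G] [T2Space G] [CompactSpace G] [MeasurableSpace G] [BorelSpace G]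

/-- A right translate of `ν` is a multiple of `ν` with the same total mass, which is finite and
nonzero. -/
theorem isMulRightInvariant_of_compactSpace {G : Type*} [TopologicalSpace G] [Group G]
    [IsTopologicalGroup G] [CompactSpace G] [MeasurableSpace G] [BorelSpace G]
    (ν : Measure G) [ν.IsHaarMeasure] : ν.IsMulRightInvariant := by
  refine ⟨fun g ↦ ?_⟩
  have h1 := Measure.isMulInvariant_eq_smul_of_compactSpace (Measure.map (fun x ↦ x * g) ν) ν
  have h2 : Measure.map (fun x ↦ x * g) ν Set.univ = ν Set.univ := by
    rw [Measure.map_apply (measurable_mul_const g) MeasurableSet.univ, Set.preimage_univ]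
  set c := Measure.haarScalarFactor (Measure.map (fun x ↦ x * g) ν) ν
  have h3 : (c : ENNReal) * ν Set.univ = 1 * ν Set.univ := by
    have h := congrArg (fun m : Measure G ↦ m Set.univ) h1
    rw [one_mul]
    exact h.symm.trans h2
  have h4 : (c : ENNReal) = 1 := (ENNReal.mul_left_inj
    (isOpen_univ.measure_ne_zero ν Set.univ_nonempty) (measure_ne_top ν _)).1 h3
  rw [h1, ENNReal.coe_eq_one.1 h4, one_smul]

/-- By right invariance `∫ f(x γ(t)) dx` is constant in `t`; its derivative at `0` is the integral
in question. -/
theorem integral_leftDeriv (ν : Measure G) [ν.IsHaarMeasure] {f : G → ℂ}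
    (hf : ContMDiff (𝓡 n) 𝓘(ℝ, ℂ) ∞ f) (X : LieAlg n G) : ∫ x, leftDeriv ℂ f x X ∂ν = 0 := by
  have : IsTopologicalGroup G := topologicalGroup_of_lieGroup (𝓡 n) ∞
  have := isMulRightInvariant_of_compactSpace ν
  obtain ⟨γ, hγ, h0, hX⟩ := exists_contMDiff_curve n X
  let F : G × ℝ → ℂ := fun p ↦ f (p.1 * γ p.2)
  have hF : ContMDiff ((𝓡 n).prod 𝓘(ℝ, ℝ)) 𝓘(ℝ, ℂ) ∞ F :=
    hf.comp (contMDiff_fst.mul (hγ.comp contMDiff_snd))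
  have hF' := (contMDiff_deriv_snd hF).continuous
  have hd : ∀ x t, HasDerivAt (fun u ↦ F (x, u)) (deriv (fun u ↦ F (x, u)) t) t := fun x t ↦ by
    have h1 : ContMDiff 𝓘(ℝ, ℝ) 𝓘(ℝ, ℂ) ∞ (fun u ↦ F (x, u)) :=
      hF.comp (contMDiff_const.prodMk contMDiff_id)
    exact (h1.contDiff.differentiable (by simp) t).hasDerivAt
  -- A bound for the `t`-derivative on the compact set `G × [-1, 1]` permits differentiation under
  -- the integral.
  obtain ⟨C, hC⟩ := (isCompact_univ.prod (isCompact_Icc (a := (-1 : ℝ)) (b := 1))).exists_bound_of_continuousOn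
    hF'.continuousOn
  have key := hasDerivAt_integral_of_dominated_loc_of_deriv_le (μ := ν) (x₀ := (0 : ℝ))
    (F := fun t x ↦ F (x, t)) (F' := fun t x ↦ deriv (fun u ↦ F (x, u)) t) (bound := fun _ ↦ C)
    (s := Set.Icc (-1) 1) (Icc_mem_nhds (by norm_num) (by norm_num))
    (Filter.Eventually.of_forall fun t ↦
      (hF.continuous.comp (Continuous.prodMk_left t)).aestronglyMeasurable)
    ((hF.continuous.comp (Continuous.prodMk_left (0 : ℝ))).integrable_of_hasCompactSupport
      (HasCompactSupport.of_compactSpace _))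
    (hF'.comp (Continuous.prodMk_left (0 : ℝ))).aestronglyMeasurable
    (Filter.Eventually.of_forall fun x t ht ↦ hC (x, t) ⟨trivial, ht⟩)
    (integrable_const C)
    (Filter.Eventually.of_forall fun x t _ ↦ hd x t)
  have h1 : (fun t ↦ ∫ x, F (x, t) ∂ν) = fun _ ↦ ∫ x, f x ∂ν :=
    funext fun t ↦ integral_mul_right_eq_self f (γ t)
  have h2 : ∀ x, deriv (fun u ↦ F (x, u)) 0 = leftDeriv ℂ f x X := fun x ↦
    (hasDerivAt_leftDeriv x (hf.contMDiffAt.mdifferentiableAt (by simp)) h0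
      (hγ.contMDiffAt.mdifferentiableAt (by simp)) hX).deriv
  have h3 := key.2
  rw [h1] at h3
  simp only [h2] at h3
  exact h3.unique (hasDerivAt_const _ _)

end Integration

/-! ### The Dirac operator -/

section DiracOperator

variable {n : ℕ} {G : Type*} [TopologicalSpace G] [ChartedSpace (EuclideanSpace ℝ (Fin n)) G]
  [Group G] [LieGroup (𝓡 n) ∞ G] {μ : Module.Dual ℝ (LieAlg n G)}

/-- The tensor `∑ b_i ⊗ b^i` is the inverse of the metric and does not depend on the basis; an
orthonormal basis is its own dual. -/
theorem sum_dualBasis_eq {V S ι κ : Type*} [AddCommGroup V] [Module ℝ V] [FiniteDimensional ℝ V]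
    [AddCommGroup S] [Module ℝ S] [Fintype ι] [DecidableEq ι] [Fintype κ] [DecidableEq κ]
    {B : LinearMap.BilinForm ℝ V} (hB : B.Nondegenerate) (hs : ∀ x y, B x y = B y x)
    (b : Module.Basis ι ℝ V) {e : Module.Basis κ ℝ V}
    (he : ∀ i j, B (e i) (e j) = if i = j then 1 else 0) (Φ : V →ₗ[ℝ] V →ₗ[ℝ] S) :
    ∑ i, Φ (b i) (B.dualBasis hB b i) = ∑ j, Φ (e j) (e j) := by
  have h1 : ∀ i, Φ (b i) = ∑ j, B (b i) (e j) • Φ (e j) := fun i ↦ by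
    have h : Φ (∑ j, e.repr (b i) j • e j) = ∑ j, B (b i) (e j) • Φ (e j) := by
      simp only [map_sum, map_smul, repr_eq_form he, hs]
    rw [← h, e.sum_repr]
  have h2 : ∀ j, e j = ∑ i, B (b i) (e j) • B.dualBasis hB b i := fun j ↦ by
    have h := (B.dualBasis hB b).sum_repr (e j)
    simp only [LinearMap.BilinForm.dualBasis_repr_apply] at h
    rw [← h]
    refine Finset.sum_congr rfl fun i _ ↦ ?_
    rw [h, hs]
  have h3 : ∀ j, Φ (e j) (e j) = ∑ i, B (b i) (e j) • Φ (e j) (B.dualBasis hB b i) := fun j ↦ by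
    have h := congrArg (Φ (e j)) (h2 j)
    simpa only [map_sum, map_smul] using h
  simp only [h1, h3, LinearMap.sum_apply, LinearMap.smul_apply]
  exact Finset.sum_comm

namespace AlmostHermitian

variable (h : AlmostHermitian μ)

theorem herm_apply (X Y : h.MJ) : h.herm X Y = (h.g (h.toMJ.symm X) (h.toMJ.symm Y) : ℂ) +
    Complex.I * (h.g (h.J (h.toMJ.symm X)) (h.toMJ.symm Y) : ℂ) := rfl

theorem herm_conj_symm (X Y : h.MJ) : h.herm X Y = conj (h.herm Y X) := by
  have e : h.g (h.J (h.toMJ.symm Y)) (h.toMJ.symm X) =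
      -h.g (h.J (h.toMJ.symm X)) (h.toMJ.symm Y) := by
    rw [← h.g_J, h.J_sq, map_neg, LinearMap.neg_apply, h.g_symm]
  rw [herm_apply, herm_apply, e, h.g_symm (h.toMJ.symm Y)]
  simp

theorem herm_complexify_skew {T : mSub μ →ₗ[ℝ] mSub μ} (hT : ∀ X, T (h.J X) = h.J (T X))
    (hg : ∀ X Y, h.g (T X) Y + h.g X (T Y) = 0) (X Y : h.MJ) :
    h.herm (h.complexify T hT X) Y = -h.herm X (h.complexify T hT Y) := by
  have e : ∀ X Y, h.g (T X) Y = -h.g X (T Y) := fun X Y ↦ eq_neg_of_add_eq_zero_left (hg X Y)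
  have hc : ∀ X, h.toMJ.symm (h.complexify T hT X) = T (h.toMJ.symm X) := fun _ ↦ rfl
  rw [herm_apply, herm_apply, hc, hc, ← hT, e, e]
  push_cast
  ring

theorem herm_AdM (s : stab μ) (X Y : h.MJ) :
    h.herm (h.complexify (AdM μ s) (fun X ↦ (h.J_Ad s X).symm) X)
      (h.complexify (AdM μ s) (fun X ↦ (h.J_Ad s X).symm) Y) = h.herm X Y := by
  have hc : ∀ X, h.toMJ.symm (h.complexify (AdM μ s) (fun X ↦ (h.J_Ad s X).symm) X) =
    AdM μ s (h.toMJ.symm X) := fun _ ↦ rfl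
  rw [herm_apply, herm_apply, hc, hc, h.J_Ad, h.g_Ad, h.g_Ad]

theorem kappa_add (X Y : mSub μ) : h.kappa (X + Y) = h.kappa X + h.kappa Y :=
  (congrArg (cliff h.herm) (map_add h.toMJ X Y)).trans (cliff_add _ _)

theorem toMJ_smul (r : ℝ) (X : mSub μ) : h.toMJ (r • X) = (r : ℂ) • h.toMJ X := by
  rw [smul_def]; simp

theorem kappa_smul (r : ℝ) (X : mSub μ) : h.kappa (r • X) = r • h.kappa X :=
  (congrArg (cliff h.herm) (h.toMJ_smul r X)).trans (cliff_smul_real _ _)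

theorem AdS_kappa (s : stab μ) (X : mSub μ) (ξ : h.Spinor) :
    h.AdS s (h.kappa X ξ) = h.kappa (AdM μ s X) (h.AdS s ξ) :=
  map_cliff (h.herm_AdM s) _ _

/-- The operator on spinors given by a linear map `L` with values in the operators commuting with `J`. -/
def spinorTensor (L : mSub μ →ₗ[ℝ] mSub μ →ₗ[ℝ] mSub μ)
    (hL : ∀ X Y, L X (h.J Y) = h.J (L X Y)) :
    mSub μ →ₗ[ℝ] h.Spinor →ₗ[ℂ] h.Spinor where
  toFun X := extDer (h.complexify (L X) (hL X))
  map_add' X Y := by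
    rw [← extDer_add]
    congr 1
    refine LinearMap.ext fun Z ↦ ?_
    change h.toMJ (L (X + Y) (h.toMJ.symm Z)) = h.toMJ (L X (h.toMJ.symm Z)) +
      h.toMJ (L Y (h.toMJ.symm Z))
    rw [map_add, LinearMap.add_apply, map_add]
  map_smul' r X := by
    have : h.complexify (L (r • X)) (hL (r • X)) = (r : ℂ) • h.complexify (L X) (hL X) := by
      refine LinearMap.ext fun Z ↦ ?_
      change h.toMJ (L (r • X) (h.toMJ.symm Z)) = (r : ℂ) • h.toMJ (L X (h.toMJ.symm Z))
      rw [map_smul, LinearMap.smul_apply, toMJ_smul]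
    rw [this, extDer_smul]
    rfl

end AlmostHermitian

section

variable (h : AlmostHermitian μ) (c : Connection μ) (hc : c.TensorCommutesWithJ h)

/-- The map `(X, Y) ↦ κ(X) ∇_Y ψ` at a point. -/
def kappaGrad (ψ : G → h.Spinor) (x : G) : mSub μ →ₗ[ℝ] mSub μ →ₗ[ℝ] h.Spinor :=
  LinearMap.mk₂ ℝ (fun X Y ↦ h.kappa X (spinorConnection h c hc ψ x Y))
    (fun X X' Y ↦ by rw [h.kappa_add, LinearMap.add_apply])
    (fun r X Y ↦ by rw [h.kappa_smul, LinearMap.smul_apply])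
    (fun X Y Y' ↦ by
      rw [← map_add]
      congr 1
      have h1 := LinearMap.congr_fun (map_add (h.spinorTensor (c.L x) (hc x)) Y Y') (ψ x)
      have h2 := leftDerivVec_add_right (𝕜 := ℂ) ψ x (Y : LieAlg n G) (Y' : LieAlg n G)
      exact (congrArg₂ (· + ·) h2 h1).trans (add_add_add_comm _ _ _ _))
    (fun r X Y ↦ by
      have h1 := LinearMap.congr_fun (map_smul (h.spinorTensor (c.L x) (hc x)) r Y) (ψ x)
      have h2 := leftDerivVec_smul_right (𝕜 := ℂ) ψ x r (Y : LieAlg n G)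
      have h3 : spinorConnection h c hc ψ x (r • Y) = (r : ℂ) • spinorConnection h c hc ψ x Y :=
        (congrArg₂ (· + ·) h2 h1).trans (smul_add _ _ _).symm
      rw [h3, map_smul]
      rfl)

/-- The Dirac operator can be computed in any orthonormal basis. -/
theorem dirac_eq_sum {ι : Type*} [Fintype ι] [DecidableEq ι] {e : Module.Basis ι ℝ (mSub μ)}
    (he : ∀ i j, h.g (e i) (e j) = if i = j then 1 else 0) (ψ : G → h.Spinor) (x : G) :
    dirac h c hc ψ x = ∑ i, h.kappa (e i) (spinorConnection h c hc ψ x (e i)) :=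
  sum_dualBasis_eq h.g_nondegenerate h.g_symm _ he (kappaGrad h c hc ψ x)

end

section LeviCivita

variable [T2Space G] [CompactSpace G] [LieAlgebra.IsSemisimple ℝ (LieAlg n G)]
  {h : AlmostHermitian μ} (hc : h.lcConnection.TensorCommutesWithJ h)
include hc

theorem isSmooth_spinorConnection {ψ : G → h.Spinor} (hψ : IsSmooth n ℂ ψ) (X : mSub μ) :
    IsSmooth n ℂ fun x ↦ spinorConnection h h.lcConnection hc ψ x X :=
  -- The Levi-Civita tensor is constant on `G`, so the hypothesis at the point `1` serves at every
  -- point.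
  (isSmooth_leftDerivVec hψ _).add (hψ.comp_linearMap (extDer (h.complexify _ (hc 1 X))))

theorem isSmooth_dirac {ψ : G → h.Spinor} (hψ : IsSmooth n ℂ ψ) :
    IsSmooth n ℂ (dirac h h.lcConnection hc ψ) :=
  IsSmooth.sum _ fun _ ↦ (isSmooth_spinorConnection hc hψ _).comp_linearMap _

theorem AdS_extDer (s : stab μ) (X : mSub μ) (ξ : h.Spinor) :
    h.AdS s (extDer (h.complexify (h.lcTensor X) (hc 1 X)) ξ) =
      extDer (h.complexify (h.lcTensor (AdM μ s X)) (hc 1 _)) (h.AdS s ξ) :=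
  map_extDer (fun Y ↦ congrArg h.toMJ (h.lcTensor_AdM s X (h.toMJ.symm Y)).symm) ξ

theorem spinorConnection_mul_right {χ : stab μ →ₜ* Circle} {ψ : G → h.Spinor}
    (hψ : h.IsSpinorField χ ψ) (x : G) (s : stab μ) (X : mSub μ) :
    spinorConnection h h.lcConnection hc ψ (x * s) (AdM μ s⁻¹ X) =
      (starRingEnd ℂ) (χ s : ℂ) • h.AdS s⁻¹ (spinorConnection h h.lcConnection hc ψ x X) := by
  have h1 : leftDerivVec ℂ ψ (x * s) (AdM μ s⁻¹ X : LieAlg n G) =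
      (starRingEnd ℂ) (χ s : ℂ) • h.AdS s⁻¹ (leftDerivVec ℂ ψ x (X : LieAlg n G)) := by
    have h2 := leftDerivVec_mul_right hψ.1 x (s : G) (X : LieAlg n G)
    simp only [hψ.2] at h2
    exact h2.symm.trans (linearMap_leftDerivVec
      ((starRingEnd ℂ) (χ s : ℂ) • (h.AdS s⁻¹).toLinearMap) hψ.1 x (X : LieAlg n G)).symm
  unfold spinorConnection
  rw [h1, hψ.2, map_smul, map_add, smul_add]
  congr 2
  exact (AdS_extDer hc s⁻¹ X (ψ x)).symm

/-- `D` is computed at `x` in an orthonormal basis `e` and at `x s` in the orthonormal basis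
`Ad_{s⁻¹} e`; each summand is then equivariant. -/
theorem isSpinorField_dirac {χ : stab μ →ₜ* Circle} {ψ : G → h.Spinor}
    (hψ : h.IsSpinorField χ ψ) : h.IsSpinorField χ (dirac h h.lcConnection hc ψ) := by
  refine ⟨isSmooth_dirac hc hψ.1, fun x s ↦ ?_⟩
  obtain ⟨e, he⟩ := exists_orthonormal_basis h.g_symm h.g_pos
  let A : mSub μ ≃ₗ[ℝ] mSub μ := LinearEquiv.ofLinearMap (AdM μ s⁻¹) (AdM μ s)
    (LinearMap.ext fun X ↦ AdM_inv_apply' s X) (LinearMap.ext fun X ↦ AdM_inv_apply s X)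
  have hA : ∀ i, e.map A i = AdM μ s⁻¹ (e i) := fun i ↦ e.map_apply A i
  have he' : ∀ i j, h.g (e.map A i) (e.map A j) = if i = j then 1 else 0 := fun i j ↦ by
    rw [hA, hA, h.g_Ad, he]
  rw [dirac_eq_sum h _ hc he' ψ, dirac_eq_sum h _ hc he ψ, map_sum, Finset.smul_sum]
  refine Finset.sum_congr rfl fun i _ ↦ ?_
  rw [hA, spinorConnection_mul_right hc hψ, map_smul, h.AdS_kappa]

omit hc in
/-- The orbit is unimodular: the operators `Y ↦ [Z, Y]_𝔪` have trace zero. -/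
theorem sum_lcTensor_eq_zero {ι : Type*} [Fintype ι] [DecidableEq ι]
    {e : Module.Basis ι ℝ (mSub μ)} (he : ∀ i j, h.g (e i) (e j) = if i = j then 1 else 0) :
    ∑ i, h.lcTensor (e i) (e i) = 0 := by
  refine h.ext_g fun Z ↦ ?_
  have h1 : ∀ X, KilM μ X (bracketM μ Z X) = 0 := fun X ↦ by
    have h2 := Kil_lie_left (Z : LieAlg n G) (X : LieAlg n G) (X : LieAlg n G)
    rw [Kil_symm (X : LieAlg n G)] at h2
    have h3 := Kil_projM (μ := μ) ⁅(Z : LieAlg n G), (X : LieAlg n G)⁆ X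
    rw [KilM_symm, KilM_apply, bracketM_apply, h3]
    linarith
  have h2 := trace_eq_zero_of_skew KilM_symm KilM_pos h1
  -- The trace vanishes by skewness for `Kil`, but does not depend on an inner product, so it can be
  -- expanded in the `g`-orthonormal basis.
  rw [trace_eq_sum_form he] at h2
  rw [map_sum, LinearMap.sum_apply, map_zero, LinearMap.zero_apply, ← h2]
  refine Finset.sum_congr rfl fun i _ ↦ ?_
  have h3 : bracketM μ (e i) (e i) = 0 := by rw [bracketM_apply, lie_self, map_zero]
  rw [AlmostHermitian.g_lcTensor, h3, bracketM_skew Z]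
  simp only [map_zero, LinearMap.zero_apply, map_neg]
  ring

/-- The failure of symmetry is a divergence pointwise. Moving `κ(e_i)` and then the spinor
connection across the inner product leaves the commutator term `κ(L_{e_i} e_i)`, whose sum over `i`
is zero. -/
theorem fockInner_dirac {ι : Type*} [Fintype ι] [DecidableEq ι]
    {e : Module.Basis ι ℝ (mSub μ)} (he : ∀ i j, h.g (e i) (e j) = if i = j then 1 else 0)
    {ψ φ : G → h.Spinor} (hψ : IsSmooth n ℂ ψ) (hφ : IsSmooth n ℂ φ) (x : G) :
    fockInner h.herm (dirac h h.lcConnection hc ψ x) (φ x) =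
      fockInner h.herm (ψ x) (dirac h h.lcConnection hc φ x) -
        ∑ i, leftDeriv ℂ (fun y ↦ fockInner h.herm (ψ y) (h.kappa (e i) (φ y))) x
          (e i : LieAlg n G) := by
  have hk : ∀ X ξ η, fockInner h.herm (h.kappa X ξ) η = -fockInner h.herm ξ (h.kappa X η) :=
    fun X ↦ fockInner_cliff h.herm_conj_symm _
  have hsk : ∀ X, ∀ U V : h.MJ, h.herm (h.complexify (h.lcTensor X) (hc 1 X) U) V =
      -h.herm U (h.complexify (h.lcTensor X) (hc 1 X) V) := fun X ↦
    h.herm_complexify_skew (hc 1 X) (h.lcTensor_skew X)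
  have h0 : ∑ i, fockInner h.herm (ψ x) (h.kappa (h.lcTensor (e i) (e i)) (φ x)) = 0 := by
    let κL : mSub μ →ₗ[ℝ] h.Spinor →ₗ[ℂ] h.Spinor :=
      { toFun := h.kappa, map_add' := h.kappa_add, map_smul' := h.kappa_smul }
    have h1 : ∑ i, κL (h.lcTensor (e i) (e i)) = 0 := by
      rw [← map_sum, sum_lcTensor_eq_zero he, map_zero]
    rw [← map_sum, ← LinearMap.sum_apply]
    exact (congrArg (fun T : h.Spinor →ₗ[ℂ] h.Spinor ↦ fockInner h.herm (ψ x) (T (φ x))) h1).trans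
      (by simp)
  rw [dirac_eq_sum h _ hc he ψ, dirac_eq_sum h _ hc he φ, map_sum, map_sum, LinearMap.sum_apply,
    -- The vanishing sum `h0` is inserted because the identity holds term by term only with the
    -- commutator terms included.
    ← Finset.sum_sub_distrib, ← add_zero (∑ i, (_ - _)), ← h0, ← Finset.sum_add_distrib]
  refine Finset.sum_congr rfl fun i _ ↦ ?_
  have h2 := leftDeriv_sesq (fockInner h.herm) hψ (hφ.comp_linearMap (h.kappa (e i))) x
    (e i : LieAlg n G)
  have h3 := linearMap_leftDerivVec (h.kappa (e i)) hφ x (e i : LieAlg n G)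
  have h4 := extDer_cliff (hsk (e i)) (h.toMJ (e i)) (φ x)
  have h5 := fockInner_extDer (hsk (e i)) (ψ x) (h.kappa (e i) (φ x))
  have h6 := congrArg (fockInner h.herm (ψ x)) h4
  rw [map_add] at h6
  rw [h2, ← h3, hk]
  unfold spinorConnection
  simp only [map_add, LinearMap.add_apply]
  have h7 : fockInner h.herm (ψ x) (extDer (h.complexify (h.lcTensor (e i)) (hc 1 (e i)))
      (h.kappa (e i) (φ x))) =
    fockInner h.herm (ψ x) (h.kappa (h.lcTensor (e i) (e i)) (φ x)) +
      fockInner h.herm (ψ x) (h.kappa (e i)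
        (extDer (h.complexify (h.lcTensor (e i)) (hc 1 (e i))) (φ x))) := h6
  have h8 : ∀ H, extDer (h.complexify (h.lcConnection.L x (e i)) H) =
    extDer (h.complexify (h.lcTensor (e i)) (hc 1 (e i))) := fun _ ↦ rfl
  rw [h8, h5, h7]
  ring

theorem isFormallySelfAdjoint_dirac [MeasurableSpace G] [BorelSpace G]
    (ν : MeasureTheory.Measure G) [ν.IsHaarMeasure] (χ : stab μ →ₜ* Circle) :
    IsFormallySelfAdjoint h ν χ (dirac h h.lcConnection hc) := by
  refine ⟨fun ψ hψ ↦ isSpinorField_dirac hc hψ, fun ψ φ hψ hφ ↦ ?_⟩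
  obtain ⟨e, he⟩ := exists_orthonormal_basis h.g_symm h.g_pos
  have hint : ∀ {f : G → ℂ}, ContMDiff (𝓡 n) 𝓘(ℝ, ℂ) ∞ f → MeasureTheory.Integrable f ν :=
    fun hf ↦ hf.continuous.integrable_of_hasCompactSupport (HasCompactSupport.of_compactSpace _)
  have hs : ∀ i, ContMDiff (𝓡 n) 𝓘(ℝ, ℂ) ∞
      fun y ↦ fockInner h.herm (ψ y) (h.kappa (e i) (φ y)) := fun i ↦
    contMDiff_sesq _ hψ.1 (hφ.1.comp_linearMap _)
  unfold AlmostHermitian.l2Inner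
  simp only [fockInner_dirac hc he hψ.1 hφ.1]
  rw [MeasureTheory.integral_sub (hint (contMDiff_sesq _ hψ.1 (isSmooth_dirac hc hφ.1)))
    (MeasureTheory.integrable_finsetSum _ fun i _ ↦ hint (contMDiff_leftDeriv (hs i) _)),
    MeasureTheory.integral_finsetSum _ fun i _ ↦ hint (contMDiff_leftDeriv (hs i) _)]
  simp only [integral_leftDeriv ν (hs _), Finset.sum_const_zero, sub_zero]

end LeviCivita

end DiracOperator

end CoadjointDirac

end

theorem corollary7p4 {n : ℕ} {G : Type*} [TopologicalSpace G]
    [ChartedSpace (EuclideanSpace ℝ (Fin n)) G] [Group G] [LieGroup (𝓡 n) ∞ G]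
    [T2Space G] [CompactSpace G] [ConnectedSpace G]
    [LieAlgebra.IsSemisimple ℝ (CoadjointDirac.LieAlg n G)]
    [MeasurableSpace G] [BorelSpace G] (ν : MeasureTheory.Measure G) [ν.IsHaarMeasure]
    (μ : Module.Dual ℝ (CoadjointDirac.LieAlg n G)) :
    (∃! h : CoadjointDirac.AlmostHermitian μ, h.IsCanonicalKahler) ∧
    ∀ h : CoadjointDirac.AlmostHermitian μ, h.IsCanonicalKahler →
      (∃! c : CoadjointDirac.Connection μ, c.IsLeviCivita h) ∧
      ∀ c : CoadjointDirac.Connection μ, c.IsLeviCivita h →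
        c.CommutesWithJ h ∧
        ∃ hc : c.TensorCommutesWithJ h, ∀ χ : CoadjointDirac.stab μ →ₜ* Circle,
          CoadjointDirac.IsFormallySelfAdjoint h ν χ (CoadjointDirac.dirac h c hc) := by
  refine ⟨CoadjointDirac.existsUnique_isCanonicalKahler μ, fun h hh ↦
    ⟨h.existsUnique_isLeviCivita, fun c hc ↦ ⟨hh.commutesWithJ hc, hh.tensorCommutesWithJ hc, ?_⟩⟩⟩
  -- Uniqueness replaces an arbitrary Levi-Civita connection by the one with constant tensor.
  obtain rfl := CoadjointDirac.AlmostHermitian.eq_lcConnection hc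
  exact CoadjointDirac.isFormallySelfAdjoint_dirac _ ν
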